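/- **Theorem 1.2 (Bulk-edge correspondence for Dirac).** Let $V:\mathbb R\to\mathbb R$ be a locally integrable $1$-periodic function, let $L>0$, and let $\chi\in L^\infty(\mathbb R,\mathbb R)$ satisfy $\chi(x)=1$ for $x<-L$ and $\chi(x)=0$ for $x>L$. Let $\sigma_1,\sigma_2,\sigma_3$ be the Pauli matrices, and consider on $L^2(\mathbb R,\mathbb C^2)$, for $t\in\mathbb R$, the bulk and the domain wall Dirac operators $$\mathcal D(t)=-i\partial_x\sigma_3+e^{-i\pi t\sigma_3}\big(V(x)\sigma_1\big)e^{i\pi t\sigma_3},\qquad \mathcal D^\sharp_\chi(t)=\mathcal D(0)\chi+\mathcal D(t)(1-\chi)=-i\partial_x\sigma_3+\chi V\sigma_1+(1-\chi)e^{-i\pi t\sigma_3}\big(V\sigma_1\big)e^{i\pi t\sigma_3},$$ each with domain the set of locally absolutely continuous $\mathbf u\in L^2$ whose image under the differential expression is in $L^2$ (this domain is $H^1(\mathbb R,\mathbb C^2)$ if $V\in L^2_{\rm loc}$). Let $g\subset\mathbb R$ be an open gap of $\mathcal D(0)$, that is, a connected component of $\mathbb R\setminus\sigma(\mathcal D(0))$.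 For $E\in g$, let $\mathcal L^\pm_t(E)$ and $\mathcal L^{\sharp,\pm}_{\chi,t}(E)$ be the spaces of solutions of $\mathcal D(t)\mathbf u=E\mathbf u$ and of $\mathcal D^\sharp_\chi(t)\mathbf u=E\mathbf u$ on $\mathbb R$ that are square integrable at $\pm\infty$. These are complex lines, and for every non-null $\mathbf u=(u^\uparrow,u^\downarrow)$ in one of them, $|u^\uparrow|=|u^\downarrow|$ vanishes nowhere; so $\theta[\mathcal L,x]:=u^\downarrow(x)/u^\uparrow(x)$, with any non-null $\mathbf u\in\mathcal L$, is a well-defined element of the unit circle for each such line $\mathcal L$. Then the following hold. 1. *Bulk index.* For all $E\in g$ and $x\in\mathbb R$, the maps $t\mapsto\theta[\mathcal L^+_t(E),x]$ and $t\mapsto\theta[\mathcal L^-_t(E),x]$, $t\in[0,1]$, are continuous closed curves in the unit circle with the same winding number $\mathcal B$ (the Maslov index), and $\mathcal B=1$. 2. *Edge index.* For all $E\in g$ and $x\in\mathbb R$, the map $t\mapsto\theta[\mathcal L^{\sharp,+}_{\chi,t}(E),x]\;\theta[\mathcal L^{\sharp,-}_{\chi,t}(E),x]^{-1}$, $t\in[0,1]$,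 is a continuous closed curve in the unit circle, and its winding number $\mathcal I^\sharp_\chi$ is $1$. 3. *Spectral flow.* Call a *branch of eigenvalues* a continuously differentiable function $E_k:(t_k^-,t_k^+)\to g$, $0\le t_k^-<t_k^+\le1$, such that $E_k(t)$ is an eigenvalue of $\mathcal D^\sharp_\chi(t)$ for all $t\in(t_k^-,t_k^+)$ and such that $E_k(t)$ tends to an edge of $g$ as $t\to t_k^-$ and as $t\to t_k^+$. For every $t\in[0,1]$ and every eigenvalue $E\in g$ of $\mathcal D^\sharp_\chi(t)$, there is exactly one branch with $E_k(t)=E$. Almost every $E\in g$ is regular, that is, a regular value of all branches. For every regular $E\in g$, there are finitely many pairs $(k,t)$ with $E_k(t)=E$, and $$\mathcal S^\sharp_\chi:=-\sum_k\ \sum_{t\in E_k^{-1}(\{E\})}\operatorname{sgn}E_k'(t)=1.$$ So $\mathcal B=\mathcal I^\sharp_\chi=\mathcal S^\sharp_\chi=1$ in every open gap of $\mathcal D(0)$, independently of $\chi$ and of $E\in g$. In addition, for all $t\in\mathbb R$, all eigenvalues of $\mathcal D^\sharp_\chi(t)$ are simple, and the corresponding eigenfunctions $\mathbf u$ are exponentially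 localised: there are $C$ and $c>0$ with $|\mathbf u(x)|\le Ce^{-c|x|}$ for almost all $x\in\mathbb R$. -/

import Mathlib

open MeasureTheory Filter Topology Set

noncomputable section

namespace DislocatedDirac

/-! ### Dirac operators on the line -/

/-- The space of two-component spinors, with its Hermitian inner product. For a spinor `v`, the
upper component is `v 0` and the lower component is `v 1`. -/
abbrev Spinor : Type := EuclideanSpace ℂ (Fin 2)

/-- The Hilbert space of square integrable spinor fields on the real line. -/
abbrev L2Spinor : Type := Lp Spinor 2 (volume : Measure ℝ)

/-- The first Pauli matrix. -/
def sigma1 : Matrix (Fin 2) (Fin 2) ℂ := !![0, 1; 1, 0]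

/-- The third Pauli matrix. -/
def sigma3 : Matrix (Fin 2) (Fin 2) ℂ := !![1, 0; 0, -1]

/-- The matrix potential `exp (-iπtσ₃) (V(x) σ₁) exp (iπtσ₃)` of the bulk Dirac operator. -/
def bulkPotential (V : ℝ → ℝ) (t x : ℝ) : Matrix (Fin 2) (Fin 2) ℂ :=
  NormedSpace.exp ((-(Complex.I * Real.pi * t) : ℂ) • sigma3) * ((V x : ℂ) • sigma1) *
    NormedSpace.exp ((Complex.I * Real.pi * t : ℂ) • sigma3)

/-- The matrix potential of the domain wall operator `D(0) χ + D(t) (1 - χ)`. -/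
def wallPotential (V χ : ℝ → ℝ) (t x : ℝ) : Matrix (Fin 2) (Fin 2) ℂ :=
  (χ x : ℂ) • bulkPotential V 0 x + ((1 - χ x : ℝ) : ℂ) • bulkPotential V t x

/-- `u` is locally absolutely continuous, with derivative (almost everywhere, and in the weak
sense) the locally integrable function `w`. -/
def HasLocalDeriv (u w : ℝ → Spinor) : Prop :=
  LocallyIntegrable w ∧ ∀ a b : ℝ, u b - u a = ∫ s in a..b, w s

/-- The differential expression `-i σ₃ u' + Q u` at `x`, where `w` stands for `u'`. -/
def diracExpr (Q : ℝ → Matrix (Fin 2) (Fin 2) ℂ) (u w : ℝ → Spinor) (x : ℝ) : Spinor :=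
  (-Complex.I) • Matrix.toEuclideanLin sigma3 (w x) + Matrix.toEuclideanLin (Q x) (u x)

lemma HasLocalDeriv.intervalIntegrable {u w : ℝ → Spinor} (h : HasLocalDeriv u w) (a b : ℝ) :
    IntervalIntegrable w volume a b :=
  (h.1.integrableOn_isCompact isCompact_uIcc).intervalIntegrable

lemma HasLocalDeriv.zero : HasLocalDeriv 0 0 :=
  ⟨locallyIntegrable_zero, fun a b => by simp⟩

lemma HasLocalDeriv.add {u w u' w' : ℝ → Spinor} (h : HasLocalDeriv u w)
    (h' : HasLocalDeriv u' w') : HasLocalDeriv (u + u') (w + w') := by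
  refine ⟨h.1.add h'.1, fun a b => ?_⟩
  have i1 : IntervalIntegrable w volume a b := h.intervalIntegrable a b
  have i2 : IntervalIntegrable w' volume a b := h'.intervalIntegrable a b
  simp only [Pi.add_apply]
  rw [intervalIntegral.integral_add i1 i2, ← h.2, ← h'.2]
  abel

lemma HasLocalDeriv.smul {u w : ℝ → Spinor} (c : ℂ) (h : HasLocalDeriv u w) :
    HasLocalDeriv (c • u) (c • w) := by
  refine ⟨h.1.smul c, fun a b => ?_⟩
  simp only [Pi.smul_apply]
  rw [intervalIntegral.integral_smul, ← h.2, smul_sub]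

lemma HasLocalDeriv.continuous {u w : ℝ → Spinor} (h : HasLocalDeriv u w) : Continuous u := by
  have hu : u = fun x => u 0 + ∫ s in (0 : ℝ)..x, w s := by
    funext x
    rw [← h.2]
    abel
  rw [hu]
  exact continuous_const.add
    (intervalIntegral.continuous_primitive (fun a b => h.intervalIntegrable a b) 0)

lemma diracExpr_zero (Q : ℝ → Matrix (Fin 2) (Fin 2) ℂ) (x : ℝ) : diracExpr Q 0 0 x = 0 := by
  simp [diracExpr]

lemma diracExpr_add (Q : ℝ → Matrix (Fin 2) (Fin 2) ℂ) (u w u' w' : ℝ → Spinor) (x : ℝ) :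
    diracExpr Q (u + u') (w + w') x = diracExpr Q u w x + diracExpr Q u' w' x := by
  simp only [diracExpr, Pi.add_apply, map_add, smul_add]
  abel

lemma diracExpr_smul (Q : ℝ → Matrix (Fin 2) (Fin 2) ℂ) (c : ℂ) (u w : ℝ → Spinor) (x : ℝ) :
    diracExpr Q (c • u) (c • w) x = c • diracExpr Q u w x := by
  simp only [diracExpr, Pi.smul_apply, map_smul, smul_add]
  rw [smul_comm]

/-- The graph of the Dirac operator `-i σ₃ ∂ₓ + Q`: the pairs `(f, h)` of `L²` functions such that
`f` has a locally absolutely continuous representative `u` with `-i σ₃ u' + Q u = h`. -/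
def diracGraph (Q : ℝ → Matrix (Fin 2) (Fin 2) ℂ) : Submodule ℂ (L2Spinor × L2Spinor) where
  carrier := {p | ∃ u w : ℝ → Spinor, HasLocalDeriv u w ∧ p.1 =ᵐ[volume] u ∧
    p.2 =ᵐ[volume] diracExpr Q u w}
  zero_mem' := by
    refine ⟨0, 0, HasLocalDeriv.zero, Lp.coeFn_zero _ _ _, ?_⟩
    filter_upwards [Lp.coeFn_zero Spinor 2 (volume : Measure ℝ)] with x hx
    rw [diracExpr_zero]
    exact hx
  add_mem' := by
    rintro p q ⟨u, w, h, h1, h2⟩ ⟨u', w', h', h1', h2'⟩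
    refine ⟨u + u', w + w', h.add h', ?_, ?_⟩
    · filter_upwards [Lp.coeFn_add p.1 q.1, h1, h1'] with x hx hx1 hx2
      rw [Prod.fst_add, hx, Pi.add_apply, hx1, hx2, Pi.add_apply]
    · filter_upwards [Lp.coeFn_add p.2 q.2, h2, h2'] with x hx hx1 hx2
      rw [Prod.snd_add, hx, Pi.add_apply, hx1, hx2, diracExpr_add]
  smul_mem' := by
    rintro c p ⟨u, w, h, h1, h2⟩
    refine ⟨c • u, c • w, h.smul c, ?_, ?_⟩
    · filter_upwards [Lp.coeFn_smul c p.1, h1] with x hx hx1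
      rw [Prod.smul_fst, hx, Pi.smul_apply, hx1, Pi.smul_apply]
    · filter_upwards [Lp.coeFn_smul c p.2, h2] with x hx hx1
      rw [Prod.smul_snd, hx, Pi.smul_apply, hx1, diracExpr_smul]

/-- `diracGraph Q` is the graph of an operator. -/
lemma diracGraph_functional (Q : ℝ → Matrix (Fin 2) (Fin 2) ℂ) :
    ∀ p ∈ diracGraph Q, p.1 = 0 → p.2 = 0 := by
  rintro p ⟨u, w, h, h1, h2⟩ h0
  have hu : u = 0 := by
    refine (Continuous.ae_eq_iff_eq volume h.continuous continuous_const).1 ?_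
    rw [h0] at h1
    exact h1.symm.trans (Lp.coeFn_zero Spinor 2 (volume : Measure ℝ))
  have hw : w =ᵐ[volume] 0 := by
    filter_upwards [LocallyIntegrable.ae_hasDerivAt_integral h.1] with x hx
    have h3 : (fun b => ∫ s in (0 : ℝ)..b, w s) = fun _ => (0 : Spinor) := by
      funext b
      rw [← h.2, hu]
      simp
    have h4 := hx 0
    rw [h3] at h4
    exact h4.unique (hasDerivAt_const x (0 : Spinor))
  apply (Lp.eq_zero_iff_ae_eq_zero).2
  filter_upwards [h2, hw] with x hx hx'
  rw [hx, hu]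
  simp [diracExpr, hx']

/-- The Dirac operator `-i σ₃ ∂ₓ + Q` on `L²(ℝ, ℂ²)`, with domain the locally absolutely
continuous `u ∈ L²` such that `-i σ₃ u' + Q u ∈ L²`. (For `Q` uniformly locally square
integrable, for instance bounded, this domain is the Sobolev space `H¹(ℝ, ℂ²)`.) -/
def diracOp (Q : ℝ → Matrix (Fin 2) (Fin 2) ℂ) : L2Spinor →ₗ.[ℂ] L2Spinor :=
  (diracGraph Q).toLinearPMap

lemma diracOp_graph (Q : ℝ → Matrix (Fin 2) (Fin 2) ℂ) : (diracOp Q).graph = diracGraph Q :=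
  Submodule.toLinearPMap_graph_eq _ (diracGraph_functional Q)

/-! ### Resolvent set, gaps, eigenvalues -/

/-- `z` belongs to the resolvent set of `A`: `A - z` is a bijection from the domain of `A` onto
the whole space, with a bounded inverse `R`. -/
def InResolventSet (A : L2Spinor →ₗ.[ℂ] L2Spinor) (z : ℂ) : Prop :=
  ∃ R : L2Spinor →L[ℂ] L2Spinor,
    (∀ h : L2Spinor, ∃ hd : R h ∈ A.domain, A ⟨R h, hd⟩ - z • R h = h) ∧
    ∀ f : A.domain, R (A f - z • (f : L2Spinor)) = f

/-- `g` is an (open) gap of `A`: a connected component of the complement in `ℝ` of the spectrum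
of `A`. -/
def IsGap (A : L2Spinor →ₗ.[ℂ] L2Spinor) (g : Set ℝ) : Prop :=
  ∃ E : ℝ, InResolventSet A E ∧ g = connectedComponentIn {e : ℝ | InResolventSet A e} E

/-- The kernel of `A - z`. -/
def eigenspace (A : L2Spinor →ₗ.[ℂ] L2Spinor) (z : ℂ) : Submodule ℂ L2Spinor where
  carrier := {f | (f, z • f) ∈ A.graph}
  zero_mem' := by
    have := A.graph.zero_mem
    rwa [mem_ofPred_eq, smul_zero]
  add_mem' := by
    intro f h hf hh
    have := A.graph.add_mem hf hh
    simpa [smul_add] using this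
  smul_mem' := by
    intro c f hf
    have := A.graph.smul_mem c hf
    simpa [smul_comm c z f] using this

/-- `z` is an eigenvalue of `A`. -/
def IsEigenvalue (A : L2Spinor →ₗ.[ℂ] L2Spinor) (z : ℂ) : Prop := eigenspace A z ≠ ⊥

/-! ### Solutions of the differential equation -/

/-- The space of solutions of the differential equation `-i σ₃ u' + Q u = E u` on `ℝ`
(locally absolutely continuous functions satisfying the equation almost everywhere). -/
def solutions (Q : ℝ → Matrix (Fin 2) (Fin 2) ℂ) (E : ℝ) : Submodule ℂ (ℝ → Spinor) where
  carrier := {u | ∃ w : ℝ → Spinor, HasLocalDeriv u w ∧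
    ∀ᵐ x : ℝ, diracExpr Q u w x = (E : ℂ) • u x}
  zero_mem' := ⟨0, HasLocalDeriv.zero, by simp [diracExpr_zero]⟩
  add_mem' := by
    rintro u u' ⟨w, h, h1⟩ ⟨w', h', h1'⟩
    refine ⟨w + w', h.add h', ?_⟩
    filter_upwards [h1, h1'] with x hx hx'
    rw [diracExpr_add, hx, hx', Pi.add_apply, smul_add]
  smul_mem' := by
    rintro c u ⟨w, h, h1⟩
    refine ⟨c • w, h.smul c, ?_⟩
    filter_upwards [h1] with x hx
    rw [diracExpr_smul, hx, Pi.smul_apply, smul_comm]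

/-- The functions that are square integrable on `s`. -/
def squareIntegrableOn (s : Set ℝ) : Submodule ℂ (ℝ → Spinor) where
  carrier := {u | MemLp u 2 (volume.restrict s)}
  zero_mem' := MemLp.zero
  add_mem' := fun h h' => MemLp.add h h'
  smul_mem' := fun c _ h => MemLp.const_smul h c

/-- The space `ℒ⁺` of solutions that are square integrable at `+∞`. -/
def decayPlus (Q : ℝ → Matrix (Fin 2) (Fin 2) ℂ) (E : ℝ) : Submodule ℂ (ℝ → Spinor) :=
  solutions Q E ⊓ squareIntegrableOn (Ici 0)

/-- The space `ℒ⁻` of solutions that are square integrable at `-∞`. -/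
def decayMinus (Q : ℝ → Matrix (Fin 2) (Fin 2) ℂ) (E : ℝ) : Submodule ℂ (ℝ → Spinor) :=
  solutions Q E ⊓ squareIntegrableOn (Iic 0)

open Classical in
/-- `θ[ℒ, x] = u↓(x) / u↑(x)`, where `u` is a non-null element of `ℒ`. This is meaningful when
`HasPhase ℒ` holds; the value does then not depend on `u`. -/
def theta (ℒ : Submodule ℂ (ℝ → Spinor)) (x : ℝ) : ℂ :=
  if h : ∃ u ∈ ℒ, u ≠ 0 then h.choose x 1 / h.choose x 0 else 0

/-- The space `ℒ` is a line, and for every non-null `u` in it, `u↑` and `u↓` have the same modulus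
and do not vanish; so `θ[ℒ, ·]` is well defined, with values in the unit circle. -/
def HasPhase (ℒ : Submodule ℂ (ℝ → Spinor)) : Prop :=
  Module.finrank ℂ ℒ = 1 ∧ ∀ u ∈ ℒ, u ≠ 0 → ∀ x, u x 0 ≠ 0 ∧ ‖u x 1‖ = ‖u x 0‖

/-! ### The three indices -/

/-- On `[0, 1]`, `u` is a closed curve in the unit circle, continuous, with winding number `k`:
it has a continuous lifting `α`, that is `u = exp (iα)`, and `α(1) - α(0) = 2πk`. -/
def HasWindingNumber (u : ℝ → ℂ) (k : ℤ) : Prop :=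
  ∃ α : ℝ → ℝ, ContinuousOn α (Icc 0 1) ∧
    (∀ t ∈ Icc (0 : ℝ) 1, u t = Complex.exp (Complex.I * α t)) ∧ α 1 - α 0 = 2 * Real.pi * k

/-- The bulk index of `t ↦ D(t)` in the gap `g` is well defined and equal to `k`: it is the common
Maslov index of `ℒ⁺` and of `ℒ⁻`, that is the winding number of `t ↦ θ[ℒ^±_t(E), x]`, whatever
`E ∈ g` and `x`. -/
def HasBulkIndex (V : ℝ → ℝ) (g : Set ℝ) (k : ℤ) : Prop :=
  ∀ E ∈ g,
    (∀ t, HasPhase (decayPlus (bulkPotential V t) E) ∧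
      HasPhase (decayMinus (bulkPotential V t) E)) ∧
    ∀ x, HasWindingNumber (fun t => theta (decayPlus (bulkPotential V t) E) x) k ∧
      HasWindingNumber (fun t => theta (decayMinus (bulkPotential V t) E) x) k

/-- The edge index of the domain wall family in the gap `g` is well defined and equal to `k`: it
is the winding number of `t ↦ θ[ℒ⁺_t(E), x] θ[ℒ⁻_t(E), x]⁻¹`, whatever `E ∈ g` and `x`, where now
`ℒ^±_t(E)` are the spaces of solutions of the domain wall equation. -/
def HasEdgeIndex (V χ : ℝ → ℝ) (g : Set ℝ) (k : ℤ) : Prop :=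
  ∀ E ∈ g,
    (∀ t, HasPhase (decayPlus (wallPotential V χ t) E) ∧
      HasPhase (decayMinus (wallPotential V χ t) E)) ∧
    ∀ x, HasWindingNumber (fun t => theta (decayPlus (wallPotential V χ t) E) x *
      (theta (decayMinus (wallPotential V χ t) E) x)⁻¹) k

/-- The domain wall Dirac operator `D(0) χ + D(t) (1 - χ)`. -/
def wallOp (V χ : ℝ → ℝ) (t : ℝ) : L2Spinor →ₗ.[ℂ] L2Spinor := diracOp (wallPotential V χ t)

/-- A branch of eigenvalues of the domain wall family in the gap `g`: a continuously
differentiable function on an interval `(left, right) ⊆ [0, 1]`, whose value at `t` is an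
eigenvalue in `g` of the operator at `t`, and which tends to edges of the gap at both ends of the
interval. Outside of the interval, the value is `0` by convention, so that a branch is determined
by its interval and its values there. -/
@[ext]
structure Branch (V χ : ℝ → ℝ) (g : Set ℝ) where
  left : ℝ
  right : ℝ
  energy : ℝ → ℝ
  left_nonneg : 0 ≤ left
  left_lt_right : left < right
  right_le_one : right ≤ 1
  contDiffOn : ContDiffOn ℝ 1 energy (Ioo left right)
  mem_gap : ∀ t ∈ Ioo left right, energy t ∈ g
  isEigenvalue : ∀ t ∈ Ioo left right, IsEigenvalue (wallOp V χ t) (energy t)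
  tendsto_left : ∃ e ∈ frontier g, Tendsto energy (𝓝[>] left) (𝓝 e)
  tendsto_right : ∃ e ∈ frontier g, Tendsto energy (𝓝[<] right) (𝓝 e)
  eq_zero : ∀ t ∉ Ioo left right, energy t = 0

/-- The times at which a branch crosses the energy `E`. -/
def Branch.crossings {V χ : ℝ → ℝ} {g : Set ℝ} (B : Branch V χ g) (E : ℝ) : Set ℝ :=
  {t | t ∈ Ioo B.left B.right ∧ B.energy t = E}

/-- The energy `E` is regular for the spectrum of the domain wall family: it is a regular value of
all the branches of eigenvalues. -/
def IsRegularEnergy (V χ : ℝ → ℝ) (g : Set ℝ) (E : ℝ) : Prop :=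
  ∀ B : Branch V χ g, ∀ t ∈ B.crossings E, deriv B.energy t ≠ 0

/-- The net number of branches that cross the energy `E` downwards. -/
def spectralFlowAt (V χ : ℝ → ℝ) (g : Set ℝ) (E : ℝ) : ℤ :=
  -∑ᶠ B : Branch V χ g, ∑ᶠ t ∈ B.crossings E, ((SignType.sign (deriv B.energy t) : SignType) : ℤ)

/-- The spectral flow of the domain wall family in the gap `g` is well defined and equal to `k`:
through each eigenvalue in `g` passes exactly one branch, almost every energy in `g` is regular,
and for each regular energy there are finitely many crossings and the flow is `k`. -/
def HasSpectralFlow (V χ : ℝ → ℝ) (g : Set ℝ) (k : ℤ) : Prop :=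
  (∀ t ∈ Icc (0 : ℝ) 1, ∀ E ∈ g, IsEigenvalue (wallOp V χ t) E →
    ∃! B : Branch V χ g, t ∈ B.crossings E) ∧
  (∀ᵐ E : ℝ, E ∈ g → IsRegularEnergy V χ g E) ∧
  ∀ E ∈ g, IsRegularEnergy V χ g E →
    {p : Branch V χ g × ℝ | p.2 ∈ p.1.crossings E}.Finite ∧ spectralFlowAt V χ g E = k

/-- The function `f` is exponentially localised. -/
def ExpLocalised (f : L2Spinor) : Prop :=
  ∃ C c : ℝ, 0 < c ∧ ∀ᵐ x : ℝ, ‖f x‖ ≤ C * Real.exp (-c * |x|)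

end DislocatedDirac

end

open DislocatedDirac

open MeasureTheory Filter Topology Set

noncomputable section

namespace DislocatedDirac

/-! The equation is the system u' = iEu - i q̄ v, v' = iqu - iEv, with q = `rot t` · V in the bulk
and q = χV + `rot t` · (1 - χ)V for the wall, where `rot t` = exp(2πit). The Wronskian of two
solutions at the same energy is constant, and (u, v) ↦ (v̄, ū) preserves the solutions at a real
energy. So a solution that is square integrable at one end has |u| = |v|, and two of them at the
same end are proportional: this gives the lines, their phases and the simplicity of eigenvalues
(`IsSol.norm_eq`, `IsSol.eq_smul_of_sqInt`, `hasPhase_of_sqInt`). In a gap, the resolvent yields a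
decaying solution, which forces the transfer matrix over one period to be hyperbolic
(`exists_decaying_of_inResolventSet`, `one_lt_re_sq_of_decaying`); its two eigenvectors are the
initial data of the decaying bulk solutions, and they are C¹ in the energy.

Multiplying q by w with |w| = 1 multiplies v by w. So the bulk phases at time t are `rot t` times
those at time 0, and the bulk index is 1. The wall equation is the rotated bulk equation on the
right of N and the unrotated one on the left of -N. The phase of the right-decaying line therefore
turns once at N, that of the left-decaying line is fixed at -N, and transport to another point adds
a Prüfer angle which is continuous in t and equal at t = 0 and t = 1 (`IsSol.phase_eq`,
`Dislocation.edge_index`).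

For the spectral flow, E is an eigenvalue exactly when the two phases agree at N, that is when
`Dislocation.totalAngle` is a multiple of 2π. This angle is C¹, gains 2π over a period, and strictly
increases with the energy by the identity of Green (`Dislocation.deriv_totalAngle_pos`). Its levels
in 2πℤ are thus graphs of C¹ functions of t that run between edges of the gap, and none of them
meets t = 0, where E is in the resolvent set. The slope of a level has the sign opposite to that of
the time derivative of the angle, so at a regular energy the flow counts with signs the integer
crossings of a function that increases by one (`sum_sign_deriv`). Regularity of almost every energy
is the one-dimensional Sard theorem, and exponential localisation comes from the Floquet multipliers
of the two tails. -/

/-! ### Absolutely continuous functions and their derivatives -/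

/-- `f` is locally absolutely continuous, with derivative the locally integrable function `f'`. -/
def IsPrimitive (f f' : ℝ → ℂ) : Prop :=
  LocallyIntegrable f' ∧ ∀ a b : ℝ, f b - f a = ∫ x in a..b, f' x

lemma LocallyIntegrable.intervalIntegrable' {E : Type*} [NormedAddCommGroup E] {f : ℝ → E}
    (h : LocallyIntegrable f) (a b : ℝ) : IntervalIntegrable f volume a b :=
  (h.integrableOn_isCompact isCompact_uIcc).intervalIntegrable

lemma LocallyIntegrable.mul_continuous' {f g : ℝ → ℂ} (h : LocallyIntegrable f)
    (hg : Continuous g) : LocallyIntegrable (fun x => f x * g x) := by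
  rw [locallyIntegrable_iff] at h ⊢
  intro k hk
  exact (h k hk).mul_continuousOn hg.continuousOn hk

lemma LocallyIntegrable.continuous_mul' {f g : ℝ → ℂ} (h : LocallyIntegrable f)
    (hg : Continuous g) : LocallyIntegrable (fun x => g x * f x) := by
  simpa only [mul_comm] using LocallyIntegrable.mul_continuous' h hg

lemma LocallyIntegrable.conj' {f : ℝ → ℂ} (h : LocallyIntegrable f) :
    LocallyIntegrable (fun x => (starRingEnd ℂ) (f x)) := by
  rw [locallyIntegrable_iff] at h ⊢
  intro k hk
  have h1 := h k hk
  refine ⟨Complex.continuous_conj.comp_aestronglyMeasurable h1.1, ?_⟩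
  exact h1.2.congr' (Eventually.of_forall fun x => by simp)

lemma absolutelyContinuousOnInterval_const {E : Type*} [NormedAddCommGroup E] (c : E) (a b : ℝ) :
    AbsolutelyContinuousOnInterval (fun _ : ℝ => c) a b :=
  (LipschitzWith.const c).lipschitzOnWith (K := 0) |>.absolutelyContinuousOnInterval

/-- Real and imaginary parts are treated separately, then recombined as multiples of 1 and i. -/
lemma absolutelyContinuousOnInterval_integral {f : ℝ → ℂ} (h : LocallyIntegrable f)
    (a b c : ℝ) (hc : c ∈ uIcc a b) :
    AbsolutelyContinuousOnInterval (fun x => ∫ v in c..x, f v) a b := by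
  have hi : ∀ x y, IntervalIntegrable f volume x y := LocallyIntegrable.intervalIntegrable' h
  have hre : IntervalIntegrable (fun x => (f x).re) volume a b :=
    ⟨(hi a b).1.re, (hi a b).2.re⟩
  have him : IntervalIntegrable (fun x => (f x).im) volume a b :=
    ⟨(hi a b).1.im, (hi a b).2.im⟩
  have h1 := (hre.absolutelyContinuousOnInterval_intervalIntegral hc).fun_smul
    (absolutelyContinuousOnInterval_const (1 : ℂ) a b)
  have h2 := (him.absolutelyContinuousOnInterval_intervalIntegral hc).fun_smul
    (absolutelyContinuousOnInterval_const Complex.I a b)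
  convert! h1.fun_add h2 using 2 with x
  apply Complex.ext
  · have := intervalIntegral.intervalIntegral_eq_integral_uIoc f c x volume
    have e := Complex.reCLM.intervalIntegral_comp_comm (hi c x)
    simp only [Complex.reCLM_apply] at e
    simp [e]
  · have e := Complex.imCLM.intervalIntegral_comp_comm (hi c x)
    simp only [Complex.imCLM_apply] at e
    simp [e]

open scoped NNReal in
lemma AbsolutelyContinuousOnInterval.of_dist_le {f g : ℝ → ℂ} {a b : ℝ} {K : ℝ≥0}
    (hf : AbsolutelyContinuousOnInterval f a b)
    (hK : ∀ x ∈ uIcc a b, ∀ y ∈ uIcc a b, dist (g x) (g y) ≤ K * dist (f x) (f y)) :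
    AbsolutelyContinuousOnInterval g a b := by
  rw [absolutelyContinuousOnInterval_iff] at hf ⊢
  intro ε hε
  obtain ⟨δ, hδ, h⟩ := hf (ε / (K + 1)) (by positivity)
  refine ⟨δ, hδ, fun E hE hs => ?_⟩
  have h1 := h E hE hs
  calc ∑ i ∈ Finset.range E.1, dist (g (E.2 i).1) (g (E.2 i).2)
      ≤ ∑ i ∈ Finset.range E.1, K * dist (f (E.2 i).1) (f (E.2 i).2) :=
        Finset.sum_le_sum fun i hi => hK _ (hE.1 i hi).1 _ (hE.1 i hi).2
    _ = K * ∑ i ∈ Finset.range E.1, dist (f (E.2 i).1) (f (E.2 i).2) := by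
        rw [Finset.mul_sum]
    _ ≤ (K + 1) * ∑ i ∈ Finset.range E.1, dist (f (E.2 i).1) (f (E.2 i).2) := by
        gcongr
        simp
    _ < (K + 1) * (ε / (K + 1)) := by gcongr
    _ = ε := by field_simp

/-- An absolutely continuous function is bounded on the interval, and `g` is Lipschitz on a closed
ball that contains its values. -/
lemma AbsolutelyContinuousOnInterval.comp_contDiff {f : ℝ → ℂ} {g : ℂ → ℂ} {a b : ℝ}
    (hf : AbsolutelyContinuousOnInterval f a b) (hg : ContDiff ℝ 1 g) :
    AbsolutelyContinuousOnInterval (fun x => g (f x)) a b := by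
  obtain ⟨C, hC⟩ := hf.exists_bound
  obtain ⟨K, hK⟩ := (hg.contDiffOn (s := Metric.closedBall 0 C)).exists_lipschitzOnWith
    (by decide) (convex_closedBall _ _) (isCompact_closedBall _ _)
  exact AbsolutelyContinuousOnInterval.of_dist_le hf fun x hx y hy =>
    hK.dist_le_mul _ (by simpa using hC _ hx) _ (by simpa using hC _ hy)

namespace IsPrimitive

variable {f f' g g' : ℝ → ℂ}

lemma intervalIntegrable (h : IsPrimitive f f') (a b : ℝ) : IntervalIntegrable f' volume a b :=
  LocallyIntegrable.intervalIntegrable' h.1 a b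

lemma eq_integral (h : IsPrimitive f f') (a : ℝ) : f = fun x => f a + ∫ s in a..x, f' s := by
  funext x
  rw [← h.2]
  ring

lemma ac (h : IsPrimitive f f') (a b : ℝ) : AbsolutelyContinuousOnInterval f a b := by
  rw [h.eq_integral a]
  exact (absolutelyContinuousOnInterval_const _ a b).fun_add
    (absolutelyContinuousOnInterval_integral h.1 a b a left_mem_uIcc)

lemma continuous (h : IsPrimitive f f') : Continuous f := by
  rw [h.eq_integral 0]
  exact continuous_const.add
    (intervalIntegral.continuous_primitive (fun a b => h.intervalIntegrable a b) 0)

lemma ae_hasDerivAt (h : IsPrimitive f f') : ∀ᵐ x, HasDerivAt f (f' x) x := by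
  filter_upwards [LocallyIntegrable.ae_hasDerivAt_integral h.1] with x hx
  rw [h.eq_integral 0]
  exact (hx 0).const_add _

/-- The difference between `f` and the integral of `f'` is absolutely continuous with derivative
zero almost everywhere, hence constant. The rules for products, exponentials and inverses all go
through this criterion. -/
lemma of_ac (h1 : ∀ a b, AbsolutelyContinuousOnInterval f a b) (h2 : LocallyIntegrable f')
    (h3 : ∀ᵐ x, HasDerivAt f (f' x) x) : IsPrimitive f f' := by
  refine ⟨h2, fun a b => ?_⟩
  have h4 := (h1 a b).fun_sub (absolutelyContinuousOnInterval_integral h2 a b a left_mem_uIcc)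
  obtain ⟨C, hC⟩ := h4.const_of_ae_hasDerivAt_zero (by
    filter_upwards [h3, LocallyIntegrable.ae_hasDerivAt_integral h2] with x hx hx' _
    simpa using hx.fun_sub (hx' a))
  have ha := hC a left_mem_uIcc
  have hb := hC b right_mem_uIcc
  simp only [intervalIntegral.integral_same, sub_zero] at ha
  rw [← ha] at hb
  linear_combination hb

lemma congr_ae (h : IsPrimitive f f') (h' : f' =ᵐ[volume] g') : IsPrimitive f g' := by
  refine ⟨(locallyIntegrable_congr h').1 h.1, fun a b => ?_⟩
  rw [h.2]
  exact intervalIntegral.integral_congr_ae (by filter_upwards [h'] with x hx _ using hx)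

lemma add (h : IsPrimitive f f') (h' : IsPrimitive g g') :
    IsPrimitive (fun x => f x + g x) (fun x => f' x + g' x) := by
  refine ⟨h.1.add h'.1, fun a b => ?_⟩
  rw [intervalIntegral.integral_add (h.intervalIntegrable a b) (h'.intervalIntegrable a b),
    ← h.2, ← h'.2]
  ring

lemma const_mul (c : ℂ) (h : IsPrimitive f f') :
    IsPrimitive (fun x => c * f x) (fun x => c * f' x) := by
  refine ⟨LocallyIntegrable.continuous_mul' h.1 continuous_const, fun a b => ?_⟩
  rw [intervalIntegral.integral_const_mul, ← h.2]
  ring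

lemma sub (h : IsPrimitive f f') (h' : IsPrimitive g g') :
    IsPrimitive (fun x => f x - g x) (fun x => f' x - g' x) := by
  have := h.add (h'.const_mul (-1))
  simpa only [neg_one_mul, ← sub_eq_add_neg] using this

lemma mul (h : IsPrimitive f f') (h' : IsPrimitive g g') :
    IsPrimitive (fun x => f x * g x) (fun x => f' x * g x + f x * g' x) := by
  refine of_ac (fun a b => ?_) ?_ ?_
  · simpa only [smul_eq_mul] using (h.ac a b).fun_smul (h'.ac a b)
  · exact (LocallyIntegrable.mul_continuous' h.1 h'.continuous).add
      (LocallyIntegrable.continuous_mul' h'.1 h.continuous)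
  · filter_upwards [h.ae_hasDerivAt, h'.ae_hasDerivAt] with x hx hx'
    exact hx.fun_mul hx'

lemma conj (h : IsPrimitive f f') :
    IsPrimitive (fun x => (starRingEnd ℂ) (f x)) (fun x => (starRingEnd ℂ) (f' x)) := by
  refine ⟨LocallyIntegrable.conj' h.1, fun a b => ?_⟩
  rw [← map_sub, h.2]
  simp only [intervalIntegral, map_sub, ← integral_conj]

lemma cexp (h : IsPrimitive f f') :
    IsPrimitive (fun x => Complex.exp (f x)) (fun x => Complex.exp (f x) * f' x) := by
  refine of_ac (fun a b => AbsolutelyContinuousOnInterval.comp_contDiff (h.ac a b) ?_) ?_ ?_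
  · exact Complex.contDiff_exp
  · exact LocallyIntegrable.continuous_mul' h.1 (Complex.continuous_exp.comp h.continuous)
  · filter_upwards [h.ae_hasDerivAt] with x hx
    exact hx.cexp

lemma inv (h : IsPrimitive f f') (h0 : ∀ x, f x ≠ 0) :
    IsPrimitive (fun x => (f x)⁻¹) (fun x => -f' x / f x ^ 2) := by
  have hc := h.continuous
  have hci : Continuous fun x => (f x)⁻¹ := hc.inv₀ h0
  refine of_ac (fun a b => ?_) ?_ ?_
  · obtain ⟨C, hC⟩ := (isCompact_uIcc (a := a) (b := b)).exists_bound_of_continuousOn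
      hci.continuousOn
    have hC0 : 0 ≤ C := (norm_nonneg _).trans (hC a left_mem_uIcc)
    -- Since |1/f| ≤ C on the interval, inversion is Lipschitz with constant C² on the values of
    -- `f`.
    refine AbsolutelyContinuousOnInterval.of_dist_le (K := ⟨C * C, by positivity⟩) (h.ac a b)
      fun x hx y hy => ?_
    have e : (f x)⁻¹ - (f y)⁻¹ = -((f x)⁻¹ * (f y)⁻¹ * (f x - f y)) := by
      have := h0 x; have := h0 y
      field_simp
      ring
    rw [dist_eq_norm, dist_eq_norm, e, norm_neg, norm_mul, norm_mul]
    change _ ≤ C * C * _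
    gcongr
    · exact hC x hx
    · exact hC y hy
  · have h2 : Continuous fun x => -((f x)⁻¹ ^ 2) := by fun_prop
    convert LocallyIntegrable.mul_continuous' h.1 h2 using 2 with x
    rw [div_eq_mul_inv, inv_pow]; ring
  · filter_upwards [h.ae_hasDerivAt] with x hx using hx.inv (h0 x)

lemma comp_add (h : IsPrimitive f f') (s : ℝ) :
    IsPrimitive (fun x => f (x + s)) (fun x => f' (x + s)) := by
  refine ⟨?_, fun a b => ?_⟩
  · have hm : MeasurePreserving (fun x : ℝ => x + s) volume volume :=
      measurePreserving_add_right volume s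
    rw [locallyIntegrable_iff]
    intro k hk
    have h1 := (locallyIntegrable_iff.1 h.1) _ (hk.image (continuous_id.add continuous_const :
      Continuous fun x : ℝ => x + s))
    have := (hm.integrableOn_comp_preimage
      (Homeomorph.addRight s).measurableEmbedding (f := f') (s := (fun x => x + s) '' k)).2 h1
    rwa [preimage_image_eq _ (add_left_injective s)] at this
  · rw [intervalIntegral.integral_comp_add_right, h.2]

end IsPrimitive

open Complex (I)
open scoped ComplexConjugate BoundedContinuousFunction

/-! ### Solutions of the Dirac system -/

/-- `(u, v)` is a solution of the Dirac equation with coefficient `q` and energy `z`. -/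
def IsSol (q : ℝ → ℂ) (z : ℂ) (u v : ℝ → ℂ) : Prop :=
  IsPrimitive u (fun x => I * z * u x - I * conj (q x) * v x) ∧
    IsPrimitive v (fun x => I * q x * u x - I * z * v x)

/-- The Wronskian of two pairs of functions. -/
def wronskian (u v u' v' : ℝ → ℂ) (x : ℝ) : ℂ := u x * v' x - v x * u' x

namespace IsSol

variable {q q' : ℝ → ℂ} {z z' : ℂ} {u v u' v' : ℝ → ℂ}

lemma smul (c : ℂ) (h : IsSol q z u v) :
    IsSol q z (fun x => c * u x) (fun x => c * v x) := by
  constructor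
  · convert h.1.const_mul c using 2; ring
  · convert h.2.const_mul c using 2; ring

lemma add (h : IsSol q z u v) (h' : IsSol q z u' v') :
    IsSol q z (fun x => u x + u' x) (fun x => v x + v' x) := by
  constructor
  · convert h.1.add h'.1 using 2; ring
  · convert h.2.add h'.2 using 2; ring

/-- The potential is Hermitian and off-diagonal, so conjugation exchanges the two equations. The
Wronskian of (v̄, ū) with (u, v) is the current |v|² - |u|². -/
lemma conj_swap (h : IsSol q z u v) :
    IsSol q (conj z) (fun x => conj (v x)) (fun x => conj (u x)) := by
  constructor
  · convert h.2.conj using 2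
    simp only [map_sub, map_mul, Complex.conj_I]; ring
  · convert h.1.conj using 2
    simp only [map_sub, map_mul, Complex.conj_I, Complex.conj_conj]; ring

lemma conj_swap_real {E : ℝ} (h : IsSol q E u v) :
    IsSol q E (fun x => conj (v x)) (fun x => conj (u x)) := by
  simpa using h.conj_swap

lemma comp_add (h : IsSol q z u v) (s : ℝ) :
    IsSol (fun x => q (x + s)) z (fun x => u (x + s)) (fun x => v (x + s)) :=
  ⟨h.1.comp_add s, h.2.comp_add s⟩

/-- Rotating the phase of the coefficient. -/
lemma rotate {w : ℂ} (hw : conj w * w = 1) (h : IsSol q z u v) :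
    IsSol (fun x => w * q x) z u (fun x => w * v x) := by
  constructor
  · convert h.1 using 2
    rw [map_mul]; linear_combination (-(I * conj (q _) * v _)) * hw
  · convert h.2.const_mul w using 2; ring

/-- Coefficients and energies may differ: the derivative only involves their differences. This
contains both the conservation law and the identity of Green. -/
lemma isPrimitive_wronskian (h : IsSol q z u v) (h' : IsSol q' z' u' v') :
    IsPrimitive (wronskian u v u' v') (fun x =>
      I * (z - z') * (u x * v' x + v x * u' x) + I * (conj (q' x) - conj (q x)) * (v x * v' x) +
        I * (q' x - q x) * (u x * u' x)) := by
  convert (h.1.mul h'.2).sub (h.2.mul h'.1) using 2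
  · rfl
  · ring

lemma wronskian_sub (h : IsSol q z u v) (h' : IsSol q' z' u' v') {x y : ℝ}
    (hq : ∀ s ∈ uIoc x y, q s = q' s) :
    wronskian u v u' v' y - wronskian u v u' v' x =
      I * (z - z') * ∫ s in x..y, (u s * v' s + v s * u' s) := by
  rw [(h.isPrimitive_wronskian h').2, ← intervalIntegral.integral_const_mul]
  refine intervalIntegral.integral_congr_ae (ae_of_all _ fun s hs => ?_)
  simp only [hq s hs]
  ring

lemma wronskian_eq (h : IsSol q z u v) (h' : IsSol q' z u' v') {x y : ℝ}
    (hq : ∀ s ∈ uIoc x y, q s = q' s) :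
    wronskian u v u' v' y = wronskian u v u' v' x := by
  have := h.wronskian_sub h' hq
  rwa [sub_self, mul_zero, zero_mul, sub_eq_zero] at this

lemma wronskian_const (h : IsSol q z u v) (h' : IsSol q z u' v') (x y : ℝ) :
    wronskian u v u' v' y = wronskian u v u' v' x :=
  h.wronskian_eq h' fun _ _ => rfl

end IsSol

/-! ### Square integrability -/

lemma eq_zero_of_integrableOn_const {S : Set ℝ} (hS : volume S = ⊤) {f : ℝ → ℂ} {c : ℂ}
    (hf : IntegrableOn f S) (h : ∀ x, f x = c) : c = 0 := by
  have : IntegrableOn (fun _ : ℝ => c) S := by simpa [funext h] using hf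
  rw [integrableOn_const_iff] at this
  simpa [hS] using this

/-- The pair `(u, v)` is square integrable on `S`. -/
def SqInt (S : Set ℝ) (u v : ℝ → ℂ) : Prop :=
  MemLp u 2 (volume.restrict S) ∧ MemLp v 2 (volume.restrict S)

namespace SqInt

variable {S : Set ℝ} {u v u' v' : ℝ → ℂ}

lemma mono {T : Set ℝ} (hTS : T ⊆ S) (h : SqInt S u v) : SqInt T u v :=
  ⟨h.1.mono_measure (Measure.restrict_mono hTS le_rfl),
    h.2.mono_measure (Measure.restrict_mono hTS le_rfl)⟩

lemma union {T : Set ℝ} (h : SqInt S u v) (h' : SqInt T u v) : SqInt (S ∪ T) u v := by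
  have key : ∀ f : ℝ → ℂ, MemLp f 2 (volume.restrict S) → MemLp f 2 (volume.restrict T) →
      MemLp f 2 (volume.restrict (S ∪ T)) := fun f h1 h2 => by
    rw [memLp_two_iff_integrable_sq_norm (aestronglyMeasurable_union_iff.2 ⟨h1.1, h2.1⟩)]
    exact IntegrableOn.union ((memLp_two_iff_integrable_sq_norm h1.1).1 h1)
      ((memLp_two_iff_integrable_sq_norm h2.1).1 h2)
  exact ⟨key u h.1 h'.1, key v h.2 h'.2⟩

lemma conj_swap (h : SqInt S u v) : SqInt S (fun x => conj (v x)) (fun x => conj (u x)) := by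
  have key : ∀ f : ℝ → ℂ, MemLp f 2 (volume.restrict S) →
      MemLp (fun x => conj (f x)) 2 (volume.restrict S) := fun f hf => by
    refine hf.congr_norm (Complex.continuous_conj.comp_aestronglyMeasurable hf.1) ?_
    exact ae_of_all _ fun x => by simp
  exact ⟨key v h.2, key u h.1⟩

lemma integrableOn_wronskian (h : SqInt S u v) (h' : SqInt S u' v') :
    IntegrableOn (wronskian u v u' v') S :=
  (h.1.integrable_mul h'.2).sub (h.2.integrable_mul h'.1)

lemma smul (c : ℂ) (h : SqInt S u v) : SqInt S (fun x => c * u x) (fun x => c * v x) :=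
  ⟨h.1.const_mul c, h.2.const_mul c⟩

lemma add (h : SqInt S u v) (h' : SqInt S u' v') :
    SqInt S (fun x => u x + u' x) (fun x => v x + v' x) :=
  ⟨h.1.add h'.1, h.2.add h'.2⟩

lemma congr (hS : MeasurableSet S) (h : SqInt S u v) (hu : ∀ x ∈ S, u x = u' x)
    (hv : ∀ x ∈ S, v x = v' x) :
    SqInt S u' v' :=
  ⟨h.1.ae_eq ((ae_restrict_iff' hS).2 (ae_of_all _ hu)),
    h.2.ae_eq ((ae_restrict_iff' hS).2 (ae_of_all _ hv))⟩

end SqInt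

lemma SqInt.of_continuous {u v : ℝ → ℂ} (hu : Continuous u) (hv : Continuous v) (a b : ℝ) :
    SqInt (Icc a b) u v := by
  have key : ∀ f : ℝ → ℂ, Continuous f → MemLp f 2 (volume.restrict (Icc a b)) := fun f hf => by
    obtain ⟨C, hC⟩ := isCompact_Icc.exists_bound_of_continuousOn (hf.continuousOn (s := Icc a b))
    exact MemLp.of_bound hf.aestronglyMeasurable C
      ((ae_restrict_iff' measurableSet_Icc).2 (ae_of_all _ hC))
  exact ⟨key u hu, key v hv⟩

namespace IsSol

variable {q : ℝ → ℂ} {z : ℂ} {u v u' v' : ℝ → ℂ} {S : Set ℝ}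

/-- Two solutions that are square integrable at the same end are linearly dependent. -/
lemma wronskian_eq_zero (h : IsSol q z u v) (h' : IsSol q z u' v') (hS : volume S = ⊤)
    (hu : SqInt S u v) (hu' : SqInt S u' v') (x : ℝ) : wronskian u v u' v' x = 0 :=
  eq_zero_of_integrableOn_const hS (hu.integrableOn_wronskian hu')
    fun y => h.wronskian_const h' x y

/-- The current of a square integrable solution vanishes. -/
lemma norm_eq {E : ℝ} (h : IsSol q E u v) (hS : volume S = ⊤) (hu : SqInt S u v) (x : ℝ) :
    ‖v x‖ = ‖u x‖ := by
  have := h.conj_swap_real.wronskian_eq_zero h hS hu.conj_swap hu x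
  simp only [wronskian, Complex.conj_mul'] at this
  norm_cast at this
  rw [← sq_eq_sq₀ (norm_nonneg _) (norm_nonneg _)]
  linarith

/-- There are no square integrable solutions for non-real energies. -/
lemma eq_zero_of_im_ne_zero (h : IsSol q z u v) (hz : z.im ≠ 0) (hu : SqInt univ u v) (x : ℝ) :
    u x = 0 ∧ v x = 0 := by
  -- The current satisfies J' = 2 Im z (|u|² + |v|²), so it is monotone; it is also integrable,
  -- hence null.
  set J : ℝ → ℝ := fun x => ‖v x‖ ^ 2 - ‖u x‖ ^ 2 with hJ
  have hW : ∀ x, wronskian (fun x => conj (v x)) (fun x => conj (u x)) u v x = J x := fun x => by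
    simp [wronskian, Complex.conj_mul', hJ]
  have hcu := h.1.continuous
  have hcv := h.2.continuous
  have hJ' : ∀ x y, J y - J x = 2 * z.im * ∫ s in x..y, (‖u s‖ ^ 2 + ‖v s‖ ^ 2) := fun x y => by
    have h1 := h.conj_swap.wronskian_sub h (x := x) (y := y) fun _ _ => rfl
    rw [hW, hW] at h1
    have h2 : (fun s => conj (v s) * v s + conj (u s) * u s) =
        fun s => ((‖u s‖ ^ 2 + ‖v s‖ ^ 2 : ℝ) : ℂ) := by
      funext s; simp [Complex.conj_mul', add_comm]
    rw [h2, intervalIntegral.integral_ofReal] at h1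
    have h3 : I * (conj z - z) = ((2 * z.im : ℝ) : ℂ) := by
      apply Complex.ext <;> simp; ring
    rw [h3] at h1
    exact_mod_cast h1
  have hint : Integrable J := by
    have h1 := hu.conj_swap.integrableOn_wronskian hu
    rw [integrableOn_univ, funext hW] at h1
    simpa using h1.re
  have hpos : ∀ x y, x ≤ y → 0 ≤ ∫ s in x..y, (‖u s‖ ^ 2 + ‖v s‖ ^ 2) := fun x y hxy =>
    intervalIntegral.integral_nonneg hxy fun _ _ => by positivity
  have bound : ∀ (S : Set ℝ) (c : ℝ), MeasurableSet S → volume S = ⊤ → 0 < c →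
      ¬ ∀ x ∈ S, c ≤ |J x| := by
    intro S c hSm hS hc hcon
    have : IntegrableOn (fun _ : ℝ => (c : ℂ)) S := by
      refine Integrable.mono (hint.integrableOn (s := S)) aestronglyMeasurable_const ?_
      refine (ae_restrict_iff' hSm).2 (ae_of_all _ fun x hx => ?_)
      simpa [abs_of_pos hc] using hcon x hx
    have := eq_zero_of_integrableOn_const hS this fun _ => rfl
    exact hc.ne' (by exact_mod_cast this)
  have hJ0 : ∀ x, J x = 0 := by
    intro x
    by_contra hx
    have hx' : 0 < |J x| := abs_pos.2 hx
    -- The sign of Im z · J x tells in which direction |J| does not decrease. There |J| stays above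
    -- |J x| on a half-line, against integrability.
    rcases le_or_gt 0 (z.im * J x) with hs | hs
    · refine bound (Ici x) _ measurableSet_Ici Real.volume_Ici hx' fun y hy => ?_
      have h1 := hJ' x y
      have h2 := hpos x y hy
      rw [← sq_le_sq]
      have h4 : 0 ≤ z.im * J x * ∫ s in x..y, (‖u s‖ ^ 2 + ‖v s‖ ^ 2) := mul_nonneg hs h2
      rw [sub_eq_iff_eq_add] at h1
      rw [h1]
      nlinarith [sq_nonneg (2 * z.im * ∫ s in x..y, (‖u s‖ ^ 2 + ‖v s‖ ^ 2))]
    · refine bound (Iic x) _ measurableSet_Iic Real.volume_Iic hx' fun y hy => ?_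
      have h1 := hJ' y x
      have h2 := hpos y x hy
      rw [← sq_le_sq]
      have h4 : z.im * J x * ∫ s in y..x, (‖u s‖ ^ 2 + ‖v s‖ ^ 2) ≤ 0 :=
        mul_nonpos_of_nonpos_of_nonneg hs.le h2
      have h5 : J y = J x - 2 * z.im * ∫ s in y..x, (‖u s‖ ^ 2 + ‖v s‖ ^ 2) := by linarith
      rw [h5]
      nlinarith [sq_nonneg (2 * z.im * ∫ s in y..x, (‖u s‖ ^ 2 + ‖v s‖ ^ 2))]
  have h0 := hJ' x (x + 1)
  rw [hJ0, hJ0, sub_zero, zero_eq_mul] at h0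
  have h0 := h0.resolve_left (by simpa using hz)
  by_contra hne
  refine absurd h0 (ne_of_gt ?_)
  refine intervalIntegral.integral_pos (by linarith) (by fun_prop) (fun _ _ => by positivity)
    ⟨x, by simp, ?_⟩
  rcases not_and_or.1 hne with h1 | h1 <;> positivity

end IsSol

/-! ### Relation with spinor fields -/

/-- The off-diagonal Hermitian matrix potential with lower left entry `q`. -/
def offDiag (q : ℝ → ℂ) (x : ℝ) : Matrix (Fin 2) (Fin 2) ℂ := !![0, conj (q x); q x, 0]

lemma hasLocalDeriv_iff {u w : ℝ → Spinor} :
    HasLocalDeriv u w ↔ ∀ i, IsPrimitive (fun x => u x i) (fun x => w x i) := by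
  have hloc : LocallyIntegrable w ↔ ∀ i, LocallyIntegrable (fun x => w x i) := by
    simp only [locallyIntegrable_iff, IntegrableOn, integrable_piLp_iff]
    exact ⟨fun h i k hk => h k hk i, fun h k hk i => h i k hk⟩
  have hcomp : LocallyIntegrable w → ∀ a b i,
      (∫ x in a..b, w x) i = ∫ x in a..b, w x i := fun h a b i =>
    ((EuclideanSpace.proj i : Spinor →L[ℂ] ℂ).intervalIntegral_comp_comm
      (LocallyIntegrable.intervalIntegrable' h a b)).symm
  constructor
  · intro h i
    refine ⟨hloc.1 h.1 i, fun a b => ?_⟩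
    rw [← hcomp h.1, ← h.2]
    rfl
  · intro h
    have hw := hloc.2 fun i => (h i).1
    refine ⟨hw, fun a b => ?_⟩
    ext i
    rw [hcomp hw, ← (h i).2]
    rfl

lemma diracExpr_offDiag (q : ℝ → ℂ) (u w : ℝ → Spinor) (x : ℝ) :
    diracExpr (offDiag q) u w x 0 = -I * w x 0 + conj (q x) * u x 1 ∧
      diracExpr (offDiag q) u w x 1 = I * w x 1 + q x * u x 0 := by
  constructor <;>
  simp [diracExpr, sigma3, offDiag, Matrix.toLpLin_apply, dotProduct,
    Fin.sum_univ_two]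

lemma isSol_of_diracExpr {q : ℝ → ℂ} {z : ℂ} {u w : ℝ → Spinor} (h : HasLocalDeriv u w)
    (h' : ∀ᵐ x, diracExpr (offDiag q) u w x = z • u x) :
    IsSol q z (fun x => u x 0) (fun x => u x 1) := by
  rw [hasLocalDeriv_iff] at h
  constructor
  · refine (h 0).congr_ae ?_
    filter_upwards [h'] with x hx
    have h1 := (diracExpr_offDiag q u w x).1
    rw [hx] at h1
    simp only [PiLp.smul_apply, smul_eq_mul] at h1
    linear_combination (-I) * h1 + w x 0 * Complex.I_mul_I
  · refine (h 1).congr_ae ?_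
    filter_upwards [h'] with x hx
    have h1 := (diracExpr_offDiag q u w x).2
    rw [hx] at h1
    simp only [PiLp.smul_apply, smul_eq_mul] at h1
    linear_combination I * h1 + w x 1 * Complex.I_mul_I

lemma IsSol.exists_hasLocalDeriv {q : ℝ → ℂ} {z : ℂ} {u : ℝ → Spinor}
    (h : IsSol q z (fun x => u x 0) (fun x => u x 1)) :
    ∃ w, HasLocalDeriv u w ∧ ∀ x, diracExpr (offDiag q) u w x = z • u x := by
  refine ⟨fun x => !₂[I * z * u x 0 - I * conj (q x) * u x 1, I * q x * u x 0 - I * z * u x 1],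
    ?_, fun x => ?_⟩
  · rw [hasLocalDeriv_iff]
    intro i
    fin_cases i
    · exact h.1
    · exact h.2
  · ext i
    fin_cases i
    · refine (diracExpr_offDiag q u _ x).1.trans ?_
      simp
      linear_combination (-z * u x 0 + conj (q x) * u x 1) * Complex.I_mul_I
    · refine (diracExpr_offDiag q u _ x).2.trans ?_
      simp
      linear_combination (-z * u x 1 + q x * u x 0) * Complex.I_mul_I

lemma mem_solutions_iff {q : ℝ → ℂ} {E : ℝ} {u : ℝ → Spinor} :
    u ∈ solutions (offDiag q) E ↔ IsSol q E (fun x => u x 0) (fun x => u x 1) := by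
  constructor
  · rintro ⟨w, h, h'⟩
    exact isSol_of_diracExpr h h'
  · intro h
    obtain ⟨w, h1, h2⟩ := h.exists_hasLocalDeriv
    exact ⟨w, h1, ae_of_all _ h2⟩

lemma mem_squareIntegrableOn_iff {S : Set ℝ} {u : ℝ → Spinor} :
    u ∈ squareIntegrableOn S ↔ SqInt S (fun x => u x 0) (fun x => u x 1) := by
  change MemLp u 2 _ ↔ _
  rw [memLp_piLp_iff, Fin.forall_fin_two]
  rfl

/-! ### Existence of solutions and dependence on parameters -/

/-! ### Volterra operators in exponentially weighted norms. -/

section Weighted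

variable {ω : ℝ → ℝ}

/-- The primitive of `ω` that vanishes at `0`. -/
def weight (ω : ℝ → ℝ) (x : ℝ) : ℝ := ∫ s in (0 : ℝ)..x, ω s

lemma isPrimitive_weight (hω : LocallyIntegrable ω) :
    IsPrimitive (fun x => (weight ω x : ℂ)) (fun x => (ω x : ℂ)) := by
  constructor
  · rw [locallyIntegrable_iff] at hω ⊢
    exact fun k hk => (hω k hk).ofReal
  · intro a b
    have hi := LocallyIntegrable.intervalIntegrable' hω
    rw [intervalIntegral.integral_ofReal, ← Complex.ofReal_sub, weight, weight,
      intervalIntegral.integral_interval_sub_left (hi _ _) (hi _ _)]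

lemma continuous_weight (hω : LocallyIntegrable ω) : Continuous (weight ω) :=
  intervalIntegral.continuous_primitive (LocallyIntegrable.intervalIntegrable' hω) 0

/-- The weight is only absolutely continuous, so the chain rule is the one for primitives. -/
lemma integral_weight_exp (hω : LocallyIntegrable ω) (κ : ℝ) (a b : ℝ) :
    κ * ∫ s in a..b, ω s * Real.exp (κ * weight ω s) =
      Real.exp (κ * weight ω b) - Real.exp (κ * weight ω a) := by
  have h := ((isPrimitive_weight hω).const_mul κ).cexp.2 a b
  have h2 : (fun s => Complex.exp (κ * weight ω s) * (κ * ω s)) =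
      fun s => ((κ * (ω s * Real.exp (κ * weight ω s)) : ℝ) : ℂ) := by
    funext s; push_cast; ring
  rw [h2, intervalIntegral.integral_ofReal, intervalIntegral.integral_const_mul] at h
  beta_reduce at h
  exact_mod_cast h.symm

/-- On each half-line `|weight|` is the weight or its opposite, and the integrand is an exact
derivative up to the factor κ. The gain κ⁻¹ makes the Volterra operators small for large κ. -/
lemma abs_integral_weight_exp_le (hω : LocallyIntegrable ω) (hω0 : ∀ x, 0 ≤ ω x) {κ : ℝ}
    (hκ : 0 < κ) (x : ℝ) :
    |∫ s in (0 : ℝ)..x, ω s * Real.exp (κ * |weight ω s|)| ≤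
      κ⁻¹ * Real.exp (κ * |weight ω x|) := by
  rcases le_total 0 x with hx | hx
  · have hpos : ∀ s ∈ Icc 0 x, |weight ω s| = weight ω s := fun s hs =>
      abs_of_nonneg (intervalIntegral.integral_nonneg hs.1 fun _ _ => hω0 _)
    rw [intervalIntegral.integral_congr (g := fun s => ω s * Real.exp (κ * weight ω s))
      (fun s hs => by rw [uIcc_of_le hx] at hs; simp only [hpos s hs]), hpos x ⟨hx, le_rfl⟩,
      abs_of_nonneg (intervalIntegral.integral_nonneg hx fun s _ =>
        mul_nonneg (hω0 s) (Real.exp_pos _).le), ← div_eq_inv_mul, le_div_iff₀' hκ,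
      integral_weight_exp hω]
    simp [weight]
  · have hneg : ∀ s ∈ Icc x 0, |weight ω s| = -weight ω s := fun s hs => by
      rw [weight, intervalIntegral.integral_symm, abs_neg, neg_neg]
      exact abs_of_nonneg (intervalIntegral.integral_nonneg hs.2 fun _ _ => hω0 _)
    have h1 := integral_weight_exp hω (-κ) x 0
    rw [intervalIntegral.integral_congr (g := fun s => ω s * Real.exp (-κ * weight ω s))
      (fun s hs => by rw [uIcc_of_ge hx] at hs; simp only [hneg s hs]; ring_nf),
      hneg x ⟨le_rfl, hx⟩, intervalIntegral.integral_symm, abs_neg,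
      abs_of_nonneg (intervalIntegral.integral_nonneg hx fun s _ =>
        mul_nonneg (hω0 s) (Real.exp_pos _).le), ← div_eq_inv_mul, le_div_iff₀' hκ]
    have h2 : κ * -weight ω x = -κ * weight ω x := by ring
    rw [h2]
    have h3 : Real.exp (-κ * weight ω 0) = 1 := by simp [weight]
    linarith

lemma locallyIntegrable_mul_weighted (hω : LocallyIntegrable ω) {c : ℝ → ℂ}
    (hc : LocallyIntegrable c) (κ : ℝ) (b : ℝ →ᵇ ℂ) :
    LocallyIntegrable (fun s => c s * (Real.exp (κ * |weight ω s|) * b s)) := by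
  have := continuous_weight hω
  exact LocallyIntegrable.mul_continuous' hc (by fun_prop)

lemma norm_integral_weighted_le (hω : LocallyIntegrable ω) {c : ℝ → ℂ}
    (hcω : ∀ x, ‖c x‖ ≤ ω x) {κ : ℝ} (hκ : 0 < κ) (b : ℝ →ᵇ ℂ) (x : ℝ) :
    ‖(Real.exp (-(κ * |weight ω x|)) : ℂ) *
      ∫ s in (0 : ℝ)..x, c s * (Real.exp (κ * |weight ω s|) * b s)‖ ≤ κ⁻¹ * ‖b‖ := by
  have hω0 : ∀ x, 0 ≤ ω x := fun x => (norm_nonneg _).trans (hcω x)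
  have hcw := continuous_weight hω
  have h1 : ‖∫ s in (0 : ℝ)..x, c s * (Real.exp (κ * |weight ω s|) * b s)‖ ≤
      |∫ s in (0 : ℝ)..x, ω s * Real.exp (κ * |weight ω s|) * ‖b‖| := by
    refine intervalIntegral.norm_integral_le_abs_of_norm_le (ae_of_all _ fun s => ?_) ?_
    · rw [norm_mul, norm_mul, Complex.norm_real, Real.norm_of_nonneg (Real.exp_pos _).le, mul_assoc]
      gcongr
      · exact hω0 s
      · exact hcω s
      · exact b.norm_coe_le_norm s
    · exact ((LocallyIntegrable.intervalIntegrable' hω 0 x).mul_continuousOn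
        (by fun_prop)).mul_const _
  rw [norm_mul, Complex.norm_real, Real.norm_of_nonneg (Real.exp_pos _).le]
  rw [intervalIntegral.integral_mul_const, abs_mul, abs_norm] at h1
  calc _ ≤ Real.exp (-(κ * |weight ω x|)) * (κ⁻¹ * Real.exp (κ * |weight ω x|) * ‖b‖) := by
        gcongr
        exact h1.trans (by gcongr; exact abs_integral_weight_exp_le hω hω0 hκ x)
    _ = κ⁻¹ * ‖b‖ * (Real.exp (-(κ * |weight ω x|)) * Real.exp (κ * |weight ω x|)) := by ring
    _ = κ⁻¹ * ‖b‖ := by rw [← Real.exp_add]; simp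

/-- The Volterra operator with coefficient `c`, on functions bounded relatively to the weight. -/
def volterra (hω : LocallyIntegrable ω) {c : ℝ → ℂ} (hc : LocallyIntegrable c)
    (hcω : ∀ x, ‖c x‖ ≤ ω x) {κ : ℝ} (hκ : 0 < κ) : (ℝ →ᵇ ℂ) →L[ℂ] (ℝ →ᵇ ℂ) :=
  LinearMap.mkContinuous
    -- A function is represented as exp(κ|weight|) · b with b bounded, and the operator acts on b.
    { toFun := fun b => BoundedContinuousFunction.ofNormedAddCommGroup
        (fun x => (Real.exp (-(κ * |weight ω x|)) : ℂ) *
          ∫ s in (0 : ℝ)..x, c s * (Real.exp (κ * |weight ω s|) * b s))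
        (by
          have h1 := continuous_weight hω
          have h2 := intervalIntegral.continuous_primitive (μ := volume)
            (LocallyIntegrable.intervalIntegrable' (locallyIntegrable_mul_weighted hω hc κ b)) 0
          fun_prop)
        (κ⁻¹ * ‖b‖) (norm_integral_weighted_le hω hcω hκ b)
      map_add' := fun b b' => by
        ext x
        have h1 := LocallyIntegrable.intervalIntegrable' (locallyIntegrable_mul_weighted hω hc κ b)
        have h2 := LocallyIntegrable.intervalIntegrable' (locallyIntegrable_mul_weighted hω hc κ b')
        simp only [BoundedContinuousFunction.coe_ofNormedAddCommGroup,
          BoundedContinuousFunction.coe_add, Pi.add_apply, mul_add]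
        rw [intervalIntegral.integral_add (h1 0 x) (h2 0 x), mul_add]
      map_smul' := fun r b => by
        ext x
        simp only [BoundedContinuousFunction.coe_ofNormedAddCommGroup,
          BoundedContinuousFunction.coe_smul, smul_eq_mul, RingHom.id_apply]
        rw [mul_left_comm r, ← intervalIntegral.integral_const_mul r]
        congr 2
        funext s
        ring }
    κ⁻¹ fun b => (BoundedContinuousFunction.norm_le (by positivity)).2
      (norm_integral_weighted_le hω hcω hκ b)

lemma volterra_apply (hω : LocallyIntegrable ω) {c : ℝ → ℂ} (hc : LocallyIntegrable c)
    (hcω : ∀ x, ‖c x‖ ≤ ω x) {κ : ℝ} (hκ : 0 < κ) (b : ℝ →ᵇ ℂ) (x : ℝ) :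
    (Real.exp (κ * |weight ω x|) : ℂ) * volterra hω hc hcω hκ b x =
      ∫ s in (0 : ℝ)..x, c s * (Real.exp (κ * |weight ω s|) * b s) := by
  change (Real.exp (κ * |weight ω x|) : ℂ) * ((Real.exp (-(κ * |weight ω x|)) : ℂ) *
    ∫ s in (0 : ℝ)..x, c s * (Real.exp (κ * |weight ω s|) * b s)) = _
  rw [← mul_assoc, ← Complex.ofReal_mul, ← Real.exp_add]
  simp

lemma norm_volterra_le (hω : LocallyIntegrable ω) {c : ℝ → ℂ} (hc : LocallyIntegrable c)
    (hcω : ∀ x, ‖c x‖ ≤ ω x) {κ : ℝ} (hκ : 0 < κ) : ‖volterra hω hc hcω hκ‖ ≤ κ⁻¹ :=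
  LinearMap.mkContinuous_norm_le _ (by positivity) _

end Weighted

/-! ### Smooth dependence of the solutions on time and energy. -/

lemma LocallyIntegrable.norm' {f : ℝ → ℂ} (h : LocallyIntegrable f) :
    LocallyIntegrable (fun x => ‖f x‖) := by
  rw [locallyIntegrable_iff] at h ⊢
  exact fun k hk => (h k hk).norm

/-- The resolvent of a smooth family of bounded operators is smooth. -/
lemma contDiffAt_inverse_one_sub {W Y : Type*} [NormedAddCommGroup W] [NormedSpace ℂ W]
    [NormedAddCommGroup Y] [NormedSpace ℂ Y] [CompleteSpace Y] {K : W → Y →L[ℂ] Y}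
    (hK : ContDiff ℂ 1 K) {p : W} (hp : ‖K p‖ < 1) (y : Y) :
    ∃ f : W → Y, ContDiffAt ℂ 1 f p ∧ ∀ᶠ p' in 𝓝 p, f p' = y + K p' (f p') := by
  have hunit : IsUnit (1 - K p) := isUnit_one_sub_of_norm_lt_one hp
  refine ⟨fun p => Ring.inverse (1 - K p) y, ?_, ?_⟩
  · obtain ⟨U, hU⟩ := hunit
    -- 1 - K p is a unit by the Neumann series, and inversion is smooth at units.
    have h1 : ContDiffAt ℂ 1 (Ring.inverse : (Y →L[ℂ] Y) → _) (1 - K p) := by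
      rw [← hU]; exact contDiffAt_ringInverse ℂ U
    exact (h1.comp p (contDiff_const.sub hK).contDiffAt).clm_apply contDiffAt_const
  · have : ContinuousAt (fun p => 1 - K p) p := (continuous_const.sub hK.continuous).continuousAt
    filter_upwards [this.eventually (Units.isOpen.mem_nhds hunit)] with p' hp'
    have h1 : (1 - K p') (Ring.inverse (1 - K p') y) = y := by
      change ((1 - K p') * Ring.inverse (1 - K p')) y = _
      rw [Ring.mul_inverse_cancel _ hp']
      rfl
    rw [sub_apply] at h1
    rw [← sub_eq_iff_eq_add]
    exact h1

/-- The space of bounded continuous functions on the line. -/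
abbrev BddCont : Type := ℝ →ᵇ ℂ

/-- The coefficient of a family of Dirac operators with a rotating component. -/
def rotCoeff (c₁ c₂ : ℝ → ℂ) (t x : ℝ) : ℂ := c₁ x + Complex.exp (2 * Real.pi * t * I) * c₂ x

lemma norm_prod_comp_le {X : Type*} [NormedAddCommGroup X] [NormedSpace ℂ X] {A B : X →L[ℂ] X}
    {r : ℝ} (hr : 0 ≤ r) (hA : ‖A‖ ≤ r) (hB : ‖B‖ ≤ r) {f g : X × X →L[ℂ] X}
    (hf : ‖f‖ ≤ 1) (hg : ‖g‖ ≤ 1) :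
    ‖(A ∘L f).prod (B ∘L g)‖ ≤ r := by
  rw [ContinuousLinearMap.opNorm_prod, Prod.norm_def]
  refine max_le ?_ ?_
  · calc _ ≤ ‖A‖ * ‖f‖ := A.opNorm_comp_le f
      _ ≤ r * 1 := by gcongr
      _ = r := mul_one r
  · calc _ ≤ ‖B‖ * ‖g‖ := B.opNorm_comp_le g
      _ ≤ r * 1 := by gcongr
      _ = r := mul_one r

/-- Local existence of a family of solutions that depends smoothly on the parameters. -/
lemma exists_local_fundamental {c₁ c₂ : ℝ → ℂ} (h₁ : LocallyIntegrable c₁)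
    (h₂ : LocallyIntegrable c₂) (p₀ : ℝ × ℝ) :
    ∃ a b : ℝ × ℝ → ℝ → ℂ,
      (∀ᶠ p in 𝓝 p₀, IsSol (rotCoeff c₁ c₂ p.1) (p.2 : ℂ) (a p) (b p) ∧ a p 0 = 1 ∧ b p 0 = 0) ∧
      ∀ x, ContDiffAt ℝ 1 (fun p => a p x) p₀ ∧ ContDiffAt ℝ 1 (fun p => b p x) p₀ ∧
        ContinuousAt (fun p : (ℝ × ℝ) × ℝ => a p.1 p.2) (p₀, x) ∧
        ContinuousAt (fun p : (ℝ × ℝ) × ℝ => b p.1 p.2) (p₀, x) := by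
  -- The summand 1 dominates the constant coefficient of the energy term.
  set ω : ℝ → ℝ := fun x => 1 + ‖c₁ x‖ + ‖c₂ x‖ with hωdef
  have hω : LocallyIntegrable ω :=
    ((locallyIntegrable_const 1).add (LocallyIntegrable.norm' h₁)).add (LocallyIntegrable.norm' h₂)
  -- The operator is a sum of four terms with factors |E|, 1, 1, 1 at `p₀`, each of norm at most
  -- κ⁻¹; any κ above |E| + 3 makes the sum smaller than 1.
  set κ : ℝ := |p₀.2| + 4 with hκdef
  have hκ : 0 < κ := by positivity
  have b0 : ∀ x : ℝ, ‖(1 : ℂ)‖ ≤ ω x := fun x => by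
    simp only [hωdef, norm_one]; linarith [norm_nonneg (c₁ x), norm_nonneg (c₂ x)]
  have b1 : ∀ x : ℝ, ‖c₁ x‖ ≤ ω x := fun x => by
    simp only [hωdef]; linarith [norm_nonneg (c₁ x), norm_nonneg (c₂ x)]
  have b2 : ∀ x : ℝ, ‖c₂ x‖ ≤ ω x := fun x => by
    simp only [hωdef]; linarith [norm_nonneg (c₁ x), norm_nonneg (c₂ x)]
  have b1' : ∀ x : ℝ, ‖conj (c₁ x)‖ ≤ ω x := fun x => by simpa using b1 x
  have b2' : ∀ x : ℝ, ‖conj (c₂ x)‖ ≤ ω x := fun x => by simpa using b2 x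
  have h0 : LocallyIntegrable (fun _ : ℝ => (1 : ℂ)) := locallyIntegrable_const 1
  have h1' := LocallyIntegrable.conj' h₁
  have h2' := LocallyIntegrable.conj' h₂
  set T0 := volterra hω h0 b0 hκ with hT0
  set T1 := volterra hω h₁ b1 hκ with hT1
  set T1' := volterra hω h1' b1' hκ with hT1'
  set T2 := volterra hω h₂ b2 hκ with hT2
  set T2' := volterra hω h2' b2' hκ with hT2'
  let F := ContinuousLinearMap.fst ℂ BddCont BddCont
  let G := ContinuousLinearMap.snd ℂ BddCont BddCont
  have hF : ‖F‖ ≤ 1 := ContinuousLinearMap.norm_fst_le ..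
  have hG : ‖G‖ ≤ 1 := ContinuousLinearMap.norm_snd_le ..
  -- `K1` carries the energy, `K2` the fixed coefficient, `K3` and `K4` the rotating one in the
  -- second and in the first equation. The phase and its conjugate are independent complex
  -- parameters, so that `K` is affine over ℂ.
  let K1 : BddCont × BddCont →L[ℂ] BddCont × BddCont := ((I • T0) ∘L F).prod ((-I • T0) ∘L G)
  let K2 : BddCont × BddCont →L[ℂ] BddCont × BddCont := ((-I • T1') ∘L G).prod ((I • T1) ∘L F)
  let K3 : BddCont × BddCont →L[ℂ] BddCont × BddCont := ((0 : BddCont →L[ℂ] BddCont) ∘L F).prod ((I • T2) ∘L F)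
  let K4 : BddCont × BddCont →L[ℂ] BddCont × BddCont := ((-I • T2') ∘L G).prod ((0 : BddCont →L[ℂ] BddCont) ∘L F)
  have hκi : (0 : ℝ) ≤ κ⁻¹ := by positivity
  have nI : ∀ T : BddCont →L[ℂ] BddCont, ‖T‖ ≤ κ⁻¹ → ‖I • T‖ ≤ κ⁻¹ := fun T hT => by
    rw [norm_smul]; simpa using hT
  have nI' : ∀ T : BddCont →L[ℂ] BddCont, ‖T‖ ≤ κ⁻¹ → ‖-I • T‖ ≤ κ⁻¹ := fun T hT => by
    rw [norm_smul]; simpa using hT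
  have n0 : ‖(0 : BddCont →L[ℂ] BddCont)‖ ≤ κ⁻¹ := by simpa using hκi
  have nK1 : ‖K1‖ ≤ κ⁻¹ := norm_prod_comp_le hκi (nI _ (norm_volterra_le ..))
    (nI' _ (norm_volterra_le ..)) hF hG
  have nK2 : ‖K2‖ ≤ κ⁻¹ := norm_prod_comp_le hκi (nI' _ (norm_volterra_le ..))
    (nI _ (norm_volterra_le ..)) hG hF
  have nK3 : ‖K3‖ ≤ κ⁻¹ := norm_prod_comp_le hκi n0 (nI _ (norm_volterra_le ..)) hF hF
  have nK4 : ‖K4‖ ≤ κ⁻¹ := norm_prod_comp_le hκi (nI' _ (norm_volterra_le ..)) n0 hG hF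
  let K : ℂ × ℂ × ℂ → (BddCont × BddCont →L[ℂ] BddCont × BddCont) := fun p => p.1 • K1 + K2 + p.2.1 • K3 + p.2.2 • K4
  let P : ℝ × ℝ → ℂ × ℂ × ℂ := fun p =>
    ((p.2 : ℂ), Complex.exp (2 * Real.pi * p.1 * I), Complex.exp (-(2 * Real.pi * p.1 * I)))
  have hP : ContDiff ℝ 1 P := by
    have e1 : ContDiff ℝ 1 fun p : ℝ × ℝ => (p.2 : ℂ) :=
      Complex.ofRealCLM.contDiff.comp contDiff_snd
    have e2 : ContDiff ℝ 1 fun p : ℝ × ℝ => 2 * Real.pi * (p.1 : ℂ) * I :=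
      (contDiff_const.mul (Complex.ofRealCLM.contDiff.comp contDiff_fst)).mul contDiff_const
    exact e1.prodMk (e2.cexp.prodMk e2.neg.cexp)
  have hKc : ContDiff ℂ 1 K := by
    refine ((?_ : ContDiff ℂ 1 fun p : ℂ × ℂ × ℂ => p.1 • K1 + K2).add ?_).add ?_
    · exact (contDiff_fst.smul contDiff_const).add contDiff_const
    · exact (contDiff_fst.comp contDiff_snd).smul contDiff_const
    · exact (contDiff_snd.comp contDiff_snd).smul contDiff_const
  have hKP : ‖K (P p₀)‖ < 1 := by
    have e1 : ‖(P p₀).1‖ = |p₀.2| := by simp [P]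
    have e2 : ‖(P p₀).2.1‖ = 1 := by simp [P, Complex.norm_exp]
    have e3 : ‖(P p₀).2.2‖ = 1 := by simp [P, Complex.norm_exp]
    have h1 := norm_add_le ((P p₀).1 • K1 + K2 + (P p₀).2.1 • K3) ((P p₀).2.2 • K4)
    have h2 := norm_add_le ((P p₀).1 • K1 + K2) ((P p₀).2.1 • K3)
    have h3 := norm_add_le ((P p₀).1 • K1) K2
    rw [norm_smul, e3, one_mul] at h1
    rw [norm_smul, e2, one_mul] at h2
    rw [norm_smul, e1] at h3
    have h4 : |p₀.2| * ‖K1‖ ≤ |p₀.2| * κ⁻¹ := by gcongr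
    have h5 : |p₀.2| * κ⁻¹ + 3 * κ⁻¹ < 1 := by
      rw [← add_mul, ← div_eq_mul_inv, div_lt_one hκ]; linarith
    change ‖(P p₀).1 • K1 + K2 + (P p₀).2.1 • K3 + (P p₀).2.2 • K4‖ < 1
    linarith
  have hcw := continuous_weight hω
  -- The constant 1 divided by the weight: (`β₀`, 0) encodes the initial data (1, 0).
  let β₀ : BddCont := BoundedContinuousFunction.ofNormedAddCommGroup
    (fun x => (Real.exp (-(κ * |weight ω x|)) : ℂ)) (by fun_prop) 1 (fun x => by
      rw [Complex.norm_real, Real.norm_of_nonneg (Real.exp_pos _).le, Real.exp_le_one_iff]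
      have : 0 ≤ κ * |weight ω x| := by positivity
      linarith)
  obtain ⟨B, hB, hBfix⟩ := contDiffAt_inverse_one_sub hKc hKP ((β₀, 0) : BddCont × BddCont)
  have hBP : ContDiffAt ℝ 1 (fun p => B (P p)) p₀ :=
    (hB.restrict_scalars ℝ).comp p₀ hP.contDiffAt
  have hev := hP.continuous.continuousAt.eventually hBfix
  let e : ℝ → ℂ := fun x => (Real.exp (κ * |weight ω x|) : ℂ)
  have hec : Continuous e := by fun_prop
  refine ⟨fun p x => e x * (B (P p)).1 x, fun p x => e x * (B (P p)).2 x, ?_, fun x => ?_⟩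
  · filter_upwards [hev] with p hp
    set f := B (P p) with hf
    have hfix : f = (β₀, 0) + K (P p) f := hp
    have hK1 : (K (P p) f).1 = (p.2 : ℂ) • (I • T0 f.1) + (-I • T1' f.2) +
        Complex.exp (-(2 * Real.pi * p.1 * I)) • (-I • T2' f.2) := by
      simp [K, K1, K2, K3, K4, P, F, G]
    have hK2 : (K (P p) f).2 = (p.2 : ℂ) • (-I • T0 f.2) + (I • T1 f.1) +
        Complex.exp (2 * Real.pi * p.1 * I) • (I • T2 f.1) := by
      simp [K, K1, K2, K3, K4, P, F, G]
    have hinv : conj (Complex.exp (2 * Real.pi * p.1 * I)) =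
        Complex.exp (-(2 * Real.pi * p.1 * I)) := by
      rw [← Complex.exp_conj]
      congr 1
      simp [Complex.conj_ofNat]
    have hq : LocallyIntegrable (rotCoeff c₁ c₂ p.1) :=
      h₁.add (LocallyIntegrable.continuous_mul' h₂ continuous_const)
    have hcf1 : Continuous fun x => e x * f.1 x := hec.mul f.1.continuous
    have hcf2 : Continuous fun x => e x * f.2 x := hec.mul f.2.continuous
    have ib : ∀ (c : ℝ → ℂ), LocallyIntegrable c → ∀ (b : BddCont) (x : ℝ),
        IntervalIntegrable (fun s => c s * (e s * b s)) volume 0 x := fun c hc b x =>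
      LocallyIntegrable.intervalIntegrable' (locallyIntegrable_mul_weighted hω hc κ b) 0 x
    have hβ : ∀ x, e x * β₀ x = 1 := fun x => by
      change (Real.exp (κ * |weight ω x|) : ℂ) * (Real.exp (-(κ * |weight ω x|)) : ℂ) = 1
      rw [← Complex.ofReal_mul, ← Real.exp_add]
      simp
    have hprim : ∀ (g g' : ℝ → ℂ) (r : ℂ), LocallyIntegrable g' →
        (∀ x, g x = r + ∫ s in (0 : ℝ)..x, g' s) → IsPrimitive g g' := by
      intro g g' r hg' hg
      have hi := LocallyIntegrable.intervalIntegrable' hg'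
      refine ⟨hg', fun a b => ?_⟩
      rw [hg a, hg b, add_sub_add_left_eq_sub,
        intervalIntegral.integral_interval_sub_left (hi _ _) (hi _ _)]
    -- Undoing the weight turns the fixed point equation into the integrated differential equation.
    have s1 : ∀ x, e x * f.1 x = 1 + ∫ s in (0 : ℝ)..x,
        (I * (p.2 : ℂ) * (e s * f.1 s) - I * conj (rotCoeff c₁ c₂ p.1 s) * (e s * f.2 s)) := by
      intro x
      have h1 : f.1 x = β₀ x + (K (P p) f).1 x := by
        conv_lhs => rw [hfix]
        rfl
      rw [h1, mul_add, hβ, hK1]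
      congr 1
      simp only [BoundedContinuousFunction.coe_add, BoundedContinuousFunction.coe_smul,
        Pi.add_apply, smul_eq_mul]
      have a0 : e x * T0 f.1 x = ∫ s in (0 : ℝ)..x, 1 * (e s * f.1 s) :=
        volterra_apply hω h0 b0 hκ f.1 x
      have a1 : e x * T1' f.2 x = ∫ s in (0 : ℝ)..x, conj (c₁ s) * (e s * f.2 s) :=
        volterra_apply hω h1' b1' hκ f.2 x
      have a2 : e x * T2' f.2 x = ∫ s in (0 : ℝ)..x, conj (c₂ s) * (e s * f.2 s) :=
        volterra_apply hω h2' b2' hκ f.2 x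
      have i0 := (ib _ h0 f.1 x).const_mul ((p.2 : ℂ) * I)
      have i1 := (ib _ h1' f.2 x).const_mul (-I)
      have i2 := (ib _ h2' f.2 x).const_mul (Complex.exp (-(2 * Real.pi * p.1 * I)) * -I)
      have : (fun s => I * (p.2 : ℂ) * (e s * f.1 s) -
          I * conj (rotCoeff c₁ c₂ p.1 s) * (e s * f.2 s)) =
          fun s => ((p.2 : ℂ) * I * (1 * (e s * f.1 s)) + -I * (conj (c₁ s) * (e s * f.2 s))) +
            Complex.exp (-(2 * Real.pi * p.1 * I)) * -I * (conj (c₂ s) * (e s * f.2 s)) := by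
        funext s
        rw [rotCoeff, map_add, map_mul, hinv]
        ring
      rw [this, intervalIntegral.integral_add (i0.add i1) i2, intervalIntegral.integral_add i0 i1,
        intervalIntegral.integral_const_mul ((p.2 : ℂ) * I),
        intervalIntegral.integral_const_mul (-I),
        intervalIntegral.integral_const_mul (Complex.exp (-(2 * Real.pi * p.1 * I)) * -I),
        ← a0, ← a1, ← a2]
      ring
    have s2 : ∀ x, e x * f.2 x = 0 + ∫ s in (0 : ℝ)..x,
        (I * rotCoeff c₁ c₂ p.1 s * (e s * f.1 s) - I * (p.2 : ℂ) * (e s * f.2 s)) := by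
      intro x
      have h1 : f.2 x = (K (P p) f).2 x := by
        conv_lhs => rw [hfix]
        simp
      rw [h1, hK2, zero_add]
      simp only [BoundedContinuousFunction.coe_add, BoundedContinuousFunction.coe_smul,
        Pi.add_apply, smul_eq_mul]
      have a0 : e x * T0 f.2 x = ∫ s in (0 : ℝ)..x, 1 * (e s * f.2 s) :=
        volterra_apply hω h0 b0 hκ f.2 x
      have a1 : e x * T1 f.1 x = ∫ s in (0 : ℝ)..x, c₁ s * (e s * f.1 s) :=
        volterra_apply hω h₁ b1 hκ f.1 x
      have a2 : e x * T2 f.1 x = ∫ s in (0 : ℝ)..x, c₂ s * (e s * f.1 s) :=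
        volterra_apply hω h₂ b2 hκ f.1 x
      have i0 := (ib _ h0 f.2 x).const_mul ((p.2 : ℂ) * -I)
      have i1 := (ib _ h₁ f.1 x).const_mul I
      have i2 := (ib _ h₂ f.1 x).const_mul (Complex.exp (2 * Real.pi * p.1 * I) * I)
      have : (fun s => I * rotCoeff c₁ c₂ p.1 s * (e s * f.1 s) - I * (p.2 : ℂ) * (e s * f.2 s)) =
          fun s => ((p.2 : ℂ) * -I * (1 * (e s * f.2 s)) + I * (c₁ s * (e s * f.1 s))) +
            Complex.exp (2 * Real.pi * p.1 * I) * I * (c₂ s * (e s * f.1 s)) := by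
        funext s
        rw [rotCoeff]
        ring
      rw [this, intervalIntegral.integral_add (i0.add i1) i2, intervalIntegral.integral_add i0 i1,
        intervalIntegral.integral_const_mul ((p.2 : ℂ) * -I),
        intervalIntegral.integral_const_mul I,
        intervalIntegral.integral_const_mul (Complex.exp (2 * Real.pi * p.1 * I) * I),
        ← a0, ← a1, ← a2]
      ring
    refine ⟨⟨hprim _ _ 1 ?_ s1, hprim _ _ 0 ?_ s2⟩, by simpa using s1 0, by simpa using s2 0⟩
    · refine LocallyIntegrable.sub ?_ ?_
      · exact (continuous_const.mul hcf1).locallyIntegrable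
      · exact LocallyIntegrable.mul_continuous'
          (LocallyIntegrable.continuous_mul' (LocallyIntegrable.conj' hq) continuous_const) hcf2
    · refine LocallyIntegrable.sub ?_ ?_
      · exact LocallyIntegrable.mul_continuous'
          (LocallyIntegrable.continuous_mul' hq continuous_const) hcf1
      · exact (continuous_const.mul hcf2).locallyIntegrable
  · have hevx : ContDiff ℝ 1 (fun b : BddCont => b x) :=
      ((BoundedContinuousFunction.evalCLM ℝ x : (ℝ →ᵇ ℂ) →L[ℝ] ℂ)).contDiff
    have hcont : ContinuousAt (fun p => B (P p)) p₀ := hBP.continuousAt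
    have hcev : Continuous fun p : BddCont × ℝ => p.1 p.2 := continuous_eval
    refine ⟨contDiffAt_const.mul (hevx.contDiffAt.comp p₀ hBP.fst),
      contDiffAt_const.mul (hevx.contDiffAt.comp p₀ hBP.snd), ?_, ?_⟩
    · refine (hec.comp continuous_snd).continuousAt.mul ?_
      refine hcev.continuousAt.comp (f := fun p : (ℝ × ℝ) × ℝ => ((B (P p.1)).1, p.2)) ?_
      refine ContinuousAt.prodMk ?_ continuousAt_snd
      exact (ContinuousAt.comp (f := Prod.fst) (x := (p₀, x)) hcont continuousAt_fst).fst
    · refine (hec.comp continuous_snd).continuousAt.mul ?_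
      refine hcev.continuousAt.comp (f := fun p : (ℝ × ℝ) × ℝ => ((B (P p.1)).2, p.2)) ?_
      refine ContinuousAt.prodMk ?_ continuousAt_snd
      exact (ContinuousAt.comp (f := Prod.fst) (x := (p₀, x)) hcont continuousAt_fst).snd

/-- A solution that is normalised at the origin determines all solutions. -/
lemma IsSol.eq_combination {q : ℝ → ℂ} {E : ℝ} {a b u v : ℝ → ℂ} (hab : IsSol q E a b)
    (ha : a 0 = 1) (hb : b 0 = 0) (h : IsSol q E u v) (x : ℝ) :
    u x = u 0 * a x + v 0 * conj (b x) ∧ v x = u 0 * b x + v 0 * conj (a x) := by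
  -- By `w1` the fundamental matrix has determinant one. The conserved Wronskians `w2`, `w3` of (u,
  -- v) with its columns then give u and v by Cramer's rule.
  have w1 := hab.conj_swap_real.wronskian_const hab 0 x
  have w2 := h.wronskian_const hab 0 x
  have w3 := h.wronskian_const hab.conj_swap_real 0 x
  simp only [wronskian, ha, hb, map_one, map_zero] at w1 w2 w3
  constructor
  · linear_combination u x * w1 - conj (b x) * w2 + a x * w3
  · linear_combination v x * w1 - conj (a x) * w2 + b x * w3

lemma IsSol.norm_sq_sub {q : ℝ → ℂ} {E : ℝ} {a b : ℝ → ℂ} (hab : IsSol q E a b)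
    (ha : a 0 = 1) (hb : b 0 = 0) (x : ℝ) : a x * conj (a x) - b x * conj (b x) = 1 := by
  have w1 := hab.conj_swap_real.wronskian_const hab 0 x
  simp only [wronskian, ha, hb, map_one, map_zero] at w1
  linear_combination -w1

/-- Existence of a fundamental solution that depends smoothly on the parameters. -/
theorem exists_fundamental {c₁ c₂ : ℝ → ℂ} (h₁ : LocallyIntegrable c₁)
    (h₂ : LocallyIntegrable c₂) :
    ∃ a b : ℝ × ℝ → ℝ → ℂ,
      (∀ p, IsSol (rotCoeff c₁ c₂ p.1) (p.2 : ℂ) (a p) (b p) ∧ a p 0 = 1 ∧ b p 0 = 0) ∧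
      (∀ x, ContDiff ℝ 1 (fun p => a p x) ∧ ContDiff ℝ 1 (fun p => b p x)) ∧
        Continuous (fun p : (ℝ × ℝ) × ℝ => a p.1 p.2) ∧
        Continuous (fun p : (ℝ × ℝ) × ℝ => b p.1 p.2) := by
  have hex : ∀ p : ℝ × ℝ, ∃ f : (ℝ → ℂ) × (ℝ → ℂ),
      IsSol (rotCoeff c₁ c₂ p.1) (p.2 : ℂ) f.1 f.2 ∧ f.1 0 = 1 ∧ f.2 0 = 0 := fun p => by
    obtain ⟨a, b, h, -⟩ := exists_local_fundamental h₁ h₂ p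
    exact ⟨(a p, b p), h.self_of_nhds⟩
  choose f hf using hex
  -- A solution is determined by its value at 0, so near `p₀` the chosen solutions coincide with the
  -- smooth local family.
  have hloc : ∀ p₀ : ℝ × ℝ, ∃ a b : ℝ × ℝ → ℝ → ℂ,
      (∀ᶠ p in 𝓝 p₀, (f p).1 = a p ∧ (f p).2 = b p) ∧
      ∀ x, ContDiffAt ℝ 1 (fun p => a p x) p₀ ∧ ContDiffAt ℝ 1 (fun p => b p x) p₀ ∧
        ContinuousAt (fun p : (ℝ × ℝ) × ℝ => a p.1 p.2) (p₀, x) ∧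
        ContinuousAt (fun p : (ℝ × ℝ) × ℝ => b p.1 p.2) (p₀, x) := fun p₀ => by
    obtain ⟨a, b, h, h'⟩ := exists_local_fundamental h₁ h₂ p₀
    refine ⟨a, b, ?_, h'⟩
    filter_upwards [h] with p hp
    have := fun x => hp.1.eq_combination hp.2.1 hp.2.2 (hf p).1 x
    simp only [(hf p).2.1, (hf p).2.2, one_mul, zero_mul, add_zero] at this
    exact ⟨funext fun x => (this x).1, funext fun x => (this x).2⟩
  refine ⟨fun p => (f p).1, fun p => (f p).2, hf, fun x => ⟨?_, ?_⟩, ?_, ?_⟩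
  · refine contDiff_iff_contDiffAt.2 fun p₀ => ?_
    obtain ⟨a, b, h, h'⟩ := hloc p₀
    exact (h' x).1.congr_of_eventuallyEq (h.mono fun p hp => congrFun hp.1 x)
  · refine contDiff_iff_contDiffAt.2 fun p₀ => ?_
    obtain ⟨a, b, h, h'⟩ := hloc p₀
    exact (h' x).2.1.congr_of_eventuallyEq (h.mono fun p hp => congrFun hp.2 x)
  · refine continuous_iff_continuousAt.2 fun ⟨p₀, x⟩ => ?_
    obtain ⟨a, b, h, h'⟩ := hloc p₀
    refine (h' x).2.2.1.congr ?_
    filter_upwards [continuousAt_fst.eventually h] with p hp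
    exact (congrFun hp.1 p.2).symm
  · refine continuous_iff_continuousAt.2 fun ⟨p₀, x⟩ => ?_
    obtain ⟨a, b, h, h'⟩ := hloc p₀
    refine (h' x).2.2.2.congr ?_
    filter_upwards [continuousAt_fst.eventually h] with p hp
    exact (congrFun hp.2 p.2).symm

/-! ### Uniqueness of solutions -/

lemma exists_normalised {q : ℝ → ℂ} (hq : LocallyIntegrable q) (E : ℝ) :
    ∃ a b, IsSol q E a b ∧ a 0 = 1 ∧ b 0 = 0 := by
  obtain ⟨a, b, h, -⟩ := exists_fundamental hq (locallyIntegrable_zero (μ := volume))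
  have h0 := h (0, E)
  have e : rotCoeff q (fun _ => 0) (0, E).1 = q := by
    funext x; simp [rotCoeff]
  exact ⟨_, _, e ▸ h0.1, h0.2⟩

namespace IsSol

variable {q : ℝ → ℂ} {E : ℝ} {u v u' v' : ℝ → ℂ}

lemma eq_zero (hq : LocallyIntegrable q) (h : IsSol q E u v) {y : ℝ} (hu : u y = 0)
    (hv : v y = 0) (x : ℝ) : u x = 0 ∧ v x = 0 := by
  obtain ⟨a, b, hab, ha, hb⟩ := exists_normalised hq E
  have h1 := hab.eq_combination ha hb h
  have h2 := hab.norm_sq_sub ha hb y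
  have h3 := h1 y
  rw [hu, hv] at h3
  have h4 : u 0 = 0 := by linear_combination (-u 0) * h2 - conj (a y) * h3.1 + conj (b y) * h3.2
  have h5 : v 0 = 0 := by linear_combination (-v 0) * h2 - a y * h3.2 + b y * h3.1
  simpa [h4, h5] using h1 x

/-- The coefficients come from the inverse of the fundamental matrix at `y`, whose determinant is
one. -/
lemma exists_initial (hq : LocallyIntegrable q) (E y : ℝ) (r s : ℂ) :
    ∃ u v, IsSol q E u v ∧ u y = r ∧ v y = s := by
  obtain ⟨a, b, hab, ha, hb⟩ := exists_normalised hq E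
  have h1 := hab.norm_sq_sub ha hb y
  refine ⟨_, _, (hab.smul (r * conj (a y) - s * conj (b y))).add
    (hab.conj_swap_real.smul (s * a y - r * b y)), ?_, ?_⟩
  · linear_combination r * h1
  · linear_combination s * h1

/-- Solutions of equations that agree on an interval agree there. -/
lemma eqOn_of_eq {q' : ℝ → ℂ} (hq : LocallyIntegrable q) (h : IsSol q E u v)
    (h' : IsSol q' E u' v') {y x : ℝ} (hqq : ∀ s ∈ uIoc y x, q s = q' s) (hu : u y = u' y)
    (hv : v y = v' y) : u x = u' x ∧ v x = v' x := by
  obtain ⟨a, b, hab, ha, hb⟩ := exists_normalised hq E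
  have h2 := hab.norm_sq_sub ha hb x
  -- Both pairs are compared with the fundamental solution for `q`: its Wronskian with (u', v') is
  -- also conserved, but only between `y` and `x`.
  have w1 := h.wronskian_const hab y x
  have w2 := h.wronskian_const hab.conj_swap_real y x
  have w3 := h'.wronskian_eq hab (fun s hs => (hqq s hs).symm)
  have w4 := h'.wronskian_eq hab.conj_swap_real (fun s hs => (hqq s hs).symm)
  simp only [wronskian] at w1 w2 w3 w4
  rw [hu, hv] at w1 w2
  constructor
  · linear_combination (-(u x - u' x)) * h2 - conj (b x) * (w1 - w3) + a x * (w2 - w4)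
  · linear_combination (-(v x - v' x)) * h2 - conj (a x) * (w1 - w3) + b x * (w2 - w4)

/-- Two square integrable solutions at the same end that have proportional first components at a
point are proportional. -/
lemma eq_smul_of_sqInt (hq : LocallyIntegrable q) (h : IsSol q E u v) (h' : IsSol q E u' v')
    {S : Set ℝ} (hS : volume S = ⊤) (hu : SqInt S u v) (hu' : SqInt S u' v') {y : ℝ} {c : ℂ}
    (hc : u y = c * u' y) (x : ℝ) : u x = c * u' x ∧ v x = c * v' x := by
  have h1 := h.add (h'.smul (-c))
  have h2 := hu.add (hu'.smul (-c))
  -- The difference has zero upper component at `y`; its current vanishes, so the lower component is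
  -- zero there as well, and the difference is null.
  have h3 := h1.norm_eq hS h2 y
  have h4 : u y + -c * u' y = 0 := by rw [hc]; ring
  rw [h4, norm_zero, norm_eq_zero] at h3
  have h5 := h1.eq_zero hq h4 h3 x
  exact ⟨by linear_combination h5.1, by linear_combination h5.2⟩

/-- A square integrable solution that vanishes at a point is null. -/
lemma eq_zero_of_sqInt (hq : LocallyIntegrable q) (h : IsSol q E u v)
    {S : Set ℝ} (hS : volume S = ⊤) (hu : SqInt S u v) {y : ℝ} (hy : u y = 0) (x : ℝ) :
    u x = 0 ∧ v x = 0 := by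
  simpa using h.eq_smul_of_sqInt hq h hS hu hu (c := 0) (by simpa using hy) x

end IsSol

/-! ### Floquet theory -/

lemma SqInt.comp_add {S : Set ℝ} (hS : MeasurableSet S) {s : ℝ} (hs : ∀ x ∈ S, x + s ∈ S)
    {u v : ℝ → ℂ} (h : SqInt S u v) : SqInt S (fun x => u (x + s)) (fun x => v (x + s)) := by
  have hm : MeasurePreserving (fun x : ℝ => x + s) volume volume :=
    measurePreserving_add_right volume s
  have hm' := hm.restrict_preimage hS
  have key : ∀ f : ℝ → ℂ, MemLp f 2 (volume.restrict S) →
      MemLp (fun x => f (x + s)) 2 (volume.restrict S) := fun f hf =>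
    (hf.comp_measurePreserving hm').mono_measure (Measure.restrict_mono hs le_rfl)
  exact ⟨key u h.1, key v h.2⟩

/-- Floquet theory: a solution of a periodic equation that is square integrable at one end is
multiplied under the shift towards this end by a factor of modulus less than one. -/
lemma IsSol.exists_multiplier {q : ℝ → ℂ} (hq : LocallyIntegrable q) {E : ℝ} {u v : ℝ → ℂ}
    (h : IsSol q E u v) {S : Set ℝ} (hSm : MeasurableSet S) (hS : volume S = ⊤) {s : ℝ}
    (hs : ∀ x ∈ S, x + s ∈ S) (hs' : volume (S \ {x | x - s ∈ S}) ≠ 0)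
    (hqs : ∀ x, q (x + s) = q x) (hu : SqInt S u v) :
    ∃ l : ℂ, ‖l‖ < 1 ∧ ∀ x, u (x + s) = l * u x ∧ v (x + s) = l * v x := by
  by_cases h0 : u 0 = 0
  · have := fun x => h.eq_zero_of_sqInt hq hS hu h0 x
    exact ⟨0, by simp, fun x => by simp [this]⟩
  -- The shifted solution solves the same equation and is square integrable at the same end, hence
  -- is a multiple of the original one.
  have hsh := h.comp_add s
  rw [funext hqs] at hsh
  set l : ℂ := u (0 + s) / u 0
  have hl := fun x => hsh.eq_smul_of_sqInt hq h hS (hu.comp_add hSm hs) hu (y := 0) (c := l)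
    (by simp only [l]; field_simp) x
  refine ⟨l, ?_, hl⟩
  have hne : ∀ x, u x ≠ 0 := fun x hx => h0 (h.eq_zero_of_sqInt hq hS hu hx 0).1
  have hcu := h.1.continuous
  -- `T` is the translate of `S`. The integral of |u|² over `T` is |l|² times that over `S`, and it
  -- is strictly smaller, since S \ T has positive measure and u never vanishes.
  set T : Set ℝ := {x | x - s ∈ S} with hT
  have hTm : MeasurableSet T := (measurable_id.sub_const s) hSm
  have hTS : T ⊆ S := fun x hx => by simpa using hs _ hx
  have hint : IntegrableOn (fun x => ‖u x‖ ^ 2) S :=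
    (memLp_two_iff_integrable_sq_norm hu.1.1).1 hu.1
  have h1 : ∫ x in T, ‖u x‖ ^ 2 = ‖l‖ ^ 2 * ∫ x in S, ‖u x‖ ^ 2 := by
    have hm : MeasurePreserving (fun x : ℝ => x + s) volume volume :=
      measurePreserving_add_right volume s
    have e := hm.setIntegral_preimage_emb (Homeomorph.addRight s).measurableEmbedding
      (fun x => ‖u x‖ ^ 2) T
    have hpre : (fun x : ℝ => x + s) ⁻¹' T = S := by ext x; simp [hT]
    rw [← e, hpre, ← integral_const_mul]
    refine integral_congr_ae (ae_of_all _ fun x => ?_)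
    simp only [(hl x).1, norm_mul, mul_pow]
  have h2 : 0 < ∫ x in S \ T, ‖u x‖ ^ 2 := by
    rw [setIntegral_pos_iff_support_of_nonneg_ae (ae_of_all _ fun x => by positivity)
      (hint.mono_set sdiff_subset)]
    have : Function.support (fun x => ‖u x‖ ^ 2) = univ := by
      ext x; simp [hne x]
    rw [this, univ_inter]
    exact pos_iff_ne_zero.2 hs'
  rw [setIntegral_sdiff hTm hint hTS, h1] at h2
  have h3 : 0 ≤ ∫ x in S, ‖u x‖ ^ 2 := integral_nonneg fun x => by positivity
  have h4 : ‖l‖ ^ 2 < 1 := by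
    by_contra hcon
    nlinarith
  exact (sq_lt_one_iff₀ (norm_nonneg _)).1 h4

lemma IsSol.exists_multiplier_plus {q : ℝ → ℂ} (hq : LocallyIntegrable q) {E : ℝ} {u v : ℝ → ℂ}
    (h : IsSol q E u v) (hqp : Function.Periodic q 1) (hu : SqInt (Ici 0) u v) :
    ∃ l : ℂ, ‖l‖ < 1 ∧ ∀ x, u (x + 1) = l * u x ∧ v (x + 1) = l * v x := by
  refine h.exists_multiplier hq measurableSet_Ici Real.volume_Ici (fun x hx => ?_) ?_ hqp hu
  · simp only [mem_Ici] at hx ⊢; linarith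
  · have : (Ici (0 : ℝ) \ {x | x - 1 ∈ Ici (0 : ℝ)}) = Ico 0 1 := by
      ext x; simp
    rw [this]; simp

lemma IsSol.exists_multiplier_minus {q : ℝ → ℂ} (hq : LocallyIntegrable q) {E : ℝ} {u v : ℝ → ℂ}
    (h : IsSol q E u v) (hqp : Function.Periodic q 1) (hu : SqInt (Iic 0) u v) :
    ∃ l : ℂ, ‖l‖ < 1 ∧ ∀ x, u (x + -1) = l * u x ∧ v (x + -1) = l * v x := by
  refine h.exists_multiplier hq measurableSet_Iic Real.volume_Iic (fun x hx => ?_) ?_ (fun x => ?_)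
    hu
  · simp only [mem_Iic] at hx ⊢; linarith
  · have : (Iic (0 : ℝ) \ {x | x - -1 ∈ Iic (0 : ℝ)}) = Ioc (-1) 0 := by
      ext x
      simp only [sub_neg_eq_add, mem_Iic, Set.mem_sdiff, mem_ofPred_eq, not_le, mem_Ioc]
      constructor <;> rintro ⟨h1, h2⟩ <;> constructor <;> linarith
    rw [this]; simp
  · rw [← sub_eq_add_neg]; exact hqp.sub_eq x

/-! ### Exponential decay from a Floquet multiplier. -/

/-- A function that is multiplied by a factor of modulus less than one under the unit shift decays
exponentially. -/
lemma exists_exp_bound {f : ℝ → ℂ} (hf : Continuous f) {l : ℂ} (hl : ‖l‖ < 1)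
    (h : ∀ x, f (x + 1) = l * f x) :
    ∃ C c : ℝ, 0 < c ∧ ∀ x, 0 ≤ x → ‖f x‖ ≤ C * Real.exp (-c * x) := by
  obtain ⟨M, hM⟩ := isCompact_Icc.exists_bound_of_continuousOn (hf.continuousOn (s := Icc 0 1))
  have hM0 : 0 ≤ M := (norm_nonneg _).trans (hM 0 (by simp))
  -- The maximum with 1/2 keeps the logarithm meaningful when l = 0.
  set m : ℝ := max ‖l‖ (1 / 2) with hm
  have hm0 : 0 < m := lt_of_lt_of_le (by norm_num) (le_max_right _ _)
  have hm1 : m < 1 := max_lt hl (by norm_num)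
  have hn : ∀ (n : ℕ) (x : ℝ), x ∈ Icc 0 1 → ‖f (x + n)‖ ≤ M * m ^ n := by
    intro n x hx
    induction n with
    | zero => simpa using hM x hx
    | succ n ih =>
      have e : x + ((n + 1 : ℕ) : ℝ) = (x + n) + 1 := by push_cast; ring
      rw [e, h, norm_mul, pow_succ']
      calc ‖l‖ * ‖f (x + n)‖ ≤ m * (M * m ^ n) := by
            gcongr
            exact le_max_left _ _
        _ = _ := by ring
  -- The factor exp(-log m) = 1/m pays for the fractional part of x lost by the floor.
  refine ⟨M * Real.exp (-Real.log m), -Real.log m, by simpa using Real.log_neg hm0 hm1,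
    fun x hx => ?_⟩
  have h1 := hn ⌊x⌋₊ (x - ⌊x⌋₊) ⟨by linarith [Nat.floor_le hx], by
    linarith [Nat.lt_floor_add_one x]⟩
  rw [sub_add_cancel] at h1
  refine h1.trans ?_
  rw [mul_assoc, ← Real.exp_add, ← Real.rpow_natCast, Real.rpow_def_of_pos hm0]
  gcongr
  nlinarith [Real.log_neg hm0 hm1, Nat.lt_floor_add_one x]

lemma memLp_Ici_of_exp_bound {f : ℝ → ℂ} (hf : Continuous f) {C c : ℝ} (hc : 0 < c)
    (h : ∀ x, 0 ≤ x → ‖f x‖ ≤ C * Real.exp (-c * x)) :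
    MemLp f 2 (volume.restrict (Ici 0)) := by
  rw [memLp_two_iff_integrable_sq_norm hf.aestronglyMeasurable]
  have h1 : IntegrableOn (fun x => C ^ 2 * Real.exp (-(2 * c) * x)) (Ici 0) := by
    rw [integrableOn_Ici_iff_integrableOn_Ioi]
    exact (integrableOn_exp_mul_Ioi (by linarith) 0).const_mul _
  refine Integrable.mono' h1 (by fun_prop) ?_
  refine (ae_restrict_iff' measurableSet_Ici).2 (ae_of_all _ fun x hx => ?_)
  have h2 := h x hx
  have h3 : C ^ 2 * Real.exp (-(2 * c) * x) = (C * Real.exp (-c * x)) ^ 2 := by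
    rw [mul_pow, ← Real.exp_nat_mul]; congr 2; push_cast; ring
  rw [Real.norm_of_nonneg (by positivity), h3]
  gcongr

lemma memLp_Iic_of_comp_neg {f : ℝ → ℂ}
    (hf : MemLp (fun x => f (-x)) 2 (volume.restrict (Ici 0))) :
    MemLp f 2 (volume.restrict (Iic 0)) := by
  have hm : MeasurePreserving (fun x : ℝ => -x) volume volume := Measure.measurePreserving_neg _
  have hm' := hm.restrict_preimage (s := Ici 0) measurableSet_Ici
  have h1 := hf.comp_measurePreserving hm'
  have h2 : (fun x : ℝ => -x) ⁻¹' Ici 0 = Iic 0 := by ext x; simp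
  rw [h2] at h1
  simpa [Function.comp_def] using h1

lemma SqInt.of_multiplier_plus {u v : ℝ → ℂ} (hu : Continuous u) (hv : Continuous v) {l : ℂ}
    (hl : ‖l‖ < 1) (h : ∀ x, u (x + 1) = l * u x ∧ v (x + 1) = l * v x) :
    SqInt (Ici 0) u v := by
  obtain ⟨C, c, hc, h1⟩ := exists_exp_bound hu hl fun x => (h x).1
  obtain ⟨C', c', hc', h1'⟩ := exists_exp_bound hv hl fun x => (h x).2
  exact ⟨memLp_Ici_of_exp_bound hu hc h1, memLp_Ici_of_exp_bound hv hc' h1'⟩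

lemma SqInt.of_multiplier_minus {u v : ℝ → ℂ} (hu : Continuous u) (hv : Continuous v) {l : ℂ}
    (hl : ‖l‖ < 1) (h : ∀ x, u (x + -1) = l * u x ∧ v (x + -1) = l * v x) :
    SqInt (Iic 0) u v := by
  have h1 : SqInt (Ici 0) (fun x => u (-x)) (fun x => v (-x)) :=
    SqInt.of_multiplier_plus (by fun_prop) (by fun_prop) hl fun x => by
      have := h (-x)
      rwa [← neg_add] at this
  exact ⟨memLp_Iic_of_comp_neg h1.1, memLp_Iic_of_comp_neg h1.2⟩

/-! ### The resolvent set -/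

/-- The resolvent set is open in the real line. -/
lemma isOpen_resolventSet (A : L2Spinor →ₗ.[ℂ] L2Spinor) :
    IsOpen {e : ℝ | InResolventSet A e} := by
  rw [Metric.isOpen_iff]
  rintro e₀ ⟨R, hR1, hR2⟩
  refine ⟨(‖R‖ + 1)⁻¹, by positivity, fun e he => ?_⟩
  set d : ℂ := (e : ℂ) - e₀ with hd
  have hdn : ‖d • R‖ < 1 := by
    rw [norm_smul, hd, ← Complex.ofReal_sub, Complex.norm_real, ← dist_eq_norm]
    have h1 : dist e e₀ < (‖R‖ + 1)⁻¹ := he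
    calc dist e e₀ * ‖R‖ ≤ dist e e₀ * (‖R‖ + 1) := by gcongr; linarith
      _ < (‖R‖ + 1)⁻¹ * (‖R‖ + 1) := by gcongr
      _ = 1 := inv_mul_cancel₀ (by positivity)
  have hu : IsUnit (1 - d • R) := isUnit_one_sub_of_norm_lt_one hdn
  set G := Ring.inverse (1 - d • R) with hG
  have hG1 : ∀ h, G h - d • R (G h) = h := fun h => by
    have : ((1 - d • R) * G) h = h := by rw [hG, Ring.mul_inverse_cancel _ hu]; rfl
    exact this
  have hG2 : ∀ h, G (h - d • R h) = h := fun h => by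
    have : (G * (1 - d • R)) h = h := by rw [hG, Ring.inverse_mul_cancel _ hu]; rfl
    exact this
  -- Since A - e = (A - e₀) - d with ‖dR‖ < 1, the new inverse is R(1 - dR)⁻¹.
  refine ⟨R ∘L G, fun h => ?_, fun f => ?_⟩
  · obtain ⟨hdom, h1⟩ := hR1 (G h)
    refine ⟨hdom, ?_⟩
    have h2 := hG1 h
    change A ⟨R (G h), hdom⟩ - (e : ℂ) • R (G h) = h
    have h3 : (e : ℂ) = d + e₀ := by rw [hd]; ring
    rw [h3, add_smul]
    calc _ = (A ⟨R (G h), hdom⟩ - (e₀ : ℂ) • R (G h)) - d • R (G h) := by abel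
      _ = h := by rw [h1, h2]
  · have h1 := hR2 f
    change R (G (A f - (e : ℂ) • (f : L2Spinor))) = f
    have h3 : A f - (e : ℂ) • (f : L2Spinor) =
        (A f - (e₀ : ℂ) • (f : L2Spinor)) - d • R (A f - (e₀ : ℂ) • (f : L2Spinor)) := by
      rw [h1, hd, sub_smul]; abel
    rw [h3, hG2, h1]

lemma not_isEigenvalue_of_inResolventSet {A : L2Spinor →ₗ.[ℂ] L2Spinor} {z : ℂ}
    (h : InResolventSet A z) : ¬ IsEigenvalue A z := by
  obtain ⟨R, -, hR⟩ := h
  intro hz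
  refine hz ((Submodule.eq_bot_iff _).2 fun f hf => ?_)
  have hf' : (f, z • f) ∈ A.graph := hf
  rw [LinearPMap.mem_graph_iff] at hf'
  obtain ⟨y, hy1, hy2⟩ := hf'
  have := hR y
  simp only at hy1 hy2
  rw [hy2, hy1, sub_self, map_zero] at this
  exact this.symm

/-- The piecewise linear function equal to one on the left of `0` and to zero on the right
of `1`. -/
lemma exists_cutoff : ∃ φ φ' : ℝ → ℂ, IsPrimitive φ φ' ∧ (∀ x ≤ 0, φ x = 1) ∧
    (∀ x, 1 ≤ x → φ x = 0) ∧ (∀ x ∉ Icc (0 : ℝ) 1, φ' x = 0) ∧ (∀ x, ‖φ' x‖ ≤ 1) ∧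
    Measurable φ' := by
  set g : ℝ → ℂ := (Icc (0 : ℝ) 1).indicator fun _ => (-1 : ℂ) with hg
  have hgm : Measurable g := measurable_const.indicator measurableSet_Icc
  have hgi : LocallyIntegrable g :=
    ((integrable_indicator_iff measurableSet_Icc).2 (by simp)).locallyIntegrable
  have hi := LocallyIntegrable.intervalIntegrable' hgi
  have h0 : ∀ x ∉ Icc (0 : ℝ) 1, g x = 0 := fun x hx => indicator_of_notMem hx _
  refine ⟨fun x => 1 + ∫ s in (0 : ℝ)..x, g s, g, ⟨hgi, fun a b => ?_⟩, fun x hx => ?_,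
    fun x hx => ?_, h0, fun x => ?_, hgm⟩
  · rw [add_sub_add_left_eq_sub, intervalIntegral.integral_interval_sub_left (hi _ _) (hi _ _)]
  · have : ∫ s in (0 : ℝ)..x, g s = 0 := by
      rw [intervalIntegral.integral_symm, intervalIntegral.integral_of_le hx,
        integral_Ioc_eq_integral_Ioo, setIntegral_eq_zero_of_forall_eq_zero, neg_zero]
      exact fun s hs => h0 s fun hs' => by linarith [hs.2, hs'.1]
    simp only [this, add_zero]
  · have h1 : ∫ s in (0 : ℝ)..1, g s = -1 := by
      rw [intervalIntegral.integral_congr (g := fun _ => (-1 : ℂ))]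
      · simp
      · intro s hs
        rw [uIcc_of_le zero_le_one] at hs
        exact indicator_of_mem hs _
    have h2 : ∫ s in (1 : ℝ)..x, g s = 0 := by
      rw [intervalIntegral.integral_of_le hx, setIntegral_eq_zero_of_forall_eq_zero]
      exact fun s hs => h0 s fun hs' => by linarith [hs.1, hs'.2]
    beta_reduce
    rw [← intervalIntegral.integral_add_adjacent_intervals (hi 0 1) (hi 1 x), h1, h2]
    ring
  · by_cases hx : x ∈ Icc (0 : ℝ) 1
    · rw [hg, indicator_of_mem hx]; simp
    · rw [h0 x hx]; simp

/-- If the resolvent exists, then there is a solution that decays to the right. -/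
lemma exists_decaying_of_inResolventSet {q : ℝ → ℂ} (hq : LocallyIntegrable q) {E : ℝ}
    (hE : InResolventSet (diracOp (offDiag q)) E) :
    ∃ u v, IsSol q E u v ∧ SqInt (Ici 0) u v ∧ ∃ x, u x ≠ 0 := by
  obtain ⟨a, b, hab, ha, hb⟩ := exists_normalised hq E
  obtain ⟨φ, φ', hφ, hφ0, hφ1, hφs, hφb, hφm⟩ := exists_cutoff
  obtain ⟨R, hR, -⟩ := hE
  have hca := hab.1.continuous
  have hcb := hab.2.continuous
  -- This is the commutator term -iσ₃φ'(a, b), equal to the Dirac expression minus E applied to φ ·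
  -- (a, b). If y solves the equation with source `h`, then y - φ · (a, b) solves the homogeneous
  -- one.
  set h : ℝ → Spinor := fun x => !₂[-I * φ' x * a x, I * φ' x * b x] with hh
  have hhL : MemLp h 2 := by
    have key : ∀ (c : ℂ) (f : ℝ → ℂ), Continuous f → MemLp (fun x => c * φ' x * f x) 2 := by
      intro c f hf
      obtain ⟨M, hM⟩ := isCompact_Icc.exists_bound_of_continuousOn (hf.continuousOn (s := Icc 0 1))
      have hM0 : 0 ≤ M := (norm_nonneg _).trans (hM 0 (by simp))
      have hind : (fun x => c * φ' x * f x) =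
          (Icc (0 : ℝ) 1).indicator fun x => c * φ' x * f x := by
        refine (indicator_eq_self.2 fun x hx => ?_).symm
        by_contra hx'
        exact hx (by simp [hφs x hx'])
      rw [hind, memLp_indicator_iff_restrict measurableSet_Icc]
      refine MemLp.of_bound ((measurable_const.mul hφm).mul hf.measurable).aestronglyMeasurable
        (‖c‖ * 1 * M) ((ae_restrict_iff' measurableSet_Icc).2 (ae_of_all _ fun x hx => ?_))
      rw [norm_mul, norm_mul]
      gcongr
      · exact hφb x
      · exact hM x hx
    rw [memLp_piLp_iff, Fin.forall_fin_two]
    exact ⟨key (-I) a hca, key I b hcb⟩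
  obtain ⟨hdom, hRh⟩ := hR (hhL.toLp h)
  set f := R (hhL.toLp h)
  have hgr : (f, diracOp (offDiag q) ⟨f, hdom⟩) ∈ (diracOp (offDiag q)).graph :=
    LinearPMap.mem_graph _ (⟨f, hdom⟩ : (diracOp (offDiag q)).domain)
  rw [diracOp_graph] at hgr
  obtain ⟨y, w, hyw, hfy, hAf⟩ := hgr
  simp only at hfy hAf
  have hyeq : ∀ᵐ x, diracExpr (offDiag q) y w x = (E : ℂ) • y x + h x := by
    have e1 : diracOp (offDiag q) ⟨f, hdom⟩ = (E : ℂ) • f + hhL.toLp h := by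
      rw [← hRh]; abel
    rw [e1] at hAf
    filter_upwards [hAf, hfy, Lp.coeFn_add ((E : ℂ) • f) (hhL.toLp h), Lp.coeFn_smul (E : ℂ) f,
      hhL.coeFn_toLp] with x h1 h2 h3 h4 h5
    rw [← h1, h3, Pi.add_apply, h4, Pi.smul_apply, h2, h5]
  have hyL : MemLp y 2 := (Lp.memLp f).ae_eq hfy
  rw [hasLocalDeriv_iff] at hyw
  have hsol : IsSol q E (fun x => y x 0 - φ x * a x) (fun x => y x 1 - φ x * b x) := by
    constructor
    · refine ((hyw 0).sub (hφ.mul hab.1)).congr_ae ?_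
      filter_upwards [hyeq] with x hx
      have h1 := (diracExpr_offDiag q y w x).1
      rw [hx] at h1
      simp only [PiLp.add_apply, PiLp.smul_apply, smul_eq_mul, hh, Matrix.cons_val_zero] at h1
      linear_combination (-I) * h1 + (w x 0 - φ' x * a x) * Complex.I_mul_I
    · refine ((hyw 1).sub (hφ.mul hab.2)).congr_ae ?_
      filter_upwards [hyeq] with x hx
      have h1 := (diracExpr_offDiag q y w x).2
      rw [hx] at h1
      simp only [PiLp.add_apply, PiLp.smul_apply, smul_eq_mul, hh, Matrix.cons_val_one,
        Matrix.cons_val_fin_one] at h1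
      linear_combination I * h1 + (w x 1 - φ' x * b x) * Complex.I_mul_I
  have hyS : SqInt univ (fun x => y x 0) (fun x => y x 1) := by
    rw [SqInt, Measure.restrict_univ]
    rw [memLp_piLp_iff] at hyL
    exact ⟨hyL 0, hyL 1⟩
  have hS : SqInt (Ici 0) (fun x => y x 0 - φ x * a x) (fun x => y x 1 - φ x * b x) := by
    -- Beyond 1 the cutoff is zero and the difference is y itself.
    have h1 : SqInt (Ici 1) (fun x => y x 0 - φ x * a x) (fun x => y x 1 - φ x * b x) :=
      (hyS.mono (subset_univ _)).congr measurableSet_Ici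
        (fun x hx => by simp [hφ1 x hx]) (fun x hx => by simp [hφ1 x hx])
    refine ((SqInt.of_continuous hsol.1.continuous hsol.2.continuous 0 1).union h1).mono ?_
    intro x hx
    rcases le_total x 1 with h2 | h2
    · exact Or.inl ⟨hx, h2⟩
    · exact Or.inr h2
  refine ⟨_, _, hsol, hS, ?_⟩
  -- If the difference vanished, (a, b) would be y on the left half-line, so square integrable there
  -- with zero current, against a(0) = 1, b(0) = 0.
  by_contra! hcon
  have hcon' : ∀ x, y x 1 - φ x * b x = 0 := fun x => by
    have := hsol.norm_eq Real.volume_Ici hS x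
    rwa [hcon x, norm_zero, norm_eq_zero] at this
  have h1 : SqInt (Iic 0) a b := (hyS.mono (subset_univ _)).congr measurableSet_Iic
    (fun x hx => by simpa [hφ0 x hx] using sub_eq_zero.1 (hcon x))
    (fun x hx => by simpa [hφ0 x hx] using sub_eq_zero.1 (hcon' x))
  have h2 := hab.norm_eq Real.volume_Iic h1 0
  rw [ha, hb] at h2
  simp at h2

/-! ### Lines of decaying solutions and their phases -/

section Phase

variable {q : ℝ → ℂ} {E : ℝ} {u v : ℝ → ℂ} {S : Set ℝ}

/-- On a line, the chosen vector is a non-zero multiple of `f`, and the factor cancels in the ratio.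
-/
lemma theta_eq_of_hasPhase {ℒ : Submodule ℂ (ℝ → Spinor)} (h : HasPhase ℒ) {f : ℝ → Spinor}
    (hf : f ∈ ℒ) (hf0 : f ≠ 0) (x : ℝ) : theta ℒ x = f x 1 / f x 0 := by
  have hex : ∃ u ∈ ℒ, u ≠ 0 := ⟨f, hf, hf0⟩
  rw [theta, dif_pos hex]
  set g := hex.choose with hg
  have hg1 : g ∈ ℒ := hex.choose_spec.1
  obtain ⟨c, hc⟩ := (finrank_eq_one_iff_of_nonzero' (⟨f, hf⟩ : ℒ)
    (by simpa using hf0)).1 h.1 ⟨g, hg1⟩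
  have hc' : g = c • f := by simpa using (congrArg Subtype.val hc).symm
  have hc0 : c ≠ 0 := by
    rintro rfl
    exact hex.choose_spec.2 (by rw [← hg, hc', zero_smul])
  rw [hc']
  simp only [Pi.smul_apply, PiLp.smul_apply, smul_eq_mul]
  exact mul_div_mul_left _ _ hc0

/-- The decaying solutions form a line with a phase as soon as there is a non-null one. -/
lemma hasPhase_of_sqInt (hq : LocallyIntegrable q) (h : IsSol q E u v) (hS : volume S = ⊤)
    (hu : SqInt S u v) {y : ℝ} (hy : u y ≠ 0) :
    HasPhase (solutions (offDiag q) E ⊓ squareIntegrableOn S) ∧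
      ∀ x, theta (solutions (offDiag q) E ⊓ squareIntegrableOn S) x = v x / u x := by
  set ℒ := solutions (offDiag q) E ⊓ squareIntegrableOn S with hℒ
  have hmem : ∀ f : ℝ → Spinor, f ∈ ℒ ↔
      IsSol q E (fun x => f x 0) (fun x => f x 1) ∧ SqInt S (fun x => f x 0) (fun x => f x 1) :=
    fun f => by rw [hℒ, Submodule.mem_inf, mem_solutions_iff, mem_squareIntegrableOn_iff]
  set f : ℝ → Spinor := fun x => !₂[u x, v x] with hf
  have hfL : f ∈ ℒ := (hmem f).2 ⟨h, hu⟩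
  have hf0 : f ≠ 0 := fun h0 => by
    have h1 : f y 0 = 0 := by rw [h0]; rfl
    exact hy h1
  have hph : HasPhase ℒ := by
    constructor
    · refine (finrank_eq_one_iff_of_nonzero' (⟨f, hfL⟩ : ℒ) (by simpa using hf0)).2 fun w => ?_
      obtain ⟨w, hw⟩ := w
      obtain ⟨hw1, hw2⟩ := (hmem w).1 hw
      have := hw1.eq_smul_of_sqInt hq h hS hw2 hu (y := y) (c := w y 0 / u y) (by field_simp)
      refine ⟨w y 0 / u y, Subtype.ext (funext fun x => ?_)⟩
      ext i
      fin_cases i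
      · exact (this x).1.symm
      · exact (this x).2.symm
    · intro w hw hw0 x
      obtain ⟨hw1, hw2⟩ := (hmem w).1 hw
      refine ⟨fun hx => hw0 (funext fun y => ?_), hw1.norm_eq hS hw2 x⟩
      have := hw1.eq_zero_of_sqInt hq hS hw2 hx y
      ext i
      fin_cases i
      · exact this.1
      · exact this.2
  exact ⟨hph, fun x => theta_eq_of_hasPhase hph hfL hf0 x⟩

end Phase

/-! ### Hyperbolic transfer matrices -/

/-- The small root of `l² - 2 T l + 1`. -/
def smallRoot (T : ℝ) : ℝ := T * (1 - √(1 - (T ^ 2)⁻¹))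

/-- The large root of `l² - 2 T l + 1`. -/
def largeRoot (T : ℝ) : ℝ := T * (1 + √(1 - (T ^ 2)⁻¹))

section Roots

variable {T : ℝ}

lemma one_sub_inv_sq_pos (hT : 1 < T ^ 2) : 0 < 1 - (T ^ 2)⁻¹ :=
  sub_pos.2 (inv_lt_one_of_one_lt₀ hT)

lemma smallRoot_mul_largeRoot (hT : 1 < T ^ 2) : smallRoot T * largeRoot T = 1 := by
  have h := Real.sq_sqrt (one_sub_inv_sq_pos hT).le
  have h2 : T ^ 2 * (T ^ 2)⁻¹ = 1 := mul_inv_cancel₀ (by positivity)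
  rw [smallRoot, largeRoot]
  linear_combination (-T ^ 2) * h + h2

lemma smallRoot_add_largeRoot : smallRoot T + largeRoot T = 2 * T := by
  rw [smallRoot, largeRoot]; ring

/-- As `T` is factored out of T ± √(T² - 1), one formula, smooth in `T`, selects the root of large
modulus for both signs of `T`. -/
lemma one_lt_abs_largeRoot (hT : 1 < T ^ 2) : 1 < |largeRoot T| := by
  have h1 : 1 < |T| := (one_lt_sq_iff_one_lt_abs T).1 hT
  have h2 := Real.sqrt_pos.2 (one_sub_inv_sq_pos hT)
  rw [largeRoot, abs_mul, abs_of_pos (by linarith : 0 < 1 + √(1 - (T ^ 2)⁻¹))]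
  nlinarith

lemma abs_smallRoot_lt_one (hT : 1 < T ^ 2) : |smallRoot T| < 1 := by
  have h1 := one_lt_abs_largeRoot hT
  have h2 : |smallRoot T| * |largeRoot T| = 1 := by
    rw [← abs_mul, smallRoot_mul_largeRoot hT, abs_one]
  by_contra! h
  nlinarith [abs_nonneg (smallRoot T)]

lemma smallRoot_ne_largeRoot (hT : 1 < T ^ 2) : smallRoot T ≠ largeRoot T := fun h => by
  have h1 := abs_smallRoot_lt_one hT
  rw [h] at h1
  exact lt_asymm h1 (one_lt_abs_largeRoot hT)

lemma contDiffAt_sqrt_one_sub (hT : 1 < T ^ 2) :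
    ContDiffAt ℝ 1 (fun T : ℝ => √(1 - (T ^ 2)⁻¹)) T := by
  refine ContDiffAt.sqrt (contDiffAt_const.sub (ContDiffAt.inv (by fun_prop) ?_)) ?_
  · positivity
  · exact (one_sub_inv_sq_pos hT).ne'

lemma contDiffAt_smallRoot (hT : 1 < T ^ 2) : ContDiffAt ℝ 1 smallRoot T :=
  contDiffAt_id.mul (contDiffAt_const.sub (contDiffAt_sqrt_one_sub hT))

lemma contDiffAt_largeRoot (hT : 1 < T ^ 2) : ContDiffAt ℝ 1 largeRoot T :=
  contDiffAt_id.mul (contDiffAt_const.add (contDiffAt_sqrt_one_sub hT))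

end Roots

section Transfer

variable {q : ℝ → ℂ} {E : ℝ} {a b u v : ℝ → ℂ}

/-- A decaying solution forces the transfer matrix to be hyperbolic. -/
lemma one_lt_re_sq_of_decaying (hq : LocallyIntegrable q) (hqp : Function.Periodic q 1)
    (hab : IsSol q E a b) (ha : a 0 = 1) (hb : b 0 = 0) (h : IsSol q E u v)
    (hu : SqInt (Ici 0) u v) (hu0 : ∃ x, u x ≠ 0) : 1 < (a 1).re ^ 2 := by
  obtain ⟨l, hl, hm⟩ := h.exists_multiplier_plus hq hqp hu
  have h0 : u 0 ≠ 0 := fun h0 => by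
    obtain ⟨x, hx⟩ := hu0
    exact hx (h.eq_zero_of_sqInt hq Real.volume_Ici hu h0 x).1
  obtain ⟨h1, h2⟩ := hab.eq_combination ha hb h 1
  have h3 := hab.norm_sq_sub ha hb 1
  obtain ⟨m1, m2⟩ := hm 0
  rw [zero_add] at m1 m2
  rw [m1] at h1
  rw [m2] at h2
  have hT : a 1 + conj (a 1) = ((2 * (a 1).re : ℝ) : ℂ) := by
    rw [Complex.add_conj]
  -- `l` is an eigenvalue of the transfer matrix over a period, which has trace 2 Re a(1) and
  -- determinant one.
  have hroot : l ^ 2 - (2 * (a 1).re : ℝ) * l + 1 = 0 := by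
    rw [← hT]
    have : u 0 * (l ^ 2 - (a 1 + conj (a 1)) * l + 1) = 0 := by
      linear_combination (l - conj (a 1)) * h1 + conj (b 1) * h2 - u 0 * h3
    exact (mul_eq_zero.1 this).resolve_left h0
  set T := (a 1).re
  have him := congrArg Complex.im hroot
  have hre := congrArg Complex.re hroot
  have hln : l.re ^ 2 + l.im ^ 2 < 1 := by
    have h5 := Complex.sq_norm l
    rw [Complex.normSq_apply] at h5
    have h6 : ‖l‖ ^ 2 < 1 := (sq_lt_one_iff₀ (norm_nonneg _)).2 hl
    nlinarith
  simp only [Complex.add_im, Complex.sub_im, Complex.add_re, Complex.sub_re, pow_two,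
    Complex.mul_re, Complex.mul_im, Complex.ofReal_re, Complex.ofReal_im, Complex.one_re,
    Complex.one_im, Complex.zero_re, Complex.zero_im, zero_mul, sub_zero, add_zero] at him hre
  -- A non-real root of this real polynomial would have modulus one, the product of the roots being
  -- one.
  have h7 : l.im = 0 := by
    by_contra h8
    have h9 : l.re = T := by
      have : l.im * (l.re - T) = 0 := by linarith
      linarith [(mul_eq_zero.1 this).resolve_left h8]
    rw [← h9] at hre
    nlinarith
  rw [h7] at hre hln
  -- For a real root, T² ≤ 1 forces l = T and T² = 1, against |l| < 1.
  by_contra! hcon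
  have h10 : (l.re - T) ^ 2 = T ^ 2 - 1 := by nlinarith
  have h11 : l.re - T = 0 := by nlinarith [sq_nonneg (l.re - T)]
  nlinarith

/-- The phase at the origin of the Floquet solution with multiplier `l`. -/
def floquetPhase (l : ℝ) (A B : ℂ) : ℂ := (l - A) / conj B

/-- If b(1) = 0, then |a(1)| = 1 by the determinant, which is incompatible with |Re a(1)| > 1. So
`floquetPhase` has a non-zero denominator. -/
lemma one_lt_re_sq_ne_zero (hab : IsSol q E a b) (ha : a 0 = 1) (hb : b 0 = 0)
    (hT : 1 < (a 1).re ^ 2) : b 1 ≠ 0 := fun h => by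
  have h3 := hab.norm_sq_sub ha hb 1
  rw [h, zero_mul, sub_zero, Complex.mul_conj, Complex.normSq_apply] at h3
  have h4 : (a 1).re * (a 1).re + (a 1).im * (a 1).im = 1 := by exact_mod_cast h3
  nlinarith [sq_nonneg (a 1).im]

/-- The Floquet solution with multiplier `l`. -/
lemma floquet_shift (hq : LocallyIntegrable q) (hqp : Function.Periodic q 1)
    (hab : IsSol q E a b) (ha : a 0 = 1) (hb : b 0 = 0) (hb1 : b 1 ≠ 0) {l : ℝ}
    (hl : l ^ 2 - 2 * (a 1).re * l + 1 = 0) (x : ℝ) :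
    a (x + 1) + floquetPhase l (a 1) (b 1) * conj (b (x + 1)) =
        l * (a x + floquetPhase l (a 1) (b 1) * conj (b x)) ∧
      b (x + 1) + floquetPhase l (a 1) (b 1) * conj (a (x + 1)) =
        l * (b x + floquetPhase l (a 1) (b 1) * conj (a x)) := by
  set θ := floquetPhase l (a 1) (b 1) with hθ
  have hsol := hab.add (hab.conj_swap_real.smul θ)
  have hsh := hsol.comp_add 1
  rw [funext hqp] at hsh
  have hb1' : conj (b 1) ≠ 0 := by simpa using hb1
  -- (1, θ) is an eigenvector of the transfer matrix: the first row is the definition of θ, the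
  -- second one follows from the characteristic equation.
  have e1 : θ * conj (b 1) = l - a 1 := by rw [hθ, floquetPhase]; field_simp
  have hl' : (l : ℂ) ^ 2 - (a 1 + conj (a 1)) * l + 1 = 0 := by
    rw [Complex.add_conj]; exact_mod_cast hl
  have h3 := hab.norm_sq_sub ha hb 1
  have e2 : b 1 + θ * conj (a 1) = l * θ := by
    have : conj (b 1) * (b 1 + θ * conj (a 1) - l * θ) = 0 := by
      linear_combination (conj (a 1) - l) * e1 - hl' - h3
    linear_combination (mul_eq_zero.1 this).resolve_left hb1'
  refine hsh.eqOn_of_eq hq (hsol.smul l) (y := 0) (fun _ _ => rfl) ?_ ?_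
  · simp only [zero_add, ha, hb, map_zero, mul_zero, add_zero, mul_one]
    linear_combination e1
  · simp only [zero_add, ha, hb, map_one, mul_one]
    linear_combination e2

end Transfer

/-! ### The dislocated family and its decaying solutions -/

/-- The data of a dislocated periodic Dirac family: a periodic potential, a switch function, and a
fundamental solution that depends smoothly on the parameters. -/
structure Dislocation where
  V : ℝ → ℝ
  χ : ℝ → ℝ
  N : ℕ
  periodic : Function.Periodic V 1
  locallyIntegrable : LocallyIntegrable V
  locallyIntegrable_mul : LocallyIntegrable (fun x => V x * χ x)
  left : ∀ x ≤ -(N : ℝ), χ x = 1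
  right : ∀ x, (N : ℝ) ≤ x → χ x = 0
  a : ℝ × ℝ → ℝ → ℂ
  b : ℝ × ℝ → ℝ → ℂ
  isSol : ∀ p : ℝ × ℝ, IsSol (rotCoeff (fun x => ((V x * χ x : ℝ) : ℂ))
    (fun x => ((V x * (1 - χ x) : ℝ) : ℂ)) p.1) (p.2 : ℂ) (a p) (b p)
  a_zero : ∀ p, a p 0 = 1
  b_zero : ∀ p, b p 0 = 0
  contDiff_a : ∀ x, ContDiff ℝ 1 (fun p => a p x)
  contDiff_b : ∀ x, ContDiff ℝ 1 (fun p => b p x)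
  continuous_a : Continuous (fun p : (ℝ × ℝ) × ℝ => a p.1 p.2)
  continuous_b : Continuous (fun p : (ℝ × ℝ) × ℝ => b p.1 p.2)

lemma contDiff_conj : ContDiff ℝ 1 (fun z : ℂ => conj z) := Complex.conjCLE.contDiff

lemma ContDiffAt.conj' {F : Type*} [NormedAddCommGroup F] [NormedSpace ℝ F] {f : F → ℂ} {x : F}
    (h : ContDiffAt ℝ 1 f x) : ContDiffAt ℝ 1 (fun y => conj (f y)) x :=
  contDiff_conj.contDiffAt.comp x h

/-- The rotation by `2πt`. -/
def rot (t : ℝ) : ℂ := Complex.exp (2 * Real.pi * t * I)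

lemma rot_zero : rot 0 = 1 := by simp [rot]

lemma rot_one : rot 1 = 1 := by simp [rot, Complex.exp_two_pi_mul_I]

lemma conj_rot_mul_rot (t : ℝ) : conj (rot t) * rot t = 1 := by
  rw [rot, ← Complex.exp_conj, ← Complex.exp_add]
  simp [Complex.conj_ofNat]

lemma norm_rot (t : ℝ) : ‖rot t‖ = 1 := by simp [rot, Complex.norm_exp]

lemma contDiff_rot : ContDiff ℝ 1 rot :=
  ((contDiff_const.mul Complex.ofRealCLM.contDiff).mul contDiff_const).cexp

namespace Dislocation

variable (D : Dislocation)

/-- The coefficient of the domain wall equation. -/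
def q (t : ℝ) : ℝ → ℂ :=
  rotCoeff (fun x => ((D.V x * D.χ x : ℝ) : ℂ)) (fun x => ((D.V x * (1 - D.χ x) : ℝ) : ℂ)) t

lemma q_apply (t x : ℝ) :
    D.q t x = ((D.V x * D.χ x : ℝ) : ℂ) + rot t * ((D.V x * (1 - D.χ x) : ℝ) : ℂ) := rfl

lemma q_zero : D.q 0 = fun x => (D.V x : ℂ) := by
  funext x; rw [q_apply, rot_zero]; push_cast; ring

lemma q_one : D.q 1 = D.q 0 := by
  funext x; rw [q_apply, q_apply, rot_zero, rot_one]

lemma q_left (t : ℝ) {x : ℝ} (hx : x ≤ -(D.N : ℝ)) : D.q t x = D.q 0 x := by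
  simp [q_apply, D.left x hx]

lemma q_right (t : ℝ) {x : ℝ} (hx : (D.N : ℝ) ≤ x) : D.q t x = rot t * D.q 0 x := by
  simp [q_apply, D.right x hx, rot_zero]

lemma locallyIntegrable_coeff₁ : LocallyIntegrable (fun x => ((D.V x * D.χ x : ℝ) : ℂ)) := by
  have := D.locallyIntegrable_mul
  rw [locallyIntegrable_iff] at this ⊢
  exact fun k hk => (this k hk).ofReal

lemma locallyIntegrable_coeff₂ :
    LocallyIntegrable (fun x => ((D.V x * (1 - D.χ x) : ℝ) : ℂ)) := by
  have := D.locallyIntegrable.sub D.locallyIntegrable_mul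
  have h1 : D.V - (fun x => D.V x * D.χ x) = fun x => D.V x * (1 - D.χ x) := by
    funext x
    simp only [Pi.sub_apply]
    ring
  rw [h1] at this
  rw [locallyIntegrable_iff] at this ⊢
  exact fun k hk => (this k hk).ofReal

lemma locallyIntegrable_q (t : ℝ) : LocallyIntegrable (D.q t) :=
  D.locallyIntegrable_coeff₁.add
    (LocallyIntegrable.continuous_mul' D.locallyIntegrable_coeff₂ continuous_const)

lemma periodic_q_zero : Function.Periodic (D.q 0) 1 := fun x => by
  rw [q_zero]; simp [D.periodic x]

lemma isSol' (t E : ℝ) : IsSol (D.q t) E (D.a (t, E)) (D.b (t, E)) := D.isSol (t, E)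

/-- The half trace of the transfer matrix. -/
def halfTrace (E : ℝ) : ℝ := (D.a (0, E) 1).re

/-- The energies at which the transfer matrix is hyperbolic. -/
def hyp : Set ℝ := {E | 1 < D.halfTrace E ^ 2}

lemma contDiff_energy (x : ℝ) : ContDiff ℝ 1 (fun E => D.a (0, E) x) ∧
    ContDiff ℝ 1 (fun E => D.b (0, E) x) :=
  ⟨(D.contDiff_a x).comp (contDiff_const.prodMk contDiff_id),
    (D.contDiff_b x).comp (contDiff_const.prodMk contDiff_id)⟩

lemma contDiff_halfTrace : ContDiff ℝ 1 D.halfTrace :=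
  Complex.reCLM.contDiff.comp (D.contDiff_energy 1).1

lemma isOpen_hyp : IsOpen D.hyp :=
  isOpen_lt continuous_const (D.contDiff_halfTrace.continuous.pow 2)

/-- The phase at the origin of the Floquet solution that decays to the right. -/
def phaseP (E : ℝ) : ℂ := floquetPhase (smallRoot (D.halfTrace E)) (D.a (0, E) 1) (D.b (0, E) 1)

/-- The phase at the origin of the Floquet solution that decays to the left. -/
def phaseM (E : ℝ) : ℂ := floquetPhase (largeRoot (D.halfTrace E)) (D.a (0, E) 1) (D.b (0, E) 1)

/-- The upper component of the Floquet solution with phase `θ` at the origin. -/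
def bulkU (θ : ℂ) (E x : ℝ) : ℂ := D.a (0, E) x + θ * conj (D.b (0, E) x)

/-- The lower component of the Floquet solution with phase `θ` at the origin. -/
def bulkV (θ : ℂ) (E x : ℝ) : ℂ := D.b (0, E) x + θ * conj (D.a (0, E) x)

lemma isSol_bulk (θ : ℂ) (E : ℝ) : IsSol (D.q 0) E (D.bulkU θ E) (D.bulkV θ E) :=
  (D.isSol' 0 E).add ((D.isSol' 0 E).conj_swap_real.smul θ)

lemma bulkU_zero (θ : ℂ) (E : ℝ) : D.bulkU θ E 0 = 1 := by simp [bulkU, D.a_zero, D.b_zero]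

lemma bulkV_zero (θ : ℂ) (E : ℝ) : D.bulkV θ E 0 = θ := by simp [bulkV, D.a_zero, D.b_zero]

variable {D} {E : ℝ}

lemma b_one_ne_zero (hE : E ∈ D.hyp) : D.b (0, E) 1 ≠ 0 :=
  one_lt_re_sq_ne_zero (D.isSol' 0 E) (D.a_zero _) (D.b_zero _) hE

lemma shiftP (hE : E ∈ D.hyp) (x : ℝ) :
    D.bulkU (D.phaseP E) E (x + 1) = smallRoot (D.halfTrace E) * D.bulkU (D.phaseP E) E x ∧
      D.bulkV (D.phaseP E) E (x + 1) = smallRoot (D.halfTrace E) * D.bulkV (D.phaseP E) E x :=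
  floquet_shift (D.locallyIntegrable_q 0) D.periodic_q_zero (D.isSol' 0 E) (D.a_zero _)
    (D.b_zero _) (b_one_ne_zero hE) (by
      have h1 := smallRoot_mul_largeRoot hE
      have h2 := smallRoot_add_largeRoot (T := D.halfTrace E)
      rw [← halfTrace]
      linear_combination smallRoot (D.halfTrace E) * h2 - h1) x

lemma shiftM (hE : E ∈ D.hyp) (x : ℝ) :
    D.bulkU (D.phaseM E) E (x + 1) = largeRoot (D.halfTrace E) * D.bulkU (D.phaseM E) E x ∧
      D.bulkV (D.phaseM E) E (x + 1) = largeRoot (D.halfTrace E) * D.bulkV (D.phaseM E) E x :=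
  floquet_shift (D.locallyIntegrable_q 0) D.periodic_q_zero (D.isSol' 0 E) (D.a_zero _)
    (D.b_zero _) (b_one_ne_zero hE) (by
      have h1 := smallRoot_mul_largeRoot hE
      have h2 := smallRoot_add_largeRoot (T := D.halfTrace E)
      rw [← halfTrace]
      linear_combination largeRoot (D.halfTrace E) * h2 - h1) x

lemma sqInt_bulkP (hE : E ∈ D.hyp) :
    SqInt (Ici 0) (D.bulkU (D.phaseP E) E) (D.bulkV (D.phaseP E) E) :=
  SqInt.of_multiplier_plus (D.isSol_bulk _ E).1.continuous (D.isSol_bulk _ E).2.continuous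
    (l := smallRoot (D.halfTrace E)) (by
      rw [Complex.norm_real]; exact abs_smallRoot_lt_one hE) (shiftP hE)

lemma sqInt_bulkM (hE : E ∈ D.hyp) :
    SqInt (Iic 0) (D.bulkU (D.phaseM E) E) (D.bulkV (D.phaseM E) E) := by
  have h1 : (smallRoot (D.halfTrace E) : ℂ) * largeRoot (D.halfTrace E) = 1 := by
    exact_mod_cast smallRoot_mul_largeRoot hE
  refine SqInt.of_multiplier_minus (D.isSol_bulk _ E).1.continuous (D.isSol_bulk _ E).2.continuous
    (l := smallRoot (D.halfTrace E)) (by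
      rw [Complex.norm_real]; exact abs_smallRoot_lt_one hE) (fun x => ?_)
  have h2 := shiftM hE (x + -1)
  rw [neg_add_cancel_right] at h2
  rw [h2.1, h2.2, ← mul_assoc, ← mul_assoc, h1, one_mul, one_mul]
  exact ⟨rfl, rfl⟩

lemma bulkU_ne_zero_P (hE : E ∈ D.hyp) (x : ℝ) : D.bulkU (D.phaseP E) E x ≠ 0 := fun hx => by
  have := ((D.isSol_bulk _ E).eq_zero_of_sqInt (D.locallyIntegrable_q 0) Real.volume_Ici
    (sqInt_bulkP hE) hx 0).1
  simp [bulkU_zero] at this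

lemma bulkU_ne_zero_M (hE : E ∈ D.hyp) (x : ℝ) : D.bulkU (D.phaseM E) E x ≠ 0 := fun hx => by
  have := ((D.isSol_bulk _ E).eq_zero_of_sqInt (D.locallyIntegrable_q 0) Real.volume_Iic
    (sqInt_bulkM hE) hx 0).1
  simp [bulkU_zero] at this

lemma norm_phaseP (hE : E ∈ D.hyp) : ‖D.phaseP E‖ = 1 := by
  have := (D.isSol_bulk _ E).norm_eq Real.volume_Ici (sqInt_bulkP hE) 0
  rw [bulkU_zero, bulkV_zero] at this
  simpa using this

lemma norm_phaseM (hE : E ∈ D.hyp) : ‖D.phaseM E‖ = 1 := by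
  have := (D.isSol_bulk _ E).norm_eq Real.volume_Iic (sqInt_bulkM hE) 0
  rw [bulkU_zero, bulkV_zero] at this
  simpa using this

lemma phaseP_ne_phaseM (hE : E ∈ D.hyp) : D.phaseP E ≠ D.phaseM E := fun h => by
  have hb : conj (D.b (0, E) 1) ≠ 0 := by simpa using b_one_ne_zero hE
  rw [phaseP, phaseM, floquetPhase, floquetPhase, div_left_inj' hb, sub_left_inj] at h
  exact smallRoot_ne_largeRoot hE (by exact_mod_cast h)

lemma contDiffAt_floquetPhase {f : ℝ → ℝ} (hE : E ∈ D.hyp) (hf : ContDiffAt ℝ 1 f E) :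
    ContDiffAt ℝ 1 (fun E => floquetPhase (f E) (D.a (0, E) 1) (D.b (0, E) 1)) E := by
  have h1 := (D.contDiff_energy 1).1.contDiffAt (x := E)
  have h2 := (D.contDiff_energy 1).2.contDiffAt (x := E)
  simp only [floquetPhase, div_eq_mul_inv]
  exact ((Complex.ofRealCLM.contDiff.contDiffAt.comp E hf).sub h1).mul
    ((ContDiffAt.conj' h2).inv (by simpa using b_one_ne_zero hE))

lemma contDiffAt_phaseP (hE : E ∈ D.hyp) : ContDiffAt ℝ 1 D.phaseP E :=
  contDiffAt_floquetPhase hE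
    ((contDiffAt_smallRoot hE).comp E D.contDiff_halfTrace.contDiffAt)

lemma contDiffAt_phaseM (hE : E ∈ D.hyp) : ContDiffAt ℝ 1 D.phaseM E :=
  contDiffAt_floquetPhase hE
    ((contDiffAt_largeRoot hE).comp E D.contDiff_halfTrace.contDiffAt)

/-! ### Decaying solutions of the domain wall equation -/

variable (D)

/-- The upper component of the solution of the domain wall equation with value `(r, s)` at `y`. -/
def transU (y : ℝ) (r s : ℂ) (p : ℝ × ℝ) (x : ℝ) : ℂ :=
  (r * conj (D.a p y) - s * conj (D.b p y)) * D.a p x +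
    (s * D.a p y - r * D.b p y) * conj (D.b p x)

/-- The lower component of the solution of the domain wall equation with value `(r, s)` at `y`. -/
def transV (y : ℝ) (r s : ℂ) (p : ℝ × ℝ) (x : ℝ) : ℂ :=
  (r * conj (D.a p y) - s * conj (D.b p y)) * D.b p x +
    (s * D.a p y - r * D.b p y) * conj (D.a p x)

lemma isSol_trans (y : ℝ) (r s : ℂ) (p : ℝ × ℝ) :
    IsSol (D.q p.1) p.2 (D.transU y r s p) (D.transV y r s p) :=
  ((D.isSol p).smul _).add ((D.isSol p).conj_swap_real.smul _)

lemma trans_self (y : ℝ) (r s : ℂ) (p : ℝ × ℝ) :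
    D.transU y r s p y = r ∧ D.transV y r s p y = s := by
  have h1 := (D.isSol p).norm_sq_sub (D.a_zero p) (D.b_zero p) y
  rw [transU, transV]
  exact ⟨by linear_combination r * h1, by linear_combination s * h1⟩

/-- The solution of the domain wall equation that decays to the right, upper component. -/
def wallUP (p : ℝ × ℝ) : ℝ → ℂ := D.transU D.N (D.bulkU (D.phaseP p.2) p.2 D.N)
  (rot p.1 * D.bulkV (D.phaseP p.2) p.2 D.N) p

/-- The solution of the domain wall equation that decays to the right, lower component. -/
def wallVP (p : ℝ × ℝ) : ℝ → ℂ := D.transV D.N (D.bulkU (D.phaseP p.2) p.2 D.N)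
  (rot p.1 * D.bulkV (D.phaseP p.2) p.2 D.N) p

/-- The solution of the domain wall equation that decays to the left, upper component. -/
def wallUM (p : ℝ × ℝ) : ℝ → ℂ := D.transU (-D.N) (D.bulkU (D.phaseM p.2) p.2 (-D.N))
  (D.bulkV (D.phaseM p.2) p.2 (-D.N)) p

/-- The solution of the domain wall equation that decays to the left, lower component. -/
def wallVM (p : ℝ × ℝ) : ℝ → ℂ := D.transV (-D.N) (D.bulkU (D.phaseM p.2) p.2 (-D.N))
  (D.bulkV (D.phaseM p.2) p.2 (-D.N)) p

lemma isSol_wallP (p : ℝ × ℝ) : IsSol (D.q p.1) p.2 (D.wallUP p) (D.wallVP p) :=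
  D.isSol_trans _ _ _ p

lemma isSol_wallM (p : ℝ × ℝ) : IsSol (D.q p.1) p.2 (D.wallUM p) (D.wallVM p) :=
  D.isSol_trans _ _ _ p

/-- On the right of N the wall coefficient is the rotated bulk coefficient, and the data at N match.
-/
lemma wallP_eq (p : ℝ × ℝ) {x : ℝ} (hx : (D.N : ℝ) ≤ x) :
    D.wallUP p x = D.bulkU (D.phaseP p.2) p.2 x ∧
      D.wallVP p x = rot p.1 * D.bulkV (D.phaseP p.2) p.2 x := by
  have h1 := (D.isSol_bulk (D.phaseP p.2) p.2).rotate (conj_rot_mul_rot p.1)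
  refine (D.isSol_wallP p).eqOn_of_eq (D.locallyIntegrable_q p.1) h1 (y := D.N) (fun s hs => ?_)
    (D.trans_self _ _ _ p).1 (D.trans_self _ _ _ p).2
  rw [uIoc_of_le hx] at hs
  exact D.q_right p.1 hs.1.le

lemma wallM_eq (p : ℝ × ℝ) {x : ℝ} (hx : x ≤ -(D.N : ℝ)) :
    D.wallUM p x = D.bulkU (D.phaseM p.2) p.2 x ∧
      D.wallVM p x = D.bulkV (D.phaseM p.2) p.2 x := by
  refine (D.isSol_wallM p).eqOn_of_eq (D.locallyIntegrable_q p.1)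
    (D.isSol_bulk (D.phaseM p.2) p.2) (y := -D.N) (fun s hs => ?_)
    (D.trans_self _ _ _ p).1 (D.trans_self _ _ _ p).2
  rw [uIoc_of_ge hx] at hs
  exact D.q_left p.1 hs.2

variable {D} {p : ℝ × ℝ}

lemma sqInt_wallP (hE : p.2 ∈ D.hyp) : SqInt (Ici 0) (D.wallUP p) (D.wallVP p) := by
  have h0 := sqInt_bulkP hE
  have h1 : SqInt (Ici 0) (D.bulkU (D.phaseP p.2) p.2)
      (fun x => rot p.1 * D.bulkV (D.phaseP p.2) p.2 x) := ⟨h0.1, h0.2.const_mul _⟩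
  have h2 : SqInt (Ici (D.N : ℝ)) (D.wallUP p) (D.wallVP p) :=
    (h1.mono (Ici_subset_Ici.2 (Nat.cast_nonneg _))).congr measurableSet_Ici
      (fun x hx => (D.wallP_eq p hx).1.symm) (fun x hx => (D.wallP_eq p hx).2.symm)
  refine ((SqInt.of_continuous (D.isSol_wallP p).1.continuous (D.isSol_wallP p).2.continuous 0
    D.N).union h2).mono fun x hx => ?_
  rcases le_total x D.N with h3 | h3
  · exact Or.inl ⟨hx, h3⟩
  · exact Or.inr h3

lemma sqInt_wallM (hE : p.2 ∈ D.hyp) : SqInt (Iic 0) (D.wallUM p) (D.wallVM p) := by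
  have h2 : SqInt (Iic (-(D.N : ℝ))) (D.wallUM p) (D.wallVM p) :=
    ((sqInt_bulkM hE).mono (Iic_subset_Iic.2 (by simp))).congr measurableSet_Iic
      (fun x hx => (D.wallM_eq p hx).1.symm) (fun x hx => (D.wallM_eq p hx).2.symm)
  refine ((SqInt.of_continuous (D.isSol_wallM p).1.continuous (D.isSol_wallM p).2.continuous
    (-D.N) 0).union h2).mono fun x hx => ?_
  rcases le_total (-(D.N : ℝ)) x with h3 | h3
  · exact Or.inl ⟨h3, hx⟩
  · exact Or.inr h3

lemma wallUP_ne_zero (hE : p.2 ∈ D.hyp) (x : ℝ) : D.wallUP p x ≠ 0 := fun hx => by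
  have := ((D.isSol_wallP p).eq_zero_of_sqInt (D.locallyIntegrable_q p.1) Real.volume_Ici
    (sqInt_wallP hE) hx D.N).1
  rw [(D.wallP_eq p le_rfl).1] at this
  exact bulkU_ne_zero_P hE _ this

lemma wallUM_ne_zero (hE : p.2 ∈ D.hyp) (x : ℝ) : D.wallUM p x ≠ 0 := fun hx => by
  have := ((D.isSol_wallM p).eq_zero_of_sqInt (D.locallyIntegrable_q p.1) Real.volume_Iic
    (sqInt_wallM hE) hx (-D.N)).1
  rw [(D.wallM_eq p le_rfl).1] at this
  exact bulkU_ne_zero_M hE _ this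

lemma norm_wallP (hE : p.2 ∈ D.hyp) (x : ℝ) : ‖D.wallVP p x‖ = ‖D.wallUP p x‖ :=
  (D.isSol_wallP p).norm_eq Real.volume_Ici (sqInt_wallP hE) x

lemma norm_wallM (hE : p.2 ∈ D.hyp) (x : ℝ) : ‖D.wallVM p x‖ = ‖D.wallUM p x‖ :=
  (D.isSol_wallM p).norm_eq Real.volume_Iic (sqInt_wallM hE) x

lemma contDiffAt_trans (x y : ℝ) {r s : ℝ × ℝ → ℂ} (hr : ContDiffAt ℝ 1 r p)
    (hs : ContDiffAt ℝ 1 s p) :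
    ContDiffAt ℝ 1 (fun p => D.transU y (r p) (s p) p x) p ∧
      ContDiffAt ℝ 1 (fun p => D.transV y (r p) (s p) p x) p := by
  have ax := (D.contDiff_a x).contDiffAt (x := p)
  have bx := (D.contDiff_b x).contDiffAt (x := p)
  have ay := (D.contDiff_a y).contDiffAt (x := p)
  have yb := (D.contDiff_b y).contDiffAt (x := p)
  have h1 := (hr.mul (ContDiffAt.conj' ay)).sub (hs.mul (ContDiffAt.conj' yb))
  have h2 := (hs.mul ay).sub (hr.mul yb)
  exact ⟨(h1.mul ax).add (h2.mul (ContDiffAt.conj' bx)),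
    (h1.mul bx).add (h2.mul (ContDiffAt.conj' ax))⟩

/-- Continuity jointly in the parameters and the position is what the integrals of the Green density
require. -/
lemma continuousAt_trans (x y : ℝ) {r s : ℝ × ℝ → ℂ} (hr : ContinuousAt r p)
    (hs : ContinuousAt s p) :
    ContinuousAt (fun z : (ℝ × ℝ) × ℝ => D.transU y (r z.1) (s z.1) z.1 z.2) (p, x) ∧
      ContinuousAt (fun z : (ℝ × ℝ) × ℝ => D.transV y (r z.1) (s z.1) z.1 z.2) (p, x) := by
  have ax := D.continuous_a.continuousAt (x := (p, x))
  have bx := D.continuous_b.continuousAt (x := (p, x))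
  have ay : ContinuousAt (fun z : (ℝ × ℝ) × ℝ => D.a z.1 y) (p, x) :=
    ((D.contDiff_a y).continuous.comp continuous_fst).continuousAt
  have yb : ContinuousAt (fun z : (ℝ × ℝ) × ℝ => D.b z.1 y) (p, x) :=
    ((D.contDiff_b y).continuous.comp continuous_fst).continuousAt
  have hr' : ContinuousAt (fun z : (ℝ × ℝ) × ℝ => r z.1) (p, x) :=
    ContinuousAt.comp (f := Prod.fst) (x := (p, x)) hr continuousAt_fst
  have hs' : ContinuousAt (fun z : (ℝ × ℝ) × ℝ => s z.1) (p, x) :=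
    ContinuousAt.comp (f := Prod.fst) (x := (p, x)) hs continuousAt_fst
  have hc := Complex.continuous_conj
  have h1 := (hr'.mul (hc.continuousAt.comp ay)).sub (hs'.mul (hc.continuousAt.comp yb))
  have h2 := (hs'.mul ay).sub (hr'.mul yb)
  exact ⟨(h1.mul ax).add (h2.mul (hc.continuousAt.comp bx)),
    (h1.mul bx).add (h2.mul (hc.continuousAt.comp ax))⟩

lemma contDiffAt_bulk {θ : ℝ → ℂ} (x : ℝ) (h : ContDiffAt ℝ 1 θ p.2) :
    ContDiffAt ℝ 1 (fun p : ℝ × ℝ => D.bulkU (θ p.2) p.2 x) p ∧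
      ContDiffAt ℝ 1 (fun p : ℝ × ℝ => D.bulkV (θ p.2) p.2 x) p := by
  have ha : ContDiffAt ℝ 1 (fun p : ℝ × ℝ => D.a (0, p.2) x) p :=
    ((D.contDiff_energy x).1.comp contDiff_snd).contDiffAt
  have hb : ContDiffAt ℝ 1 (fun p : ℝ × ℝ => D.b (0, p.2) x) p :=
    ((D.contDiff_energy x).2.comp contDiff_snd).contDiffAt
  have hθ : ContDiffAt ℝ 1 (fun p : ℝ × ℝ => θ p.2) p := h.comp p contDiffAt_snd
  exact ⟨ha.add (hθ.mul (ContDiffAt.conj' hb)), hb.add (hθ.mul (ContDiffAt.conj' ha))⟩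

lemma contDiffAt_rot_fst : ContDiffAt ℝ 1 (fun p : ℝ × ℝ => rot p.1) p :=
  (contDiff_rot.comp contDiff_fst).contDiffAt

lemma contDiffAt_wallP (hE : p.2 ∈ D.hyp) (x : ℝ) :
    ContDiffAt ℝ 1 (fun p => D.wallUP p x) p ∧ ContDiffAt ℝ 1 (fun p => D.wallVP p x) p := by
  have h := contDiffAt_bulk (D := D) (D.N : ℝ) (contDiffAt_phaseP hE)
  exact contDiffAt_trans x _ h.1 (contDiffAt_rot_fst.mul h.2)

lemma contDiffAt_wallM (hE : p.2 ∈ D.hyp) (x : ℝ) :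
    ContDiffAt ℝ 1 (fun p => D.wallUM p x) p ∧ ContDiffAt ℝ 1 (fun p => D.wallVM p x) p := by
  have h := contDiffAt_bulk (D := D) (-(D.N : ℝ)) (contDiffAt_phaseM hE)
  exact contDiffAt_trans x _ h.1 h.2

lemma continuousAt_wallP (hE : p.2 ∈ D.hyp) (x : ℝ) :
    ContinuousAt (fun z : (ℝ × ℝ) × ℝ => D.wallUP z.1 z.2) (p, x) ∧
      ContinuousAt (fun z : (ℝ × ℝ) × ℝ => D.wallVP z.1 z.2) (p, x) := by
  have h := contDiffAt_bulk (D := D) (D.N : ℝ) (contDiffAt_phaseP hE)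
  exact continuousAt_trans (r := fun p : ℝ × ℝ => D.bulkU (D.phaseP p.2) p.2 D.N)
    (s := fun p : ℝ × ℝ => rot p.1 * D.bulkV (D.phaseP p.2) p.2 D.N) x _ h.1.continuousAt
    (contDiffAt_rot_fst.continuousAt.mul h.2.continuousAt)

lemma continuousAt_wallM (hE : p.2 ∈ D.hyp) (x : ℝ) :
    ContinuousAt (fun z : (ℝ × ℝ) × ℝ => D.wallUM z.1 z.2) (p, x) ∧
      ContinuousAt (fun z : (ℝ × ℝ) × ℝ => D.wallVM z.1 z.2) (p, x) := by
  have h := contDiffAt_bulk (D := D) (-(D.N : ℝ)) (contDiffAt_phaseM hE)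
  exact continuousAt_trans (r := fun p : ℝ × ℝ => D.bulkU (D.phaseM p.2) p.2 (-D.N))
    (s := fun p : ℝ × ℝ => D.bulkV (D.phaseM p.2) p.2 (-D.N)) x _ h.1.continuousAt
    h.2.continuousAt

end Dislocation

/-! ### Prüfer angles -/

/-- The derivative of the Prüfer angle of a solution with phase `θ`. -/
def pruferRate (q θ : ℝ → ℂ) (E s : ℝ) : ℝ := -2 * E + 2 * (conj (q s) * θ s).re

lemma locallyIntegrable_pruferRate {q θ : ℝ → ℂ} (hq : LocallyIntegrable q) (hθ : Continuous θ)
    (E : ℝ) : LocallyIntegrable (pruferRate q θ E) := by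
  have h1 : LocallyIntegrable (fun s => (conj (q s) * θ s).re) := by
    have h := LocallyIntegrable.mul_continuous' (LocallyIntegrable.conj' hq) hθ
    rw [locallyIntegrable_iff] at h ⊢
    exact fun k hk => (h k hk).re
  exact (locallyIntegrable_const _).add (h1.smul (2 : ℝ))

/-- The phase of a solution rotates according to the Prüfer equation. -/
lemma IsSol.phase_eq {q : ℝ → ℂ} (hq : LocallyIntegrable q) {E : ℝ} {u v : ℝ → ℂ}
    (h : IsSol q E u v) (hu : ∀ x, u x ≠ 0) (hn : ∀ x, ‖v x‖ = ‖u x‖) (y x : ℝ) :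
    v x / u x = v y / u y *
      Complex.exp (I * (∫ s in y..x, pruferRate q (fun s => v s / u s) E s : ℝ)) := by
  have hcu := h.1.continuous
  have hcv := h.2.continuous
  have hr : LocallyIntegrable (pruferRate q (fun s => v s / u s) E) :=
    locallyIntegrable_pruferRate hq (hcv.div hcu hu) E
  have hA : IsPrimitive
      (fun x => ((∫ s in y..x, pruferRate q (fun s => v s / u s) E s : ℝ) : ℂ))
      (fun s => (pruferRate q (fun s => v s / u s) E s : ℂ)) := by
    constructor
    · rw [locallyIntegrable_iff] at hr ⊢
      exact fun k hk => (hr k hk).ofReal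
    · intro a b
      have hi := LocallyIntegrable.intervalIntegrable' hr
      rw [intervalIntegral.integral_ofReal, ← Complex.ofReal_sub,
        intervalIntegral.integral_interval_sub_left (hi _ _) (hi _ _)]
  -- The phase satisfies θ' = iθ(-2E + q̄θ + q/θ), and |θ| = 1 makes q/θ the conjugate of q̄θ, so
  -- that the bracket is the real rate. Hence θ exp(-iA) has derivative zero.
  have h1 := (h.2.mul (h.1.inv hu)).mul (hA.const_mul (-I)).cexp
  have h2 := h1.congr_ae (g' := fun _ => 0) (ae_of_all _ fun s => by
    have e1 : (pruferRate q (fun s => v s / u s) E s : ℂ) =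
        -2 * E + (conj (q s) * (v s / u s) + q s * (u s / v s)) := by
      have e2 : conj (v s / u s) = u s / v s := by
        have hv : v s ≠ 0 := fun h0 => hu s (by
          have := hn s; rw [h0, norm_zero] at this; exact norm_eq_zero.1 this.symm)
        have e3 : conj (v s) * v s = conj (u s) * u s := by
          rw [Complex.conj_mul', Complex.conj_mul', hn]
        have hu' : conj (u s) ≠ 0 := by simpa using hu s
        rw [map_div₀]
        field_simp
        linear_combination e3
      have e4 : conj (conj (q s) * (v s / u s)) = q s * (u s / v s) := by
        rw [map_mul, e2, Complex.conj_conj]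
      rw [pruferRate, ← e4, Complex.add_conj]
      push_cast
      ring
    have hv : v s ≠ 0 := fun h0 => hu s (by
      have := hn s; rw [h0, norm_zero] at this; exact norm_eq_zero.1 this.symm)
    have hus := hu s
    simp only [e1]
    field_simp
    ring)
  have h3 := h2.2 y x
  simp only [intervalIntegral.integral_zero, intervalIntegral.integral_same, Complex.ofReal_zero,
    mul_zero, Complex.exp_zero, mul_one, sub_eq_zero] at h3
  rw [div_eq_mul_inv, div_eq_mul_inv, ← h3, mul_assoc, ← Complex.exp_add]
  simp

lemma HasWindingNumber.of_arg {u : ℝ → ℂ} {α : ℝ → ℝ} {c : ℂ} (hc : ‖c‖ = 1)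
    (hα : ContinuousOn α (Icc 0 1))
    (hu : ∀ t ∈ Icc (0 : ℝ) 1, u t = c * Complex.exp (I * α t)) {k : ℤ}
    (hk : α 1 - α 0 = 2 * Real.pi * k) : HasWindingNumber u k := by
  refine ⟨fun t => c.arg + α t, continuousOn_const.add hα, fun t ht => ?_, by linarith⟩
  rw [hu t ht]
  have h1 := Complex.norm_mul_exp_arg_mul_I c
  rw [hc, Complex.ofReal_one, one_mul] at h1
  conv_lhs => rw [← h1]
  rw [← Complex.exp_add]
  push_cast
  ring_nf

namespace Dislocation

variable {D : Dislocation}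

lemma continuousAt_integral_pruferRate {θ : ℝ × ℝ → ℝ → ℂ} {p : ℝ × ℝ} (y x : ℝ)
    (h1 : ∀ s, ContinuousAt (fun p => θ p s) p) (h2 : ∀ᶠ p' in 𝓝 p, Continuous (θ p'))
    (h3 : ∀ᶠ p' in 𝓝 p, ∀ s, ‖θ p' s‖ ≤ 1) :
    ContinuousAt (fun p => ∫ s in y..x, pruferRate (D.q p.1) (θ p) p.2 s) p := by
  -- The bound is valid for energies within 1 of that of `p`, and for all times since |`rot t`| = 1.
  set B : ℝ → ℝ := fun s => 2 * (|p.2| + 1) +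
    2 * (‖((D.V s * D.χ s : ℝ) : ℂ)‖ + ‖((D.V s * (1 - D.χ s) : ℝ) : ℂ)‖) with hB
  have hBl : LocallyIntegrable B :=
    (locallyIntegrable_const _).add (((LocallyIntegrable.norm' D.locallyIntegrable_coeff₁).add
      (LocallyIntegrable.norm' D.locallyIntegrable_coeff₂)).smul (2 : ℝ))
  refine intervalIntegral.continuousAt_of_dominated_interval (bound := B) ?_ ?_
    (LocallyIntegrable.intervalIntegrable' hBl y x) (ae_of_all _ fun s _ => ?_)
  · filter_upwards [h2] with p' hp'
    exact (locallyIntegrable_pruferRate (D.locallyIntegrable_q p'.1) hp'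
      p'.2).aestronglyMeasurable.restrict
  · have h4 : ∀ᶠ p' : ℝ × ℝ in 𝓝 p, |p'.2| < |p.2| + 1 :=
      (continuous_snd.abs.continuousAt (x := p)).eventually (gt_mem_nhds (by linarith))
    filter_upwards [h3, h4] with p' hp' hp4
    refine ae_of_all _ fun s _ => ?_
    have e1 : ‖D.q p'.1 s‖ ≤ ‖((D.V s * D.χ s : ℝ) : ℂ)‖ + ‖((D.V s * (1 - D.χ s) : ℝ) : ℂ)‖ := by
      rw [q_apply]
      refine (norm_add_le _ _).trans ?_
      rw [norm_mul, norm_rot, one_mul]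
    have e2 : |(conj (D.q p'.1 s) * θ p' s).re| ≤ ‖D.q p'.1 s‖ := by
      refine (Complex.abs_re_le_norm _).trans ?_
      rw [norm_mul, RCLike.norm_conj]
      exact mul_le_of_le_one_right (norm_nonneg _) (hp' s)
    rw [pruferRate, Real.norm_eq_abs]
    refine (abs_add_le _ _).trans ?_
    rw [abs_mul, abs_mul, abs_neg, abs_two]
    simp only [hB]
    linarith
  · have hq : ContinuousAt (fun p : ℝ × ℝ => D.q p.1 s) p := by
      simp only [q_apply]
      exact (continuous_const.add ((contDiff_rot.continuous.comp continuous_fst).mul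
        continuous_const)).continuousAt
    have hc := (Complex.continuous_conj.continuousAt.comp hq).mul (h1 s)
    exact (continuousAt_const.mul continuousAt_snd).add
      (continuousAt_const.mul (Complex.continuous_re.continuousAt.comp hc))

/-- The Prüfer angle acquired between `y` and `x` by the solution that decays to the right. -/
def angleP (D : Dislocation) (y x : ℝ) (p : ℝ × ℝ) : ℝ :=
  ∫ s in y..x, pruferRate (D.q p.1) (fun s => D.wallVP p s / D.wallUP p s) p.2 s

/-- The Prüfer angle acquired between `y` and `x` by the solution that decays to the left. -/
def angleM (D : Dislocation) (y x : ℝ) (p : ℝ × ℝ) : ℝ :=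
  ∫ s in y..x, pruferRate (D.q p.1) (fun s => D.wallVM p s / D.wallUM p s) p.2 s

variable {p : ℝ × ℝ}

lemma eventually_hyp (hp : p.2 ∈ D.hyp) : ∀ᶠ p' : ℝ × ℝ in 𝓝 p, p'.2 ∈ D.hyp :=
  continuousAt_snd.eventually (D.isOpen_hyp.mem_nhds hp)

lemma continuousAt_angleP (hp : p.2 ∈ D.hyp) (y x : ℝ) : ContinuousAt (D.angleP y x) p := by
  refine continuousAt_integral_pruferRate y x (fun s => ?_) ?_ ?_
  · exact (contDiffAt_wallP hp s).2.continuousAt.div (contDiffAt_wallP hp s).1.continuousAt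
      (wallUP_ne_zero hp s)
  · filter_upwards [eventually_hyp hp] with p' hp'
    exact (D.isSol_wallP p').2.continuous.div (D.isSol_wallP p').1.continuous (wallUP_ne_zero hp')
  · filter_upwards [eventually_hyp hp] with p' hp' s
    rw [norm_div, norm_wallP hp', div_self (norm_ne_zero_iff.2 (wallUP_ne_zero hp' s))]

lemma continuousAt_angleM (hp : p.2 ∈ D.hyp) (y x : ℝ) : ContinuousAt (D.angleM y x) p := by
  refine continuousAt_integral_pruferRate y x (fun s => ?_) ?_ ?_
  · exact (contDiffAt_wallM hp s).2.continuousAt.div (contDiffAt_wallM hp s).1.continuousAt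
      (wallUM_ne_zero hp s)
  · filter_upwards [eventually_hyp hp] with p' hp'
    exact (D.isSol_wallM p').2.continuous.div (D.isSol_wallM p').1.continuous (wallUM_ne_zero hp')
  · filter_upwards [eventually_hyp hp] with p' hp' s
    rw [norm_div, norm_wallM hp', div_self (norm_ne_zero_iff.2 (wallUM_ne_zero hp' s))]

lemma phaseP_wall (hp : p.2 ∈ D.hyp) (y x : ℝ) : D.wallVP p x / D.wallUP p x =
    D.wallVP p y / D.wallUP p y * Complex.exp (I * D.angleP y x p) :=
  (D.isSol_wallP p).phase_eq (D.locallyIntegrable_q _) (wallUP_ne_zero hp) (norm_wallP hp) y x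

lemma phaseM_wall (hp : p.2 ∈ D.hyp) (y x : ℝ) : D.wallVM p x / D.wallUM p x =
    D.wallVM p y / D.wallUM p y * Complex.exp (I * D.angleM y x p) :=
  (D.isSol_wallM p).phase_eq (D.locallyIntegrable_q _) (wallUM_ne_zero hp) (norm_wallM hp) y x

variable (D) in
-- The equations at times 0 and 1 are the same. This is why the transport angles take equal values
-- at both ends and add no winding.
lemma fundamental_one (E : ℝ) : D.a (1, E) = D.a (0, E) ∧ D.b (1, E) = D.b (0, E) := by
  have h1 := D.isSol' 1 E
  rw [q_one] at h1
  have h2 := fun x => h1.eqOn_of_eq (D.locallyIntegrable_q 0) (D.isSol' 0 E) (y := 0) (x := x)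
    (fun _ _ => rfl) (by rw [D.a_zero, D.a_zero]) (by rw [D.b_zero, D.b_zero])
  exact ⟨funext fun x => (h2 x).1, funext fun x => (h2 x).2⟩

variable (D) in
lemma wall_one (E : ℝ) : D.wallUP (1, E) = D.wallUP (0, E) ∧ D.wallVP (1, E) = D.wallVP (0, E) ∧
    D.wallUM (1, E) = D.wallUM (0, E) ∧ D.wallVM (1, E) = D.wallVM (0, E) := by
  have h := D.fundamental_one E
  refine ⟨?_, ?_, ?_, ?_⟩ <;> funext x <;>
  simp only [wallUP, wallVP, wallUM, wallVM, transU, transV, h, rot_one, rot_zero]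

variable (D) in
lemma angle_one (E y x : ℝ) : D.angleP y x (1, E) = D.angleP y x (0, E) ∧
    D.angleM y x (1, E) = D.angleM y x (0, E) := by
  have h := D.wall_one E
  simp only [angleP, angleM, h, q_one, and_self]

/-! ### The bulk index and the edge index -/

lemma hasWindingNumber_rot {c : ℂ} (hc : ‖c‖ = 1) :
    HasWindingNumber (fun t => rot t * c) 1 := by
  refine HasWindingNumber.of_arg hc (α := fun t => 2 * Real.pi * t) (by fun_prop)
    (fun t _ => ?_) (by simp)
  rw [rot, mul_comm]
  push_cast
  ring_nf

variable {E : ℝ}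

/-- The bulk index. -/
lemma bulk_index (hE : E ∈ D.hyp) :
    (∀ t, HasPhase (decayPlus (offDiag fun x => rot t * D.q 0 x) E) ∧
      HasPhase (decayMinus (offDiag fun x => rot t * D.q 0 x) E)) ∧
    ∀ x, HasWindingNumber (fun t => theta (decayPlus (offDiag fun x => rot t * D.q 0 x) E) x) 1 ∧
      HasWindingNumber (fun t => theta (decayMinus (offDiag fun x => rot t * D.q 0 x) E) x) 1 := by
  have hP := fun t => hasPhase_of_sqInt (S := Ici 0) (y := 0)
    (LocallyIntegrable.continuous_mul' (D.locallyIntegrable_q 0) (continuous_const (y := rot t)))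
    ((D.isSol_bulk (D.phaseP E) E).rotate (conj_rot_mul_rot t)) Real.volume_Ici
    ⟨(sqInt_bulkP hE).1, (sqInt_bulkP hE).2.const_mul _⟩ (bulkU_ne_zero_P hE 0)
  have hM := fun t => hasPhase_of_sqInt (S := Iic 0) (y := 0)
    (LocallyIntegrable.continuous_mul' (D.locallyIntegrable_q 0) (continuous_const (y := rot t)))
    ((D.isSol_bulk (D.phaseM E) E).rotate (conj_rot_mul_rot t)) Real.volume_Iic
    ⟨(sqInt_bulkM hE).1, (sqInt_bulkM hE).2.const_mul _⟩ (bulkU_ne_zero_M hE 0)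
  refine ⟨fun t => ⟨(hP t).1, (hM t).1⟩, fun x => ⟨?_, ?_⟩⟩
  · have h1 : (fun t => theta (decayPlus (offDiag fun x => rot t * D.q 0 x) E) x) =
        fun t => rot t * (D.bulkV (D.phaseP E) E x / D.bulkU (D.phaseP E) E x) :=
      funext fun t => ((hP t).2 x).trans (mul_div_assoc _ _ _)
    rw [h1]
    refine hasWindingNumber_rot ?_
    rw [norm_div, (D.isSol_bulk _ E).norm_eq Real.volume_Ici (sqInt_bulkP hE) x,
      div_self (norm_ne_zero_iff.2 (bulkU_ne_zero_P hE x))]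
  · have h1 : (fun t => theta (decayMinus (offDiag fun x => rot t * D.q 0 x) E) x) =
        fun t => rot t * (D.bulkV (D.phaseM E) E x / D.bulkU (D.phaseM E) E x) :=
      funext fun t => ((hM t).2 x).trans (mul_div_assoc _ _ _)
    rw [h1]
    refine hasWindingNumber_rot ?_
    rw [norm_div, (D.isSol_bulk _ E).norm_eq Real.volume_Iic (sqInt_bulkM hE) x,
      div_self (norm_ne_zero_iff.2 (bulkU_ne_zero_M hE x))]

/-- The edge index. -/
lemma edge_index (hE : E ∈ D.hyp) :
    (∀ t, HasPhase (decayPlus (offDiag (D.q t)) E) ∧ HasPhase (decayMinus (offDiag (D.q t)) E)) ∧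
    ∀ x, HasWindingNumber (fun t => theta (decayPlus (offDiag (D.q t)) E) x *
      (theta (decayMinus (offDiag (D.q t)) E) x)⁻¹) 1 := by
  have hE' : ∀ t : ℝ, ((t, E) : ℝ × ℝ).2 ∈ D.hyp := fun t => hE
  have hP := fun t => hasPhase_of_sqInt (S := Ici 0) (y := 0) (D.locallyIntegrable_q t)
    (D.isSol_wallP (t, E)) Real.volume_Ici (sqInt_wallP (hE' t)) (wallUP_ne_zero (hE' t) 0)
  have hM := fun t => hasPhase_of_sqInt (S := Iic 0) (y := 0) (D.locallyIntegrable_q t)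
    (D.isSol_wallM (t, E)) Real.volume_Iic (sqInt_wallM (hE' t)) (wallUM_ne_zero (hE' t) 0)
  refine ⟨fun t => ⟨(hP t).1, (hM t).1⟩, fun x => ?_⟩
  set cP := D.bulkV (D.phaseP E) E D.N / D.bulkU (D.phaseP E) E D.N with hcP
  set cM := D.bulkV (D.phaseM E) E (-D.N) / D.bulkU (D.phaseM E) E (-D.N) with hcM
  have nP : ‖cP‖ = 1 := by
    rw [norm_div, (D.isSol_bulk _ E).norm_eq Real.volume_Ici (sqInt_bulkP hE) _,
      div_self (norm_ne_zero_iff.2 (bulkU_ne_zero_P hE _))]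
  have nM : ‖cM‖ = 1 := by
    rw [norm_div, (D.isSol_bulk _ E).norm_eq Real.volume_Iic (sqInt_bulkM hE) _,
      div_self (norm_ne_zero_iff.2 (bulkU_ne_zero_M hE _))]
  -- The right phase is `rot t` · `cP` at N, the left one is `cM` at -N; the two angles transport
  -- them to x, and only 2πt fails to close up.
  refine HasWindingNumber.of_arg (c := cP * cM⁻¹)
    (α := fun t => 2 * Real.pi * t + D.angleP D.N x (t, E) - D.angleM (-D.N) x (t, E))
    (by rw [norm_mul, norm_inv, nP, nM]; simp) ?_ (fun t _ => ?_) ?_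
  · have hcont : Continuous fun t : ℝ => (t, E) := by fun_prop
    refine Continuous.continuousOn ?_
    refine ((by fun_prop : Continuous fun t : ℝ => 2 * Real.pi * t).add ?_).sub ?_
    · exact continuous_iff_continuousAt.2 fun t =>
        ContinuousAt.comp (f := fun t : ℝ => ((t, E) : ℝ × ℝ)) (x := t)
          (continuousAt_angleP (hE' t) _ _) hcont.continuousAt
    · exact continuous_iff_continuousAt.2 fun t =>
        ContinuousAt.comp (f := fun t : ℝ => ((t, E) : ℝ × ℝ)) (x := t)
          (continuousAt_angleM (hE' t) _ _) hcont.continuousAt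
  · have e1 : theta (decayPlus (offDiag (D.q t)) E) x =
        rot t * cP * Complex.exp (I * D.angleP D.N x (t, E)) := by
      refine ((hP t).2 x).trans ?_
      rw [phaseP_wall (hE' t) D.N x, (D.wallP_eq _ le_rfl).1, (D.wallP_eq _ le_rfl).2,
        mul_div_assoc]
    have e2 : theta (decayMinus (offDiag (D.q t)) E) x =
        cM * Complex.exp (I * D.angleM (-D.N) x (t, E)) := by
      refine ((hM t).2 x).trans ?_
      rw [phaseM_wall (hE' t) (-D.N) x, (D.wallM_eq _ le_rfl).1, (D.wallM_eq _ le_rfl).2]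
    rw [e1, e2, mul_inv, ← Complex.exp_neg, rot]
    have e3 : I * ((2 * Real.pi * t + D.angleP D.N x (t, E) - D.angleM (-D.N) x (t, E) : ℝ) : ℂ) =
        2 * Real.pi * t * I + I * D.angleP D.N x (t, E) + -(I * D.angleM (-D.N) x (t, E)) := by
      push_cast; ring
    rw [e3, Complex.exp_add, Complex.exp_add]
    ring
  · rw [(D.angle_one E _ _).1, (D.angle_one E _ _).2]
    simp

end Dislocation

/-! ### The matrix potentials -/

/-- The exponential of cσ₃ is diagonal, and conjugating by it multiplies the lower left entry by
exp(2πit) and the upper right one by the conjugate. -/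
lemma bulkPotential_eq (V : ℝ → ℝ) (t : ℝ) :
    bulkPotential V t = offDiag fun x => rot t * (V x : ℂ) := by
  funext x
  have hs : ∀ c : ℂ, NormedSpace.exp (c • sigma3) =
      Matrix.diagonal ![Complex.exp c, Complex.exp (-c)] := by
    intro c
    have h1 : c • sigma3 = Matrix.diagonal ![c, -c] := by
      ext i j; fin_cases i <;> fin_cases j <;> simp [sigma3]
    rw [h1, Matrix.exp_diagonal]
    congr 1
    funext i
    rw [Pi.coe_exp, ← Complex.exp_eq_exp_ℂ]
    fin_cases i <;> rfl
  have hr : Complex.exp (I * Real.pi * t) * Complex.exp (I * Real.pi * t) = rot t := by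
    rw [rot, ← Complex.exp_add]; ring_nf
  have hr' : Complex.exp (-(I * Real.pi * t)) * Complex.exp (-(I * Real.pi * t)) =
      conj (rot t) := by
    rw [rot, ← Complex.exp_add, ← Complex.exp_conj]
    congr 1
    simp [Complex.conj_ofNat]
    ring
  rw [bulkPotential, hs, hs, neg_neg, offDiag, map_mul, Complex.conj_ofReal, ← hr', ← hr]
  ext i j
  fin_cases i <;> fin_cases j <;> simp [sigma1, Matrix.diagonal_mul, Matrix.mul_diagonal] <;> ring

lemma Dislocation.bulkPotential_eq (D : Dislocation) (t : ℝ) :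
    bulkPotential D.V t = offDiag fun x => rot t * D.q 0 x := by
  rw [DislocatedDirac.bulkPotential_eq, D.q_zero]

lemma Dislocation.wallPotential_eq (D : Dislocation) (t : ℝ) :
    wallPotential D.V D.χ t = offDiag (D.q t) := by
  funext x
  rw [wallPotential, DislocatedDirac.bulkPotential_eq, DislocatedDirac.bulkPotential_eq]
  simp only [offDiag, D.q_apply, rot_zero, map_add, map_mul, Complex.conj_ofReal, map_one]
  ext i j
  fin_cases i <;> fin_cases j <;> simp <;> ring

/-! ### Auxiliary calculus -/

/-- A continuous lifting of a continuously differentiable curve is continuously differentiable. -/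
lemma contDiffAt_of_cexp {F : Type*} [NormedAddCommGroup F] [NormedSpace ℝ F] {f : F → ℝ} {x : F}
    (hf : ContinuousAt f x) (h : ContDiffAt ℝ 1 (fun y => Complex.exp (I * f y)) x) :
    ContDiffAt ℝ 1 f x := by
  -- Dividing by the value at `x` brings the curve close to 1, where the principal logarithm is
  -- smooth; it returns f y - f x as soon as this is smaller than π in modulus.
  have h0 : ContDiffAt ℝ 1
      (fun y => Complex.log (Complex.exp (I * f y) * Complex.exp (-(I * f x)))) x := by
    refine (Complex.contDiffAt_log (n := 1) (x := Complex.exp (I * f x) * Complex.exp (-(I * f x)))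
      ?_).restrict_scalars ℝ |>.comp x (h.mul contDiffAt_const)
    rw [← Complex.exp_add, add_neg_cancel, Complex.exp_zero]
    exact Complex.one_mem_slitPlane
  have h1 : ContDiffAt ℝ 1
      (fun y => f x + (Complex.log (Complex.exp (I * f y) * Complex.exp (-(I * f x)))).im) x :=
    contDiffAt_const.add (Complex.imCLM.contDiff.contDiffAt.comp x h0)
  refine h1.congr_of_eventuallyEq ?_
  have h2 : ∀ᶠ y in 𝓝 x, dist (f y) (f x) < Real.pi :=
    hf.eventually (Metric.ball_mem_nhds _ Real.pi_pos)
  filter_upwards [h2] with y hy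
  rw [Real.dist_eq, abs_lt] at hy
  have e : I * (f y : ℂ) + -(I * f x) = ((f y - f x : ℝ) : ℂ) * I := by push_cast; ring
  rw [← Complex.exp_add, e, Complex.log_exp]
  · simp
  · simpa using hy.1
  · simpa using hy.2.le

lemma continuousAt_parametric_integral {s : Set ℝ} (hs : IsOpen s) {f : ℝ → ℝ → ℂ}
    (hf : ∀ F ∈ s, ∀ x, ContinuousAt (fun z : ℝ × ℝ => f z.1 z.2) (F, x)) {E : ℝ} (hE : E ∈ s)
    (a b : ℝ) : ContinuousAt (fun F => ∫ x in a..b, f F x) E := by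
  have h1 : Continuous (fun z : s × ℝ => f z.1 z.2) := by
    refine continuous_iff_continuousAt.2 fun z => ?_
    have hc : Continuous fun z : s × ℝ => ((z.1 : ℝ), z.2) := by fun_prop
    exact ContinuousAt.comp (f := fun z : s × ℝ => ((z.1 : ℝ), z.2)) (x := z)
      (hf z.1 z.1.2 z.2) hc.continuousAt
  have h2 : Continuous (fun F : s => ∫ x in a..b, f F x) :=
    intervalIntegral.continuous_parametric_intervalIntegral_of_continuous'
      (f := fun (F : s) x => f F x) h1 a b
  exact (continuousOn_iff_continuous_domRestrict.2 h2).continuousAt (hs.mem_nhds hE)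

/-- The derivative of a phase, from the identity of Green. -/
lemma hasDerivAt_phase {U V K : ℝ → ℂ} {E : ℝ} (hU : ContinuousAt U E) (hK : ContinuousAt K E)
    (hU0 : ∀ᶠ F in 𝓝 E, U F ≠ 0) (hn : ‖V E‖ = ‖U E‖)
    (h : ∀ᶠ F in 𝓝 E, conj (V E) * V F - conj (U E) * U F = I * ((F - E : ℝ) : ℂ) * K F) :
    HasDerivAt (fun F => V F / U F) (I * (V E / U E) * (K E / (‖U E‖ ^ 2 : ℝ))) E := by
  have hUE : U E ≠ 0 := hU0.self_of_nhds
  have hVE : V E ≠ 0 := fun h0 => hUE (by rw [h0, norm_zero] at hn; exact norm_eq_zero.1 hn.symm)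
  have hVc : conj (V E) ≠ 0 := by simpa using hVE
  have e3 : conj (V E) * V E = conj (U E) * U E := by
    rw [Complex.conj_mul', Complex.conj_mul', hn]
  -- As |V| = |U| at E, the ratio V/U there equals Ū/V̄, and the difference quotient is exactly `k`.
  -- Continuity of `U` and `K` suffices; nothing is asked of `V`.
  set k : ℝ → ℂ := fun F => I * K F / (conj (V E) * U F) with hk
  have hkc : ContinuousAt k E :=
    (continuousAt_const.mul hK).div (continuousAt_const.mul hU) (mul_ne_zero hVc hUE)
  have hkE : I * (V E / U E) * (K E / (‖U E‖ ^ 2 : ℝ)) = k E := by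
    have : ((‖U E‖ ^ 2 : ℝ) : ℂ) = conj (U E) * U E := by rw [Complex.conj_mul']; push_cast; rfl
    rw [this, ← e3, hk]
    field_simp
  rw [hkE, hasDerivAt_iff_tendsto_slope]
  refine (hkc.tendsto.mono_left nhdsWithin_le_nhds).congr' ?_
  filter_upwards [nhdsWithin_le_nhds hU0, nhdsWithin_le_nhds h, self_mem_nhdsWithin] with F h1 h2 h3
  have h4 : ((F - E : ℝ) : ℂ) ≠ 0 := by
    exact_mod_cast sub_ne_zero.2 h3
  rw [slope_def_module, hk, Complex.real_smul]
  push_cast at h4 h2 ⊢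
  field_simp
  linear_combination (-U E) * h2 + U F * e3

namespace Dislocation

variable {D : Dislocation} {p : ℝ × ℝ} {E : ℝ}

/-! ### The total angle -/

/-- Here it matters that `N` is an integer: a whole number of periods multiplies both components by
the same factor, so the phase is that at the origin. -/
lemma bulk_ratio_P (hE : E ∈ D.hyp) :
    D.bulkV (D.phaseP E) E D.N / D.bulkU (D.phaseP E) E D.N = D.phaseP E := by
  have : ∀ n : ℕ, D.bulkV (D.phaseP E) E n = D.phaseP E * D.bulkU (D.phaseP E) E n := by
    intro n
    induction n with
    | zero => simp [bulkU_zero, bulkV_zero]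
    | succ n ih =>
      push_cast
      rw [(shiftP hE n).1, (shiftP hE n).2, ih]
      ring
  rw [this, mul_div_cancel_right₀ _ (bulkU_ne_zero_P hE _)]

lemma largeRoot_ne_zero (hE : E ∈ D.hyp) : largeRoot (D.halfTrace E) ≠ 0 := fun h => by
  have := one_lt_abs_largeRoot hE
  rw [h, abs_zero] at this
  linarith

lemma bulk_ratio_M (hE : E ∈ D.hyp) :
    D.bulkV (D.phaseM E) E (-D.N) / D.bulkU (D.phaseM E) E (-D.N) = D.phaseM E := by
  have : ∀ n : ℕ, D.bulkV (D.phaseM E) E (-n) = D.phaseM E * D.bulkU (D.phaseM E) E (-n) := by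
    intro n
    induction n with
    | zero => simp [bulkU_zero, bulkV_zero]
    | succ n ih =>
      have h := shiftM hE (-(n + 1 : ℝ))
      have e : -(n + 1 : ℝ) + 1 = -n := by ring
      rw [e] at h
      have h0 : (largeRoot (D.halfTrace E) : ℂ) ≠ 0 := by exact_mod_cast largeRoot_ne_zero hE
      push_cast
      apply mul_left_cancel₀ h0
      linear_combination ih - h.2 + D.phaseM E * h.1
  rw [this, mul_div_cancel_right₀ _ (bulkU_ne_zero_M hE _)]

variable (D) in
/-- The angle between the phases of the two decaying solutions of the periodic equation. -/
def bulkAngle (E : ℝ) : ℝ := Complex.arg (-(D.phaseP E / D.phaseM E)) + Real.pi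

variable (D) in
/-- The angle between the phases of the decaying solutions of the domain wall equation. -/
def totalAngle (p : ℝ × ℝ) : ℝ :=
  2 * Real.pi * p.1 + D.bulkAngle p.2 - D.angleM (-D.N) D.N p

/-- The two phases are distinct and of modulus one, so their ratio is never 1 and its opposite
avoids the cut. So `bulkAngle` is continuous on `hyp`, with values in (0, 2π). -/
lemma neg_ratio_mem_slitPlane (hE : E ∈ D.hyp) :
    -(D.phaseP E / D.phaseM E) ∈ Complex.slitPlane := by
  rw [Complex.mem_slitPlane_iff_not_le_zero, Complex.le_def]
  rintro ⟨h1, h2⟩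
  have hn : ‖D.phaseP E / D.phaseM E‖ = 1 := by
    rw [norm_div, norm_phaseP hE, norm_phaseM hE, div_one]
  have hM : D.phaseM E ≠ 0 := by
    rw [← norm_ne_zero_iff, norm_phaseM hE]; exact one_ne_zero
  simp only [Complex.neg_re, Complex.zero_re, Complex.neg_im, Complex.zero_im] at h1 h2
  have h3 : (D.phaseP E / D.phaseM E).im = 0 := by linarith
  have h4 : (((D.phaseP E / D.phaseM E).re : ℝ) : ℂ) = D.phaseP E / D.phaseM E :=
    Complex.ext rfl (by rw [h3]; rfl)
  rw [← h4, Complex.norm_real, Real.norm_of_nonneg (by linarith)] at hn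
  rw [hn, Complex.ofReal_one, eq_comm, div_eq_one_iff_eq hM] at h4
  exact phaseP_ne_phaseM hE h4

lemma exp_bulkAngle (hE : E ∈ D.hyp) :
    Complex.exp (I * D.bulkAngle E) = D.phaseP E / D.phaseM E := by
  have h1 := Complex.norm_mul_exp_arg_mul_I (-(D.phaseP E / D.phaseM E))
  rw [norm_neg, norm_div, norm_phaseP hE, norm_phaseM hE, div_one, Complex.ofReal_one,
    one_mul] at h1
  rw [bulkAngle]
  have e : I * ((Complex.arg (-(D.phaseP E / D.phaseM E)) + Real.pi : ℝ) : ℂ) =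
      Complex.arg (-(D.phaseP E / D.phaseM E)) * I + Real.pi * I := by push_cast; ring
  rw [e, Complex.exp_add, h1, Complex.exp_pi_mul_I]
  ring

lemma continuousAt_bulkAngle (hE : E ∈ D.hyp) : ContinuousAt D.bulkAngle E := by
  have hM : D.phaseM E ≠ 0 := by
    rw [← norm_ne_zero_iff, norm_phaseM hE]; exact one_ne_zero
  have h1 : ContinuousAt (fun E => -(D.phaseP E / D.phaseM E)) E :=
    ((contDiffAt_phaseP hE).continuousAt.div (contDiffAt_phaseM hE).continuousAt hM).neg
  exact (ContinuousAt.comp (f := fun E => -(D.phaseP E / D.phaseM E)) (x := E)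
    (Complex.continuousAt_arg (neg_ratio_mem_slitPlane hE)) h1).add continuousAt_const

lemma exp_totalAngle (hp : p.2 ∈ D.hyp) : Complex.exp (I * D.totalAngle p) =
    D.wallVP p D.N / D.wallUP p D.N * (D.wallVM p D.N / D.wallUM p D.N)⁻¹ := by
  rw [phaseM_wall hp (-D.N) D.N, (D.wallP_eq p le_rfl).1, (D.wallP_eq p le_rfl).2,
    (D.wallM_eq p le_rfl).1, (D.wallM_eq p le_rfl).2, mul_div_assoc, bulk_ratio_P hp,
    bulk_ratio_M hp, totalAngle, mul_inv, ← Complex.exp_neg, rot]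
  have e : I * ((2 * Real.pi * p.1 + D.bulkAngle p.2 - D.angleM (-D.N) D.N p : ℝ) : ℂ) =
      2 * Real.pi * p.1 * I + I * D.bulkAngle p.2 + -(I * D.angleM (-D.N) D.N p) := by
    push_cast; ring
  rw [e, Complex.exp_add, Complex.exp_add, exp_bulkAngle hp]
  ring

lemma continuousAt_totalAngle (hp : p.2 ∈ D.hyp) : ContinuousAt D.totalAngle p :=
  ((continuousAt_const.mul continuousAt_fst).add
    (ContinuousAt.comp (f := Prod.snd) (x := p) (continuousAt_bulkAngle hp) continuousAt_snd)).sub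
    (continuousAt_angleM hp _ _)

lemma contDiffAt_totalAngle (hp : p.2 ∈ D.hyp) : ContDiffAt ℝ 1 D.totalAngle p := by
  refine contDiffAt_of_cexp (continuousAt_totalAngle hp) ?_
  have h1 := contDiffAt_wallP hp D.N
  have h2 := contDiffAt_wallM hp D.N
  have hV : D.wallVM p D.N ≠ 0 := by
    rw [← norm_ne_zero_iff, norm_wallM hp, norm_ne_zero_iff]
    exact wallUM_ne_zero hp _
  have h3 : ContDiffAt ℝ 1 (fun p => D.wallVP p D.N * (D.wallUP p D.N)⁻¹ *
      (D.wallVM p D.N * (D.wallUM p D.N)⁻¹)⁻¹) p :=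
    (h1.2.mul (h1.1.inv (wallUP_ne_zero hp _))).mul
      ((h2.2.mul (h2.1.inv (wallUM_ne_zero hp _))).inv
        (mul_ne_zero hV (inv_ne_zero (wallUM_ne_zero hp _))))
  refine h3.congr_of_eventuallyEq ?_
  filter_upwards [eventually_hyp hp] with p' hp'
  rw [exp_totalAngle hp', div_eq_mul_inv, div_eq_mul_inv]

variable (D) in
lemma totalAngle_one (E : ℝ) : D.totalAngle (1, E) = D.totalAngle (0, E) + 2 * Real.pi := by
  rw [totalAngle, totalAngle, (D.angle_one E _ _).2]
  simp
  ring

/-! ### Monotonicity of the total angle in the energy -/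

variable {t : ℝ}

variable (D) in
/-- The density of the identity of Green for the solutions that decay to the right. -/
def greenP (t E F x : ℝ) : ℂ := conj (D.wallVP (t, E) x) * D.wallVP (t, F) x +
  conj (D.wallUP (t, E) x) * D.wallUP (t, F) x

variable (D) in
/-- The density of the identity of Green for the solutions that decay to the left. -/
def greenM (t E F x : ℝ) : ℂ := conj (D.wallVM (t, E) x) * D.wallVM (t, F) x +
  conj (D.wallUM (t, E) x) * D.wallUM (t, F) x

lemma continuousAt_green {F : ℝ} (hF : F ∈ D.hyp) (t E x : ℝ) :
    ContinuousAt (fun z : ℝ × ℝ => D.greenP t E z.1 z.2) (F, x) ∧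
      ContinuousAt (fun z : ℝ × ℝ => D.greenM t E z.1 z.2) (F, x) := by
  have hc : Continuous fun z : ℝ × ℝ => (((t, z.1), z.2) : (ℝ × ℝ) × ℝ) := by fun_prop
  have hP := continuousAt_wallP (p := (t, F)) hF x
  have hM := continuousAt_wallM (p := (t, F)) hF x
  have key : ∀ {f : (ℝ × ℝ) × ℝ → ℂ}, ContinuousAt f ((t, F), x) →
      ContinuousAt (fun z : ℝ × ℝ => f ((t, z.1), z.2)) (F, x) := fun h =>
    ContinuousAt.comp (f := fun z : ℝ × ℝ => (((t, z.1), z.2) : (ℝ × ℝ) × ℝ)) (x := (F, x)) h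
      hc.continuousAt
  have key2 : ∀ {f : ℝ → ℂ}, Continuous f →
      ContinuousAt (fun z : ℝ × ℝ => conj (f z.2)) (F, x) := fun h =>
    (Complex.continuous_conj.comp (h.comp continuous_snd)).continuousAt
  exact ⟨((key2 (D.isSol_wallP (t, E)).2.continuous).mul (key hP.2)).add
      ((key2 (D.isSol_wallP (t, E)).1.continuous).mul (key hP.1)),
    ((key2 (D.isSol_wallM (t, E)).2.continuous).mul (key hM.2)).add
      ((key2 (D.isSol_wallM (t, E)).1.continuous).mul (key hM.1))⟩

lemma integral_green_self (hE : E ∈ D.hyp) (t : ℝ) {x y : ℝ} (hxy : x ≤ y) :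
    ∃ P Q : ℝ, 0 ≤ P ∧ 0 ≤ Q ∧ (x < y → 0 < P ∧ 0 < Q) ∧
      ∫ s in x..y, D.greenP t E E s = P ∧ ∫ s in x..y, D.greenM t E E s = Q := by
  have key : ∀ U V : ℝ → ℂ, Continuous U → (∀ s, U s ≠ 0) → (∀ s, ‖V s‖ = ‖U s‖) →
      ∃ P : ℝ, 0 ≤ P ∧ (x < y → 0 < P) ∧
        ∫ s in x..y, (conj (V s) * V s + conj (U s) * U s) = P := by
    intro U V hU h0 hn
    refine ⟨∫ s in x..y, 2 * ‖U s‖ ^ 2, ?_, fun h => ?_, ?_⟩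
    · exact intervalIntegral.integral_nonneg hxy fun s _ => by positivity
    · refine intervalIntegral.intervalIntegral_pos_of_pos
        (Continuous.intervalIntegrable (by fun_prop) _ _) (fun s => ?_) h
      have := norm_pos_iff.2 (h0 s)
      positivity
    · rw [← intervalIntegral.integral_ofReal]
      congr 1
      funext s
      rw [Complex.conj_mul', Complex.conj_mul', hn]
      push_cast; ring
  obtain ⟨P, h1, h2, h3⟩ := key _ _ (D.isSol_wallP (t, E)).1.continuous
    (wallUP_ne_zero (p := (t, E)) hE) (norm_wallP (p := (t, E)) hE)
  obtain ⟨Q, k1, k2, k3⟩ := key _ _ (D.isSol_wallM (t, E)).1.continuous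
    (wallUM_ne_zero (p := (t, E)) hE) (norm_wallM (p := (t, E)) hE)
  exact ⟨P, Q, h1, k1, fun h => ⟨h2 h, k2 h⟩, h3, k3⟩

lemma abs_smallRoot_mul_lt_one {F : ℝ} (hE : E ∈ D.hyp) (hF : F ∈ D.hyp) :
    |smallRoot (D.halfTrace E) * smallRoot (D.halfTrace F)| < 1 := by
  rw [abs_mul]
  exact mul_lt_one_of_nonneg_of_lt_one_left (abs_nonneg _) (abs_smallRoot_lt_one hE)
    (abs_smallRoot_lt_one hF).le

lemma one_sub_smallRoot_mul_pos {F : ℝ} (hE : E ∈ D.hyp) (hF : F ∈ D.hyp) :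
    0 < 1 - smallRoot (D.halfTrace E) * smallRoot (D.halfTrace F) := by
  linarith [(abs_lt.1 (abs_smallRoot_mul_lt_one hE hF)).2]

lemma continuousAt_one_sub_smallRoot_mul (hE : E ∈ D.hyp) : ContinuousAt (fun F =>
    ((1 - smallRoot (D.halfTrace E) * smallRoot (D.halfTrace F) : ℝ) : ℂ)) E :=
  Complex.continuous_ofReal.continuousAt.comp (continuousAt_const.sub (continuousAt_const.mul
    ((contDiffAt_smallRoot hE).continuousAt.comp D.contDiff_halfTrace.continuous.continuousAt)))

lemma continuousAt_integral_green (hE : E ∈ D.hyp) (t x y : ℝ) :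
    ContinuousAt (fun F => ∫ s in x..y, D.greenP t E F s) E ∧
      ContinuousAt (fun F => ∫ s in x..y, D.greenM t E F s) E :=
  ⟨continuousAt_parametric_integral D.isOpen_hyp (fun _ hF s => (continuousAt_green hF t E s).1)
      hE x y,
    continuousAt_parametric_integral D.isOpen_hyp (fun _ hF s => (continuousAt_green hF t E s).2)
      hE x y⟩

/-- The identity of Green is used over the period [N, N + 1]. The shift multiplies the Wronskian W
by the product of the small roots at E and F, so W(N)(1 - s_E s_F) = i(F - E)∫ over this period: the
half-line integral is summed as a geometric series. The density is positive on the diagonal, hence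
the sign. -/
lemma hasDerivAt_phaseP_wall (hE : E ∈ D.hyp) (t : ℝ) : ∃ k : ℝ, 0 < k ∧
    HasDerivAt (fun F => D.wallVP (t, F) D.N / D.wallUP (t, F) D.N)
      (I * (D.wallVP (t, E) D.N / D.wallUP (t, E) D.N) * k) E := by
  obtain ⟨P, _, -, -, hP, hI, -⟩ := integral_green_self hE t
    (show (D.N : ℝ) ≤ D.N + 1 by linarith)
  have hP := (hP (by linarith)).1
  have hs := one_sub_smallRoot_mul_pos hE hE
  have hU := norm_pos_iff.2 (wallUP_ne_zero (p := (t, E)) hE D.N)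
  have hcU : ContinuousAt (fun F => D.wallUP (t, F) D.N) E :=
    ContinuousAt.comp (f := fun F : ℝ => ((t, F) : ℝ × ℝ)) (x := E)
      (contDiffAt_wallP (p := (t, E)) hE D.N).1.continuousAt
      (by fun_prop : Continuous fun F : ℝ => ((t, F) : ℝ × ℝ)).continuousAt
  have h1 := hasDerivAt_phase hcU
    (V := fun F => D.wallVP (t, F) D.N)
    ((continuousAt_integral_green hE t D.N (D.N + 1)).1.div
      (continuousAt_one_sub_smallRoot_mul hE) (by exact_mod_cast hs.ne'))
    (by filter_upwards [D.isOpen_hyp.mem_nhds hE] with F hF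
        exact wallUP_ne_zero (p := (t, F)) hF _) (norm_wallP (p := (t, E)) hE _)
    (by
      filter_upwards [D.isOpen_hyp.mem_nhds hE] with F hF
      have g1 := ((D.isSol_wallP (t, E)).conj_swap_real).wronskian_sub (D.isSol_wallP (t, F))
        (x := D.N) (y := D.N + 1) fun _ _ => rfl
      have g2 : ∀ F ∈ D.hyp, D.wallUP (t, F) (D.N + 1) =
          smallRoot (D.halfTrace F) * D.wallUP (t, F) D.N ∧ D.wallVP (t, F) (D.N + 1) =
          smallRoot (D.halfTrace F) * D.wallVP (t, F) D.N := fun F hF => by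
        rw [(D.wallP_eq _ le_rfl).1, (D.wallP_eq _ le_rfl).2,
          (D.wallP_eq _ (by linarith : (D.N : ℝ) ≤ D.N + 1)).1,
          (D.wallP_eq _ (by linarith : (D.N : ℝ) ≤ D.N + 1)).2, (shiftP hF _).1, (shiftP hF _).2]
        exact ⟨rfl, by ring⟩
      rw [wronskian, wronskian, (g2 E hE).1, (g2 E hE).2, (g2 F hF).1, (g2 F hF).2, map_mul,
        map_mul, Complex.conj_ofReal] at g1
      have hs' : ((1 - smallRoot (D.halfTrace E) * smallRoot (D.halfTrace F) : ℝ) : ℂ) ≠ 0 := by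
        exact_mod_cast (one_sub_smallRoot_mul_pos hE hF).ne'
      simp only [Pi.div_apply]
      rw [← mul_div_assoc, eq_div_iff hs']
      simp only [greenP]
      push_cast at g1 ⊢
      linear_combination -g1)
  refine ⟨P / (1 - smallRoot (D.halfTrace E) * smallRoot (D.halfTrace E)) /
    ‖D.wallUP (t, E) D.N‖ ^ 2, by positivity, ?_⟩
  convert h1 using 2
  simp only [Pi.div_apply]
  rw [hI]
  push_cast
  rfl

/-- The decay is now to the left: the period before -N, with its geometric factor, and the segment
from -N to N contribute to the Wronskian at N, both with a minus sign. -/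
lemma hasDerivAt_phaseM_wall (hE : E ∈ D.hyp) (t : ℝ) : ∃ k : ℝ, k < 0 ∧
    HasDerivAt (fun F => D.wallVM (t, F) D.N / D.wallUM (t, F) D.N)
      (I * (D.wallVM (t, E) D.N / D.wallUM (t, E) D.N) * k) E := by
  obtain ⟨_, Q, -, -, hQ, -, hI⟩ := integral_green_self hE t
    (show (-D.N - 1 : ℝ) ≤ -D.N by linarith)
  have hQ := (hQ (by linarith)).2
  obtain ⟨_, Q', -, hQ', -, -, hI'⟩ := integral_green_self hE t
    (show (-D.N : ℝ) ≤ D.N by linarith [(Nat.cast_nonneg D.N : (0 : ℝ) ≤ D.N)])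
  have hs := one_sub_smallRoot_mul_pos hE hE
  have hU := norm_pos_iff.2 (wallUM_ne_zero (p := (t, E)) hE D.N)
  have hcU : ContinuousAt (fun F => D.wallUM (t, F) D.N) E :=
    ContinuousAt.comp (f := fun F : ℝ => ((t, F) : ℝ × ℝ)) (x := E)
      (contDiffAt_wallM (p := (t, E)) hE D.N).1.continuousAt
      (by fun_prop : Continuous fun F : ℝ => ((t, F) : ℝ × ℝ)).continuousAt
  have h1 := hasDerivAt_phase hcU
    (V := fun F => D.wallVM (t, F) D.N)
    ((((continuousAt_integral_green hE t (-D.N - 1) (-D.N)).2.div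
      (continuousAt_one_sub_smallRoot_mul hE) (by exact_mod_cast hs.ne')).add
      (continuousAt_integral_green hE t (-D.N) D.N).2).neg)
    (by filter_upwards [D.isOpen_hyp.mem_nhds hE] with F hF
        exact wallUM_ne_zero (p := (t, F)) hF _) (norm_wallM (p := (t, E)) hE _)
    (by
      filter_upwards [D.isOpen_hyp.mem_nhds hE] with F hF
      have g1 := ((D.isSol_wallM (t, E)).conj_swap_real).wronskian_sub (D.isSol_wallM (t, F))
        (x := -D.N - 1) (y := -D.N) fun _ _ => rfl
      have g3 := ((D.isSol_wallM (t, E)).conj_swap_real).wronskian_sub (D.isSol_wallM (t, F))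
        (x := -D.N) (y := D.N) fun _ _ => rfl
      have g2 : ∀ F ∈ D.hyp, D.wallUM (t, F) (-D.N - 1) =
          smallRoot (D.halfTrace F) * D.wallUM (t, F) (-D.N) ∧ D.wallVM (t, F) (-D.N - 1) =
          smallRoot (D.halfTrace F) * D.wallVM (t, F) (-D.N) := fun F hF => by
        have h1 : (smallRoot (D.halfTrace F) : ℂ) * largeRoot (D.halfTrace F) = 1 := by
          exact_mod_cast smallRoot_mul_largeRoot hF
        have h2 := shiftM hF (-D.N - 1)
        rw [sub_add_cancel] at h2
        rw [(D.wallM_eq _ le_rfl).1, (D.wallM_eq _ le_rfl).2,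
          (D.wallM_eq _ (by linarith : (-D.N - 1 : ℝ) ≤ -D.N)).1,
          (D.wallM_eq _ (by linarith : (-D.N - 1 : ℝ) ≤ -D.N)).2, h2.1, h2.2, ← mul_assoc,
          ← mul_assoc, h1, one_mul, one_mul]
        exact ⟨rfl, rfl⟩
      rw [wronskian, wronskian] at g1 g3
      rw [(g2 E hE).1, (g2 E hE).2, (g2 F hF).1, (g2 F hF).2, map_mul,
        map_mul, Complex.conj_ofReal] at g1
      have hs' : ((1 - smallRoot (D.halfTrace E) * smallRoot (D.halfTrace F) : ℝ) : ℂ) ≠ 0 := by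
        exact_mod_cast (one_sub_smallRoot_mul_pos hE hF).ne'
      simp only [Pi.div_apply, Pi.neg_apply, Pi.add_apply]
      simp only [greenM]
      have g4 := mul_inv_cancel₀ hs'
      rw [div_eq_mul_inv]
      set w := (((1 - smallRoot (D.halfTrace E) * smallRoot (D.halfTrace F) : ℝ) : ℂ))⁻¹
      push_cast at g1 g3 g4 ⊢
      linear_combination w * g1 + g3 - (conj (D.wallVM (t, E) (-D.N)) * D.wallVM (t, F) (-D.N) -
        conj (D.wallUM (t, E) (-D.N)) * D.wallUM (t, F) (-D.N)) * g4)
  refine ⟨-(Q / (1 - smallRoot (D.halfTrace E) * smallRoot (D.halfTrace E)) + Q') /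
    ‖D.wallUM (t, E) D.N‖ ^ 2, ?_, ?_⟩
  · rw [neg_div, neg_lt_zero]; positivity
  convert h1 using 2
  simp only [Pi.div_apply, Pi.neg_apply, Pi.add_apply]
  rw [hI, hI']
  push_cast
  rfl

/-- The total angle is strictly increasing in the energy. -/
lemma deriv_totalAngle_pos (hE : E ∈ D.hyp) (t : ℝ) :
    0 < deriv (fun F => D.totalAngle (t, F)) E := by
  obtain ⟨k, hk, h1⟩ := hasDerivAt_phaseP_wall hE t
  obtain ⟨l, hl, h2⟩ := hasDerivAt_phaseM_wall hE t
  have hd : DifferentiableAt ℝ (fun F => D.totalAngle (t, F)) E :=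
    ((contDiffAt_totalAngle (p := (t, E)) hE).differentiableAt one_ne_zero).comp E
      (by fun_prop)
  -- Differentiating exp(i · angle) · θ₋ = θ₊ and dividing by θ₊ gives: the derivative of the angle
  -- is k - l, positive as k > 0 > l.
  have h3 := ((hd.hasDerivAt.ofReal_comp).const_mul I).cexp.mul h2
  have h4 := h3.unique (h1.congr_of_eventuallyEq (by
    filter_upwards [D.isOpen_hyp.mem_nhds hE] with F hF
    have hV : D.wallVM (t, F) D.N / D.wallUM (t, F) D.N ≠ 0 := by
      refine div_ne_zero ?_ (wallUM_ne_zero (p := (t, F)) hF _)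
      rw [← norm_ne_zero_iff, norm_wallM (p := (t, F)) hF, norm_ne_zero_iff]
      exact wallUM_ne_zero (p := (t, F)) hF _
    simp only [Pi.mul_apply]
    rw [exp_totalAngle (p := (t, F)) hF, inv_mul_cancel_right₀ hV]))
  have hM : D.wallVM (t, E) D.N / D.wallUM (t, E) D.N ≠ 0 := by
    refine div_ne_zero ?_ (wallUM_ne_zero (p := (t, E)) hE _)
    rw [← norm_ne_zero_iff, norm_wallM (p := (t, E)) hE, norm_ne_zero_iff]
    exact wallUM_ne_zero (p := (t, E)) hE _
  have hP : D.wallVP (t, E) D.N / D.wallUP (t, E) D.N ≠ 0 := by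
    refine div_ne_zero ?_ (wallUP_ne_zero (p := (t, E)) hE _)
    rw [← norm_ne_zero_iff, norm_wallP (p := (t, E)) hE, norm_ne_zero_iff]
    exact wallUP_ne_zero (p := (t, E)) hE _
  rw [exp_totalAngle (p := (t, E)) hE] at h4
  have h5 : ((deriv (fun F => D.totalAngle (t, F)) E + l : ℝ) : ℂ) = (k : ℝ) := by
    apply mul_left_cancel₀ (mul_ne_zero Complex.I_ne_zero hP)
    rw [← h4]
    push_cast
    generalize D.wallVM (t, E) D.N / D.wallUM (t, E) D.N = m at hM
    generalize deriv (fun F => D.totalAngle (t, F)) E = d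
    linear_combination (-(D.wallVP (t, E) D.N / D.wallUP (t, E) D.N) * I * (d + l)) *
      mul_inv_cancel₀ hM
  have h6 : deriv (fun F => D.totalAngle (t, F)) E + l = k := by exact_mod_cast h5
  linarith

end Dislocation

/-! ### Counting integer crossings -/

lemma eq_of_continuousOn_of_int {α : Type*} [TopologicalSpace α] {s : Set α}
    (hs : IsPreconnected s) {f : α → ℝ} (hf : ContinuousOn f s) (h : ∀ x ∈ s, ∃ n : ℤ, f x = n)
    {x y : α} (hx : x ∈ s) (hy : y ∈ s) : f x = f y := by
  have hn : ∀ x ∈ s, ((round (f x) : ℤ) : ℝ) = f x := fun x hx => by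
    obtain ⟨n, hn⟩ := h x hx
    rw [hn, round_intCast]
  have hc : ContinuousOn (fun x => round (f x)) s := by
    rw [Int.isClosedEmbedding_coe_real.isInducing.continuousOn_iff]
    exact hf.congr hn
  rw [← hn x hx, ← hn y hy, hs.constant hc hx hy]

lemma exists_eq_Ioo {s : Set ℝ} (ho : IsOpen s) (hc : IsPreconnected s) {x : ℝ} (hx : x ∈ s)
    (hb : BddBelow s) (ha : BddAbove s) : ∃ a b, a < b ∧ s = Ioo a b := by
  have h1 := IsConnected.Ioo_csInf_csSup_subset ⟨⟨x, hx⟩, hc⟩ hb ha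
  have h2 : s ⊆ Ioo (sInf s) (sSup s) := fun y hy => by
    obtain ⟨ε, hε, h⟩ := Metric.isOpen_iff.1 ho y hy
    have k1 : y - ε / 2 ∈ s := h (by
      rw [Metric.mem_ball, Real.dist_eq, sub_sub_cancel_left, abs_neg, abs_of_pos] <;> linarith)
    have k2 : y + ε / 2 ∈ s := h (by
      rw [Metric.mem_ball, Real.dist_eq, add_sub_cancel_left, abs_of_pos] <;> linarith)
    exact ⟨by linarith [csInf_le hb k1], by linarith [le_csSup ha k2]⟩
  exact ⟨_, _, (h2 hx).1.trans (h2 hx).2, h2.antisymm h1⟩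

section Crossings

variable {y : ℝ → ℝ}

/-- Floor plus ceiling is 2m + 1 between m and m + 1, and 2m at m. A crossing thus changes it by one
on each side, exactly as a sign function with value 0 at the crossing. -/
lemma floor_add_ceil_of_mem_Ioo {r : ℝ} {m : ℤ} (h : r ∈ Ioo (m : ℝ) (m + 1)) :
    ⌊r⌋ + ⌈r⌉ = 2 * m + 1 := by
  have h1 : ⌊r⌋ = m := Int.floor_eq_iff.2 ⟨h.1.le, h.2⟩
  have h2 : ⌈r⌉ = m + 1 := Int.ceil_eq_iff.2 ⟨by push_cast; linarith [h.1], by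
    push_cast; exact h.2.le⟩
  rw [h1, h2]; ring

lemma floor_add_ceil_intCast (m : ℤ) : ⌊(m : ℝ)⌋ + ⌈(m : ℝ)⌉ = 2 * m := by
  rw [Int.floor_intCast, Int.ceil_intCast]; ring

lemma mem_Ioo_floor {r : ℝ} (h : ∀ m : ℤ, r ≠ m) : r ∈ Ioo (⌊r⌋ : ℝ) (⌊r⌋ + 1) :=
  ⟨lt_of_le_of_ne (Int.floor_le r) (h _).symm, Int.lt_floor_add_one r⟩

/-- The sum of the floor and the ceiling is locally constant away from the integers. -/
lemma eventually_floor_add_ceil_of_ne {x : ℝ} (hy : ContinuousAt y x) (h : ∀ m : ℤ, y x ≠ m) :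
    ∀ᶠ t in 𝓝 x, (∀ m : ℤ, y t ≠ m) ∧ ⌊y t⌋ + ⌈y t⌉ = ⌊y x⌋ + ⌈y x⌉ := by
  have h1 := mem_Ioo_floor h
  filter_upwards [hy.eventually (isOpen_Ioo.mem_nhds h1)] with t ht
  refine ⟨fun m hm => ?_, ?_⟩
  · rw [hm] at ht
    have k1 : ⌊y x⌋ < m := by exact_mod_cast ht.1
    have k2 : m < ⌊y x⌋ + 1 := by exact_mod_cast ht.2
    omega
  · rw [floor_add_ceil_of_mem_Ioo ht, floor_add_ceil_of_mem_Ioo h1]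

/-- The sum of the floor and the ceiling jumps at transversal crossings of the integers. -/
lemma eventually_floor_add_ceil_of_eq {x d : ℝ} (hy : HasDerivAt y d x) (hd : d ≠ 0) {m : ℤ}
    (h : y x = m) : ∀ᶠ t in 𝓝 x, (t ≠ x → ∀ m : ℤ, y t ≠ m) ∧
      ⌊y t⌋ + ⌈y t⌉ = ⌊y x⌋ + ⌈y x⌉ + (SignType.sign d : ℤ) * (SignType.sign (t - x) : ℤ) := by
  -- The slopes near `x` have the sign of `d`, so y t - m has the sign of d(t - x).
  have h1 : ∀ᶠ t in 𝓝[≠] x, 0 < d * slope y x t :=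
    ((hasDerivAt_iff_tendsto_slope.1 hy).const_mul d).eventually
      (lt_mem_nhds (mul_self_pos.2 hd))
  have h2 : ∀ᶠ t in 𝓝 x, y t ∈ Ioo (m - 1 : ℝ) (m + 1) :=
    hy.continuousAt.eventually (isOpen_Ioo.mem_nhds (by rw [h]; constructor <;> linarith))
  filter_upwards [eventually_nhdsWithin_iff.1 h1, h2] with t k1 k2
  rcases eq_or_ne t x with rfl | htx
  · simp
  have k3 := k1 htx
  have htx' : t - x ≠ 0 := sub_ne_zero.2 htx
  rw [slope_def_field, h] at k3
  have k4 : y t - m = (y t - m) / (t - x) * (t - x) := by field_simp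
  have key : (0 < d * (t - x) ∧ (m : ℝ) < y t) ∨ (d * (t - x) < 0 ∧ y t < m) := by
    have k5 : 0 < d * (t - x) * (y t - m) := by
      have : d * (t - x) * (y t - m) = d * ((y t - m) / (t - x)) * (t - x) ^ 2 := by
        field_simp
      rw [this]; positivity
    rcases pos_and_pos_or_neg_and_neg_of_mul_pos k5 with k | k
    · exact Or.inl ⟨k.1, by linarith [k.2]⟩
    · exact Or.inr ⟨k.1, by linarith [k.2]⟩
  have hs : (SignType.sign d : ℤ) * (SignType.sign (t - x) : ℤ) =
      (SignType.sign (d * (t - x)) : ℤ) := by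
    rw [sign_mul]; push_cast; rfl
  rw [hs, h, floor_add_ceil_intCast]
  rcases key with ⟨s1, s2⟩ | ⟨s1, s2⟩
  · have k5 : y t ∈ Ioo (m : ℝ) (m + 1) := ⟨s2, k2.2⟩
    refine ⟨fun _ n hn => ?_, ?_⟩
    · rw [hn] at k5
      have e1 : m < n := by exact_mod_cast k5.1
      have e2 : n < m + 1 := by exact_mod_cast k5.2
      omega
    · rw [floor_add_ceil_of_mem_Ioo k5, sign_pos s1]; rfl
  · have k5 : y t ∈ Ioo ((m - 1 : ℤ) : ℝ) ((m - 1 : ℤ) + 1) := by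
      push_cast; exact ⟨k2.1, by linarith⟩
    refine ⟨fun _ n hn => ?_, ?_⟩
    · rw [hn] at k5
      have e1 : m - 1 < n := by exact_mod_cast k5.1
      have e2 : n < m - 1 + 1 := by exact_mod_cast k5.2
      omega
    · rw [floor_add_ceil_of_mem_Ioo k5, sign_neg s1]
      change _ = 2 * m + (-1)
      ring

lemma eventually_sign_sub {x s : ℝ} (h : x ≠ s) :
    ∀ᶠ t in 𝓝 x, SignType.sign (t - s) = SignType.sign (x - s) := by
  rcases lt_or_gt_of_ne h with h | h
  · filter_upwards [gt_mem_nhds h] with t ht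
    rw [sign_neg (sub_neg.2 ht), sign_neg (sub_neg.2 h)]
  · filter_upwards [lt_mem_nhds h] with t ht
    rw [sign_pos (sub_pos.2 ht), sign_pos (sub_pos.2 h)]

/-- The set of the integer crossings of `y` on the unit interval. -/
def integerTimes (y : ℝ → ℝ) : Set ℝ := {t | t ∈ Icc (0 : ℝ) 1 ∧ ∃ m : ℤ, y t = m}

/-- Infinitely many crossings would accumulate in [0, 1]. But transversal crossings are isolated,
and a non-integer value stays non-integer nearby. -/
lemma finite_integerTimes (hy : Differentiable ℝ y) (hd : ∀ t ∈ integerTimes y, deriv y t ≠ 0) :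
    (integerTimes y).Finite := by
  by_contra hinf
  obtain ⟨x, hx, hacc⟩ := Set.Infinite.exists_accPt_of_subset_isCompact hinf
    (isCompact_Icc (a := (0 : ℝ)) (b := 1)) (fun t ht => ht.1)
  have h1 : ∀ᶠ t in 𝓝 x, t ≠ x → ∀ m : ℤ, y t ≠ m := by
    by_cases h : ∃ m : ℤ, y x = m
    · obtain ⟨m, hm⟩ := h
      exact (eventually_floor_add_ceil_of_eq (hy x).hasDerivAt (hd x ⟨hx, m, hm⟩) hm).mono
        fun t ht => ht.1
    · push Not at h
      exact (eventually_floor_add_ceil_of_ne (hy x).continuousAt h).mono fun t ht _ => ht.1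
  obtain ⟨t, ht, ht1⟩ := ((accPt_iff_frequently.1 hacc).and_eventually h1).exists
  obtain ⟨m, hm⟩ := ht.2.2
  exact ht1 ht.1 m hm

/-- A function that increases by one, between values that are not integers, crosses the integers
once, counting with signs. -/
lemma sum_sign_deriv (hy : Differentiable ℝ y) (hd : ∀ t ∈ integerTimes y, deriv y t ≠ 0)
    (h0 : ∀ m : ℤ, y 0 ≠ m) (h1 : y 1 = y 0 + 1) :
    ∑ᶠ t ∈ integerTimes y, (SignType.sign (deriv y t) : ℤ) = 1 := by
  have hfin := finite_integerTimes hy hd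
  set T := hfin.toFinset with hT
  have hmem : ∀ {t}, t ∈ T ↔ t ∈ integerTimes y := hfin.mem_toFinset
  set σ : ℝ → ℤ := fun t => (SignType.sign (deriv y t) : ℤ) with hσ
  rw [finsum_mem_eq_finite_toFinset_sum _ hfin]
  change ∑ t ∈ T, σ t = 1
  -- Floor plus ceiling with its jumps removed: locally constant, hence constant on [0, 1].
  set C : ℝ → ℤ := fun t => ⌊y t⌋ + ⌈y t⌉ - ∑ s ∈ T, σ s * (SignType.sign (t - s) : ℤ) with hC
  have hloc : ∀ x ∈ Icc (0 : ℝ) 1, ∀ᶠ t in 𝓝 x, C t = C x := by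
    intro x hx
    have e1 : ∀ᶠ t in 𝓝 x, ∀ s ∈ T.erase x, SignType.sign (t - s) = SignType.sign (x - s) := by
      rw [Finset.eventually_all]
      exact fun s hs => eventually_sign_sub (Finset.ne_of_mem_erase hs).symm
    by_cases h : x ∈ T
    · obtain ⟨m, hm⟩ := (hmem.1 h).2
      filter_upwards [e1, eventually_floor_add_ceil_of_eq (hy x).hasDerivAt
        (hd x (hmem.1 h)) hm] with t k1 k2
      simp only [hC]
      rw [k2.2, ← Finset.add_sum_erase T _ h, ← Finset.add_sum_erase T _ h,
        Finset.sum_congr rfl fun s hs => by rw [k1 s hs]]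
      simp [hσ]
      ring
    · have h' : ∀ m : ℤ, y x ≠ m := fun m hm => h (hmem.2 ⟨hx, m, hm⟩)
      rw [Finset.erase_eq_of_notMem h] at e1
      filter_upwards [e1, eventually_floor_add_ceil_of_ne (hy x).continuousAt h'] with t k1 k2
      simp only [hC]
      rw [k2.2, Finset.sum_congr rfl fun s hs => by rw [k1 s hs]]
  have hcont : ContinuousOn C (Icc 0 1) := fun x hx =>
    (continuousAt_const.congr ((hloc x hx).mono fun t ht => ht.symm)).continuousWithinAt
  have h01 := isPreconnected_Icc.constant hcont (left_mem_Icc.2 zero_le_one)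
    (right_mem_Icc.2 zero_le_one)
  -- All crossings are interior, so the signs of t - s are -1 at t = 0 and 1 at t = 1. Comparing the
  -- two values of `C` gives 2 = 2∑σ.
  have hT0 : ∀ s ∈ T, 0 < s ∧ s < 1 := fun s hs => by
    obtain ⟨⟨k1, k2⟩, m, hm⟩ := hmem.1 hs
    refine ⟨lt_of_le_of_ne k1 fun h => h0 m (by rw [h]; exact hm), lt_of_le_of_ne k2 fun h => ?_⟩
    rw [h, h1] at hm
    exact h0 (m - 1) (by push_cast; linarith)
  have s0 : ∑ s ∈ T, σ s * (SignType.sign (0 - s) : ℤ) = -∑ s ∈ T, σ s := by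
    rw [← Finset.sum_neg_distrib]
    refine Finset.sum_congr rfl fun s hs => ?_
    rw [sign_neg (by linarith [(hT0 s hs).1])]
    simp
  have s1 : ∑ s ∈ T, σ s * (SignType.sign (1 - s) : ℤ) = ∑ s ∈ T, σ s := by
    refine Finset.sum_congr rfl fun s hs => ?_
    rw [sign_pos (by linarith [(hT0 s hs).2])]
    simp
  simp only [hC] at h01
  rw [s0, s1, h1, Int.floor_add_one, Int.ceil_add_one] at h01
  linarith

end Crossings

/-! ### Spectral flow of a family with an energy lifting -/

/-- The eigenvalues of the domain wall family in the gap `(a, b)` are the integer levels of the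
function `f` of time and energy, which is increasing in the energy and increases by one over a
period. -/
structure IsEnergyLifting (V χ : ℝ → ℝ) (a b : ℝ) (f : ℝ × ℝ → ℝ) : Prop where
  lt : a < b
  contDiffAt : ∀ p : ℝ × ℝ, p.2 ∈ Ioo a b → ContDiffAt ℝ 1 f p
  deriv_pos : ∀ t, ∀ E ∈ Ioo a b, 0 < deriv (fun F => f (t, F)) E
  one : ∀ E ∈ Ioo a b, f (1, E) = f (0, E) + 1
  zero : ∀ E ∈ Ioo a b, ∀ m : ℤ, f (0, E) ≠ m
  isEigenvalue_iff : ∀ t, ∀ E ∈ Ioo a b,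
    IsEigenvalue (wallOp V χ t) (E : ℝ) ↔ ∃ m : ℤ, f (t, E) = m

/-- The times at which the level `c` of `f` is attained at some energy in `(a, b)`. -/
def levelTimes (a b : ℝ) (f : ℝ × ℝ → ℝ) (c : ℝ) : Set ℝ := {t | ∃ E ∈ Ioo a b, f (t, E) = c}

open Classical in
/-- The energy in `(a, b)` at which the level `c` of `f` is attained. -/
def levelEnergy (a b : ℝ) (f : ℝ × ℝ → ℝ) (c t : ℝ) : ℝ :=
  if h : ∃ E ∈ Ioo a b, f (t, E) = c then h.choose else 0

namespace IsEnergyLifting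

variable {V χ : ℝ → ℝ} {a b : ℝ} {f : ℝ × ℝ → ℝ} {c t E : ℝ}

lemma levelEnergy_spec (ht : t ∈ levelTimes a b f c) :
    levelEnergy a b f c t ∈ Ioo a b ∧ f (t, levelEnergy a b f c t) = c := by
  have ht' : ∃ E ∈ Ioo a b, f (t, E) = c := ht
  rw [levelEnergy, dif_pos ht']
  exact ht'.choose_spec

lemma continuousAt_energy (h : IsEnergyLifting V χ a b f) (t : ℝ) (hE : E ∈ Ioo a b) :
    ContinuousAt (fun F => f (t, F)) E :=
  ContinuousAt.comp (f := fun F : ℝ => ((t, F) : ℝ × ℝ)) (x := E)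
    (h.contDiffAt (t, E) hE).continuousAt
    (by fun_prop : Continuous fun F : ℝ => ((t, F) : ℝ × ℝ)).continuousAt

lemma continuousAt_time (h : IsEnergyLifting V χ a b f) (t : ℝ) (hE : E ∈ Ioo a b) :
    ContinuousAt (fun s => f (s, E)) t :=
  ContinuousAt.comp (f := fun s : ℝ => ((s, E) : ℝ × ℝ)) (x := t)
    (h.contDiffAt (t, E) hE).continuousAt
    (by fun_prop : Continuous fun s : ℝ => ((s, E) : ℝ × ℝ)).continuousAt

lemma strictMonoOn (h : IsEnergyLifting V χ a b f) (t : ℝ) :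
    StrictMonoOn (fun F => f (t, F)) (Ioo a b) :=
  strictMonoOn_of_deriv_pos (convex_Ioo a b)
    (fun _ hE => (h.continuousAt_energy t hE).continuousWithinAt)
    (fun E hE => h.deriv_pos t E (by rwa [interior_Ioo] at hE))

lemma eq_levelEnergy (h : IsEnergyLifting V χ a b f) (hE : E ∈ Ioo a b) (hf : f (t, E) = c) :
    t ∈ levelTimes a b f c ∧ levelEnergy a b f c t = E := by
  have ht : t ∈ levelTimes a b f c := ⟨E, hE, hf⟩
  have h1 := levelEnergy_spec ht
  exact ⟨ht, (h.strictMonoOn t).injOn h1.1 hE (h1.2.trans hf.symm)⟩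

/-- The level sets are locally graphs over the time. -/
lemma exists_local (h : IsEnergyLifting V χ a b f) (hE : E ∈ Ioo a b) (hf : f (t, E) = c) :
    ∃ ψ : ℝ → ℝ, ψ t = E ∧ ContDiffAt ℝ 1 ψ t ∧ ∀ᶠ s in 𝓝 t, ψ s ∈ Ioo a b ∧ f (s, ψ s) = c := by
  have hc := h.contDiffAt (t, E) hE
  have hd : HasDerivAt (fun F => f (t, F))
      ((fderiv ℝ f (t, E) ∘L ContinuousLinearMap.inr ℝ ℝ ℝ) 1) E := by
    have h1 := (hc.differentiableAt one_ne_zero).hasFDerivAt.comp_hasDerivAt (f := fun F => (t, F)) E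
      ((hasDerivAt_const E t).prodMk (hasDerivAt_id E))
    exact h1
  have hpos := h.deriv_pos t E hE
  rw [hd.deriv] at hpos
  -- The partial derivative in the energy is multiplication by a positive number, so the implicit
  -- function theorem applies.
  have hinv : (fderiv ℝ f (t, E) ∘L ContinuousLinearMap.inr ℝ ℝ ℝ).IsInvertible := by
    set A := fderiv ℝ f (t, E) ∘L ContinuousLinearMap.inr ℝ ℝ ℝ with hA
    refine ⟨ContinuousLinearEquiv.unitsEquivAut ℝ (Units.mk0 (A 1) hpos.ne'), ?_⟩
    ext
    simp
  refine ⟨hc.implicitFunction one_ne_zero hinv, hc.implicitFunction_apply_self one_ne_zero hinv,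
    hc.contDiffAt_implicitFunction one_ne_zero hinv, ?_⟩
  have h2 := (hc.contDiffAt_implicitFunction one_ne_zero hinv).continuousAt
  have h3 : hc.implicitFunction one_ne_zero hinv t ∈ Ioo a b := by
    rw [show hc.implicitFunction one_ne_zero hinv t = E from
      hc.implicitFunction_apply_self one_ne_zero hinv]
    exact hE
  filter_upwards [h2.eventually (isOpen_Ioo.mem_nhds h3),
    hc.eventually_apply_implicitFunction one_ne_zero hinv] with s k1 k2
  exact ⟨k1, k2.trans hf⟩

lemma eventually_levelTimes (h : IsEnergyLifting V χ a b f) (ht : t ∈ levelTimes a b f c) :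
    ∀ᶠ s in 𝓝 t, s ∈ levelTimes a b f c := by
  obtain ⟨E, hE, hf⟩ := ht
  obtain ⟨ψ, -, -, h1⟩ := h.exists_local hE hf
  exact h1.mono fun s hs => ⟨_, hs⟩

lemma isOpen_levelTimes (h : IsEnergyLifting V χ a b f) (c : ℝ) : IsOpen (levelTimes a b f c) :=
  isOpen_iff_mem_nhds.2 fun _ ht => h.eventually_levelTimes ht

lemma contDiffAt_levelEnergy (h : IsEnergyLifting V χ a b f) (ht : t ∈ levelTimes a b f c) :
    ContDiffAt ℝ 1 (levelEnergy a b f c) t := by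
  obtain ⟨E, hE, hf⟩ := ht
  obtain ⟨ψ, -, h1, h2⟩ := h.exists_local hE hf
  exact h1.congr_of_eventuallyEq (h2.mono fun s hs => (h.eq_levelEnergy hs.1 hs.2).2)

/-- The level moves in the direction opposite to the one of the lifting. -/
lemma sign_deriv_levelEnergy (h : IsEnergyLifting V χ a b f) (ht : t ∈ levelTimes a b f c) :
    SignType.sign (deriv (levelEnergy a b f c) t) =
      -SignType.sign (deriv (fun s => f (s, levelEnergy a b f c t)) t) := by
  obtain ⟨hE, hf⟩ := levelEnergy_spec ht
  set e := levelEnergy a b f c with he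
  have hF := ((h.contDiffAt (t, e t) hE).differentiableAt one_ne_zero).hasFDerivAt
  have h1 : HasDerivAt (fun s => f (s, e t)) (fderiv ℝ f (t, e t) (1, 0)) t :=
    hF.comp_hasDerivAt (f := fun s => (s, e t)) t
      ((hasDerivAt_id t).prodMk (hasDerivAt_const t (e t)))
  have h2 : HasDerivAt (fun F => f (t, F)) (fderiv ℝ f (t, e t) (0, 1)) (e t) :=
    hF.comp_hasDerivAt (f := fun F => (t, F)) (e t)
      ((hasDerivAt_const (e t) t).prodMk (hasDerivAt_id (e t)))
  have hde := ((h.contDiffAt_levelEnergy ht).differentiableAt one_ne_zero).hasDerivAt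
  have h3 : HasDerivAt (fun s => f (s, e s)) (fderiv ℝ f (t, e t) (1, deriv e t)) t :=
    hF.comp_hasDerivAt (f := fun s => (s, e s)) t ((hasDerivAt_id t).prodMk hde)
  -- `f` is constant along the level: ∂ₜf + e' ∂_E f = 0, with ∂_E f > 0.
  have h4 : HasDerivAt (fun s => f (s, e s)) 0 t :=
    (hasDerivAt_const t c).congr_of_eventuallyEq
      ((h.eventually_levelTimes ht).mono fun s hs => (levelEnergy_spec hs).2)
  have h5 := h3.unique h4
  have h6 := h.deriv_pos t (e t) hE
  rw [h2.deriv] at h6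
  have h7 : ((1, deriv e t) : ℝ × ℝ) = (1, 0) + deriv e t • (0, 1) := by simp
  rw [h7, map_add, map_smul, smul_eq_mul] at h5
  rw [h1.deriv, ← Left.sign_neg, show -(fderiv ℝ f (t, e t) (1, 0)) =
    deriv e t * fderiv ℝ f (t, e t) (0, 1) by linarith, sign_mul, sign_pos h6, mul_one]

/-- At the boundary of the set of times of a level, the energy tends to an edge of the gap. -/
lemma tendsto_levelEnergy (h : IsEnergyLifting V χ a b f) (ht : t ∉ levelTimes a b f c) :
    ∃ e ∈ frontier (Ioo a b),
      Tendsto (levelEnergy a b f c) (𝓝[levelTimes a b f c] t) (𝓝 e) := by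
  have hne : ∀ E ∈ Ioo a b, f (t, E) ≠ c := fun E hE hf => ht ⟨E, hE, hf⟩
  have hcont : ContinuousOn (fun F => f (t, F)) (Ioo a b) := fun E hE =>
    (h.continuousAt_energy t hE).continuousWithinAt
  rw [frontier_Ioo h.lt]
  have hmid : (a + b) / 2 ∈ Ioo a b := ⟨by linarith [h.lt], by linarith [h.lt]⟩
  -- At such a time f(t, ·) - c keeps one sign on (a, b). If negative, then for each z < b one has
  -- f(s, z) < c for s near t, and monotonicity puts the level above z: the limit is b. If positive,
  -- the limit is a.
  rcases lt_or_gt_of_ne (hne _ hmid) with hlt | hgt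
  · have hall : ∀ E ∈ Ioo a b, f (t, E) < c := fun E hE => by
      by_contra! hge
      obtain ⟨F, hF, hF'⟩ := isPreconnected_Ioo.intermediate_value hmid hE hcont ⟨hlt.le, hge⟩
      exact hne F hF hF'
    refine ⟨b, by simp, tendsto_order.2 ⟨fun y hy => ?_, fun y hy => ?_⟩⟩
    · set z := max y ((a + b) / 2) with hz
      have hzm : z ∈ Ioo a b := ⟨hmid.1.trans_le (le_max_right _ _), max_lt hy hmid.2⟩
      filter_upwards [nhdsWithin_le_nhds ((h.continuousAt_time t hzm).eventually
        (gt_mem_nhds (hall z hzm))), self_mem_nhdsWithin] with s k1 k2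
      obtain ⟨k3, k4⟩ := levelEnergy_spec k2
      by_contra! k5
      have := (h.strictMonoOn s).monotoneOn k3 hzm (k5.trans (le_max_left _ _))
      linarith
    · filter_upwards [self_mem_nhdsWithin] with s k2
      exact (levelEnergy_spec k2).1.2.trans hy
  · have hall : ∀ E ∈ Ioo a b, c < f (t, E) := fun E hE => by
      by_contra! hge
      obtain ⟨F, hF, hF'⟩ := isPreconnected_Ioo.intermediate_value hE hmid hcont ⟨hge, hgt.le⟩
      exact hne F hF hF'
    refine ⟨a, by simp, tendsto_order.2 ⟨fun y hy => ?_, fun y hy => ?_⟩⟩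
    · filter_upwards [self_mem_nhdsWithin] with s k2
      exact hy.trans (levelEnergy_spec k2).1.1
    · set z := min y ((a + b) / 2) with hz
      have hzm : z ∈ Ioo a b := ⟨lt_min hy hmid.1, (min_le_right _ _).trans_lt hmid.2⟩
      filter_upwards [nhdsWithin_le_nhds ((h.continuousAt_time t hzm).eventually
        (lt_mem_nhds (hall z hzm))), self_mem_nhdsWithin] with s k1 k2
      obtain ⟨k3, k4⟩ := levelEnergy_spec k2
      by_contra! k5
      have := (h.strictMonoOn s).monotoneOn hzm k3 ((min_le_left _ _).trans k5)
      linarith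

/-- At time 0 no integer value is taken, and the values at time 1 are larger by one. So a level
started in [0, 1] stays there. -/
lemma ne_zero_one (h : IsEnergyLifting V χ a b f) (m : ℤ) :
    (0 : ℝ) ∉ levelTimes a b f m ∧ (1 : ℝ) ∉ levelTimes a b f m := by
  constructor
  · rintro ⟨E, hE, hf⟩
    exact h.zero E hE m hf
  · rintro ⟨E, hE, hf⟩
    rw [h.one E hE] at hf
    exact h.zero E hE (m - 1) (by push_cast; linarith)

/-! ### Branches -/

/-- A branch follows a level of the lifting, on a maximal interval. -/
lemma branch_level (h : IsEnergyLifting V χ a b f) (B : Branch V χ (Ioo a b)) {t : ℝ}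
    (ht : t ∈ Ioo B.left B.right) {m : ℤ} (hm : f (t, B.energy t) = m) :
    (∀ s ∈ Ioo B.left B.right, s ∈ levelTimes a b f m ∧ levelEnergy a b f m s = B.energy s) ∧
      B.left ∉ levelTimes a b f m ∧ B.right ∉ levelTimes a b f m := by
  have hint : ∀ s ∈ Ioo B.left B.right, ∃ n : ℤ, f (s, B.energy s) = n := fun s hs =>
    (h.isEigenvalue_iff s _ (B.mem_gap s hs)).1 (B.isEigenvalue s hs)
  have hcont : ContinuousOn (fun s => f (s, B.energy s)) (Ioo B.left B.right) := fun s hs => by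
    have h1 := (B.contDiffOn.continuousOn s hs)
    exact ContinuousAt.comp_continuousWithinAt (f := fun s => (s, B.energy s)) (x := s)
      (h.contDiffAt (s, B.energy s) (B.mem_gap s hs)).continuousAt
      (continuousWithinAt_id.prodMk h1)
  have h1 : ∀ s ∈ Ioo B.left B.right,
      s ∈ levelTimes a b f m ∧ levelEnergy a b f m s = B.energy s := fun s hs =>
    h.eq_levelEnergy (B.mem_gap s hs)
      ((eq_of_continuousOn_of_int isPreconnected_Ioo hcont hint hs ht).trans hm)
  -- At an end point that still belongs to the level, the energy would converge to a point inside
  -- the open gap and not to an edge.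
  have hlim : ∀ s ∈ levelTimes a b f m, ∀ l : Filter ℝ, l.NeBot → l ≤ 𝓝 s →
      Ioo B.left B.right ∈ l → ¬ ∃ e ∈ frontier (Ioo a b), Tendsto B.energy l (𝓝 e) := by
    rintro s hs l hl hls hIoo ⟨e, he, hte⟩
    have h2 := (h.contDiffAt_levelEnergy hs).continuousAt.tendsto.mono_left hls
    have h3 : Tendsto B.energy l (𝓝 (levelEnergy a b f m s)) :=
      h2.congr' (mem_of_superset hIoo fun r hr => (h1 r hr).2)
    rw [← tendsto_nhds_unique h3 hte, isOpen_Ioo.frontier_eq] at he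
    exact he.2 (levelEnergy_spec hs).1
  refine ⟨h1, fun hs => ?_, fun hs => ?_⟩
  · exact hlim _ hs (𝓝[>] B.left) inferInstance nhdsWithin_le_nhds
      (Ioo_mem_nhdsGT B.left_lt_right) B.tendsto_left
  · exact hlim _ hs (𝓝[<] B.right) inferInstance nhdsWithin_le_nhds
      (Ioo_mem_nhdsLT B.left_lt_right) B.tendsto_right

/-- Two branches through the same point follow the same level, and each ends only where the level is
not attained; so no end of one lies inside the interval of the other. -/
lemma branch_unique (h : IsEnergyLifting V χ a b f) {B B' : Branch V χ (Ioo a b)} {t E : ℝ}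
    (ht : t ∈ B.crossings E) (ht' : t ∈ B'.crossings E) : B = B' := by
  obtain ⟨m, hm⟩ := (h.isEigenvalue_iff t _ (B.mem_gap t ht.1)).1 (B.isEigenvalue t ht.1)
  have hm' : f (t, B'.energy t) = m := by rw [ht'.2, ← ht.2, hm]
  obtain ⟨k1, k2, k3⟩ := h.branch_level B ht.1 hm
  obtain ⟨l1, l2, l3⟩ := h.branch_level B' ht'.1 hm'
  have o1 := ht.1
  have o2 := ht'.1
  have e1 : B.left = B'.left := by
    apply le_antisymm
    · by_contra! hlt
      exact k2 (l1 _ ⟨hlt, o1.1.trans o2.2⟩).1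
    · by_contra! hlt
      exact l2 (k1 _ ⟨hlt, o2.1.trans o1.2⟩).1
  have e2 : B.right = B'.right := by
    apply le_antisymm
    · by_contra! hlt
      exact l3 (k1 _ ⟨o1.1.trans o2.2, hlt⟩).1
    · by_contra! hlt
      exact k3 (l1 _ ⟨o2.1.trans o1.2, hlt⟩).1
  refine Branch.ext e1 e2 (funext fun s => ?_)
  by_cases hs : s ∈ Ioo B.left B.right
  · rw [← (k1 s hs).2, (l1 s (by rwa [← e1, ← e2])).2]
  · rw [B.eq_zero s hs, B'.eq_zero s (by rwa [← e1, ← e2])]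

/-- The interval of the branch is the connected component of `t` in the open set of times of the
level. It avoids 0 and 1, and at its ends, where the level is no longer attained, the energy tends
to an edge. -/
lemma exists_branch (h : IsEnergyLifting V χ a b f) {t E : ℝ} (ht : t ∈ Icc (0 : ℝ) 1)
    (hE : E ∈ Ioo a b) {m : ℤ} (hm : f (t, E) = m) :
    ∃ B : Branch V χ (Ioo a b), t ∈ B.crossings E := by
  obtain ⟨htS, hte⟩ := h.eq_levelEnergy hE hm
  set S := levelTimes a b f m with hS
  have hSo : IsOpen S := h.isOpen_levelTimes m
  obtain ⟨hS0, hS1⟩ := h.ne_zero_one m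
  set K := connectedComponentIn S t with hK
  have hKS : K ⊆ S := connectedComponentIn_subset S t
  have hKt : t ∈ K := mem_connectedComponentIn htS
  have hKc : IsPreconnected K := isPreconnected_connectedComponentIn
  have hK01 : K ⊆ Icc 0 1 := fun s hs => by
    constructor
    · by_contra! hlt
      exact hS0 (hKS (hKc.ordConnected.out hs hKt ⟨hlt.le, ht.1⟩))
    · by_contra! hlt
      exact hS1 (hKS (hKc.ordConnected.out hKt hs ⟨ht.2, hlt.le⟩))
  obtain ⟨l, r, hlr, hKeq⟩ := exists_eq_Ioo hSo.connectedComponentIn hKc hKt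
    (bddBelow_Icc.mono hK01) (bddAbove_Icc.mono hK01)
  have hmax : ∀ s, IsPreconnected (insert s K) → s ∈ S → s ∈ K := fun s hs hsS =>
    hs.subset_connectedComponentIn (mem_insert_of_mem s hKt) (insert_subset hsS hKS)
      (mem_insert s K)
  have hKIoo : K = Ioo l r := hKeq
  have hl : l ∉ S := fun hs => by
    have : l ∈ K := hmax l (by rw [hKIoo, Ioo_insert_left hlr]; exact isPreconnected_Ico) hs
    rw [hKIoo] at this
    exact lt_irrefl _ this.1
  have hr : r ∉ S := fun hs => by
    have : r ∈ K := hmax r (by rw [hKIoo, Ioo_insert_right hlr]; exact isPreconnected_Ioc) hs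
    rw [hKIoo] at this
    exact lt_irrefl _ this.2
  have hcl : closure K ⊆ Icc 0 1 := isClosed_Icc.closure_subset_iff.2 hK01
  rw [hKIoo, closure_Ioo hlr.ne] at hcl
  have hIS : ∀ s ∈ Ioo l r, s ∈ S := fun s hs => hKS (by rwa [hKIoo])
  set e : ℝ → ℝ := (Ioo l r).indicator (levelEnergy a b f m) with he
  have hee : ∀ s ∈ Ioo l r, e s = levelEnergy a b f m s := fun s hs => indicator_of_mem hs _
  have htl : t ∈ Ioo l r := by rwa [← hKIoo]
  refine ⟨⟨l, r, e, (hcl (left_mem_Icc.2 hlr.le)).1, hlr, (hcl (right_mem_Icc.2 hlr.le)).2,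
    fun s hs => ?_, fun s hs => ?_, fun s hs => ?_, ?_, ?_, fun s hs => indicator_of_notMem hs _⟩,
    htl, (hee t htl).trans hte⟩
  · exact (h.contDiffAt_levelEnergy (hIS s hs)).contDiffWithinAt.congr hee (hee s hs)
  · rw [hee s hs]
    exact (levelEnergy_spec (hIS s hs)).1
  · rw [hee s hs]
    obtain ⟨k1, k2⟩ := levelEnergy_spec (hIS s hs)
    exact (h.isEigenvalue_iff s _ k1).2 ⟨m, k2⟩
  · obtain ⟨z, hz, hz'⟩ := h.tendsto_levelEnergy hl
    refine ⟨z, hz, ?_⟩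
    have h1 : Ioo l r ∈ 𝓝[>] l := Ioo_mem_nhdsGT hlr
    refine (hz'.mono_left (nhdsWithin_le_iff.2 ?_ : 𝓝[>] l ≤ 𝓝[S] l)).congr' ?_
    · exact mem_of_superset h1 hIS
    · exact mem_of_superset h1 fun s hs => (hee s hs).symm
  · obtain ⟨z, hz, hz'⟩ := h.tendsto_levelEnergy hr
    refine ⟨z, hz, ?_⟩
    have h1 : Ioo l r ∈ 𝓝[<] r := Ioo_mem_nhdsLT hlr
    refine (hz'.mono_left (nhdsWithin_le_iff.2 ?_ : 𝓝[<] r ≤ 𝓝[S] r)).congr' ?_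
    · exact mem_of_superset h1 hIS
    · exact mem_of_superset h1 fun s hs => (hee s hs).symm

lemma existsUnique_branch (h : IsEnergyLifting V χ a b f) (ht : t ∈ Icc (0 : ℝ) 1)
    (hE : E ∈ Ioo a b) (hev : IsEigenvalue (wallOp V χ t) E) :
    ∃! B : Branch V χ (Ioo a b), t ∈ B.crossings E := by
  obtain ⟨m, hm⟩ := (h.isEigenvalue_iff t E hE).1 hev
  obtain ⟨B, hB⟩ := h.exists_branch ht hE hm
  exact ⟨B, hB, fun B' hB' => h.branch_unique hB' hB⟩

/-- The slope of a branch at a crossing. -/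
lemma branch_deriv (h : IsEnergyLifting V χ a b f) (B : Branch V χ (Ioo a b))
    (ht : t ∈ B.crossings E) : E ∈ Ioo a b ∧ ∃ m : ℤ, f (t, E) = m ∧ t ∈ levelTimes a b f m ∧
      levelEnergy a b f m t = E ∧ deriv B.energy t = deriv (levelEnergy a b f m) t ∧
      SignType.sign (deriv B.energy t) = -SignType.sign (deriv (fun s => f (s, E)) t) := by
  have hE : E ∈ Ioo a b := by rw [← ht.2]; exact B.mem_gap t ht.1
  obtain ⟨m, hm⟩ := (h.isEigenvalue_iff t _ (B.mem_gap t ht.1)).1 (B.isEigenvalue t ht.1)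
  obtain ⟨k1, -, -⟩ := h.branch_level B ht.1 hm
  have h1 : deriv B.energy t = deriv (levelEnergy a b f m) t := EventuallyEq.deriv_eq <| by
    filter_upwards [isOpen_Ioo.mem_nhds ht.1] with s hs
    exact (k1 s hs).2.symm
  have h2 := (k1 t ht.1).2.trans ht.2
  have h3 := h.sign_deriv_levelEnergy (k1 t ht.1).1
  rw [h2, ← h1] at h3
  rw [ht.2] at hm
  exact ⟨hE, m, hm, (k1 t ht.1).1, h2, h1, h3⟩

/-! ### Regular energies and the spectral flow -/

lemma ae_isRegularEnergy (h : IsEnergyLifting V χ a b f) :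
    ∀ᵐ E : ℝ, E ∈ Ioo a b → IsRegularEnergy V χ (Ioo a b) E := by
  -- One-dimensional Sard: the critical values of each level form a null set, there are countably
  -- many integer levels, and each branch follows one of them.
  set Z : ℤ → Set ℝ := fun m => {t | t ∈ levelTimes a b f m ∧ deriv (levelEnergy a b f m) t = 0}
  have hnull : ∀ m : ℤ, volume (levelEnergy a b f m '' Z m) = 0 := fun m => by
    refine addHaar_image_eq_zero_of_det_fderivWithin_eq_zero volume (f' := fun _ => 0)
      (fun t ht => ?_) (fun t _ => ?_)
    · have h1 := ((h.contDiffAt_levelEnergy ht.1).differentiableAt one_ne_zero).hasDerivAt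
      rw [ht.2] at h1
      simpa using h1.hasFDerivAt.hasFDerivWithinAt
    · simp [ContinuousLinearMap.det]
  have h1 : volume (⋃ m : ℤ, levelEnergy a b f m '' Z m) = 0 := measure_iUnion_null hnull
  filter_upwards [measure_eq_zero_iff_ae_notMem.1 h1] with E hE _ B t ht hd
  obtain ⟨-, m, -, k1, k2, k3, -⟩ := h.branch_deriv B ht
  exact hE (mem_iUnion.2 ⟨m, t, ⟨k1, k3 ▸ hd⟩, k2⟩)

/-- Crossings of `E` by branches correspond one to one to the integer times of f(·, E), with
opposite slopes; the two minus signs cancel. -/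
lemma flow (h : IsEnergyLifting V χ a b f) (hE : E ∈ Ioo a b)
    (hreg : IsRegularEnergy V χ (Ioo a b) E) :
    {p : Branch V χ (Ioo a b) × ℝ | p.2 ∈ p.1.crossings E}.Finite ∧
      spectralFlowAt V χ (Ioo a b) E = 1 := by
  set P := {p : Branch V χ (Ioo a b) × ℝ | p.2 ∈ p.1.crossings E} with hP
  set y : ℝ → ℝ := fun t => f (t, E) with hy
  have hyd : Differentiable ℝ y := fun t =>
    ((h.contDiffAt (t, E) hE).differentiableAt one_ne_zero).comp t
      (f := fun s : ℝ => ((s, E) : ℝ × ℝ)) (by fun_prop)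
  have hbij : BijOn Prod.snd P (integerTimes y) := by
    refine ⟨?_, ?_, ?_⟩
    · rintro ⟨B, t⟩ ht
      obtain ⟨-, m, hm, -⟩ := h.branch_deriv B ht
      exact ⟨⟨B.left_nonneg.trans ht.1.1.le, ht.1.2.le.trans B.right_le_one⟩, m, hm⟩
    · rintro ⟨B, t⟩ ht ⟨B', t'⟩ ht' heq
      obtain rfl : t = t' := heq
      exact Prod.ext (h.branch_unique ht ht') rfl
    · rintro t ⟨ht, m, hm⟩
      obtain ⟨B, hB⟩ := h.exists_branch ht hE hm
      exact ⟨⟨B, t⟩, hB, rfl⟩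
  have hd : ∀ t ∈ integerTimes y, deriv y t ≠ 0 := fun t ht h0 => by
    obtain ⟨⟨B, t'⟩, ht', rfl⟩ := hbij.surjOn ht
    obtain ⟨-, m, -, -, -, -, hs⟩ := h.branch_deriv B ht'
    rw [h0, sign_zero, neg_zero, sign_eq_zero_iff] at hs
    exact hreg B _ ht' hs
  have hPfin : P.Finite := hbij.finite_iff_finite.2 (finite_integerTimes hyd hd)
  refine ⟨hPfin, ?_⟩
  classical
  -- The iterated sum over branches and crossings becomes a single sum over pairs, which is finite
  -- and is carried to the integer times.
  set G : Branch V χ (Ioo a b) × ℝ → ℤ := fun p =>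
    ∑ᶠ _ : p.2 ∈ p.1.crossings E, ((SignType.sign (deriv p.1.energy p.2) : SignType) : ℤ) with hG
  have hsupp : Function.HasFiniteSupport G := hPfin.subset fun p hp => by
    by_contra hp'
    have : IsEmpty (p.2 ∈ p.1.crossings E) := ⟨hp'⟩
    exact hp (finsum_of_isEmpty _)
  have h1 := finsum_curry G hsupp
  have h2 : ∑ᶠ p : Branch V χ (Ioo a b) × ℝ, G p =
      ∑ᶠ t ∈ integerTimes y, -(SignType.sign (deriv y t) : ℤ) := by
    refine finsum_mem_eq_of_bijOn Prod.snd hbij fun p hp => ?_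
    obtain ⟨-, m, -, -, -, -, hs⟩ := h.branch_deriv p.1 hp
    rw [hs]
    cases SignType.sign (deriv (fun s => f (s, E)) p.2) <;> rfl
  have h3 := sum_sign_deriv hyd hd (h.zero E hE) (h.one E hE)
  rw [spectralFlowAt]
  change -∑ᶠ B, ∑ᶠ t, G (B, t) = 1
  rw [← h1, h2, finsum_mem_neg_distrib _ (finite_integerTimes hyd hd), neg_neg, h3]

lemma hasSpectralFlow (h : IsEnergyLifting V χ a b f) : HasSpectralFlow V χ (Ioo a b) 1 :=
  ⟨fun _ ht _ hE hev => h.existsUnique_branch ht hE hev, h.ae_isRegularEnergy,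
    fun _ hE hreg => h.flow hE hreg⟩

end IsEnergyLifting

/-! ### Eigenfunctions -/

section Eigen

variable {q : ℝ → ℂ} {z : ℂ}

lemma exists_isSol_of_mem_eigenspace {f : L2Spinor} (hf : f ∈ eigenspace (diracOp (offDiag q)) z) :
    ∃ y : ℝ → Spinor, f =ᵐ[volume] y ∧ IsSol q z (fun x => y x 0) (fun x => y x 1) ∧
      SqInt univ (fun x => y x 0) (fun x => y x 1) := by
  have hf' : (f, z • f) ∈ (diracOp (offDiag q)).graph := hf
  rw [diracOp_graph] at hf'
  obtain ⟨y, w, hyw, hfy, hAf⟩ := hf'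
  simp only at hfy hAf
  refine ⟨y, hfy, isSol_of_diracExpr hyw ?_, ?_⟩
  · filter_upwards [hfy, hAf, Lp.coeFn_smul z f] with x h1 h2 h3
    rw [← h2, h3, Pi.smul_apply, h1]
  · have hyL : MemLp y 2 := (Lp.memLp f).ae_eq hfy
    rw [SqInt, Measure.restrict_univ]
    rw [memLp_piLp_iff] at hyL
    exact ⟨hyL 0, hyL 1⟩

lemma IsSol.exists_mem_eigenspace {u v : ℝ → ℂ} (h : IsSol q z u v) (hu : SqInt univ u v) :
    ∃ f ∈ eigenspace (diracOp (offDiag q)) z, f =ᵐ[volume] fun x => (!₂[u x, v x] : Spinor) := by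
  set y : ℝ → Spinor := fun x => !₂[u x, v x] with hy
  have hyL : MemLp y 2 := by
    rw [SqInt, Measure.restrict_univ] at hu
    rw [memLp_piLp_iff, Fin.forall_fin_two]
    exact ⟨hu.1, hu.2⟩
  refine ⟨hyL.toLp y, ?_, hyL.coeFn_toLp⟩
  change (_, _) ∈ (diracOp (offDiag q)).graph
  rw [diracOp_graph]
  have h' : IsSol q z (fun x => y x 0) (fun x => y x 1) := h
  obtain ⟨w, h1, h2⟩ := h'.exists_hasLocalDeriv
  refine ⟨y, w, h1, hyL.coeFn_toLp, ?_⟩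
  filter_upwards [hyL.coeFn_toLp, Lp.coeFn_smul z (hyL.toLp y)] with x k1 k2
  rw [k2, Pi.smul_apply, k1, h2]

lemma isEigenvalue_iff_exists_isSol {E : ℝ} :
    IsEigenvalue (diracOp (offDiag q)) E ↔
      ∃ u v, IsSol q E u v ∧ SqInt univ u v ∧ ∃ x, u x ≠ 0 := by
  rw [IsEigenvalue, Submodule.ne_bot_iff]
  constructor
  · rintro ⟨f, hf, hf0⟩
    obtain ⟨y, hfy, hs, hS⟩ := exists_isSol_of_mem_eigenspace hf
    refine ⟨_, _, hs, hS, ?_⟩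
    by_contra! hcon
    refine hf0 ((Lp.eq_zero_iff_ae_eq_zero).2 (hfy.trans (ae_of_all _ fun x => ?_)))
    have h1 := hs.norm_eq Real.volume_univ hS x
    simp only [hcon x, norm_zero, norm_eq_zero] at h1
    ext i
    fin_cases i
    · exact hcon x
    · exact h1
  · rintro ⟨u, v, hs, hS, x, hx⟩
    obtain ⟨f, hf, hfy⟩ := hs.exists_mem_eigenspace hS
    refine ⟨f, hf, fun h0 => hx ?_⟩
    have h1 : (fun x => (!₂[u x, v x] : Spinor)) =ᵐ[volume] fun _ => 0 := by
      rw [h0] at hfy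
      exact hfy.symm.trans (Lp.coeFn_zero Spinor 2 (volume : Measure ℝ))
    have h2 : u =ᵐ[volume] fun _ => 0 := by
      filter_upwards [h1] with s hs'
      have := congrArg (fun w : Spinor => w 0) hs'
      simpa using this
    exact congrFun ((Continuous.ae_eq_iff_eq volume hs.1.continuous continuous_const).1 h2) x

lemma eigenvalue_im_eq_zero (hz : IsEigenvalue (diracOp (offDiag q)) z) : z.im = 0 := by
  by_contra him
  obtain ⟨f, hf, hf0⟩ := (Submodule.ne_bot_iff _).1 hz
  obtain ⟨y, hfy, hs, hS⟩ := exists_isSol_of_mem_eigenspace hf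
  refine hf0 ((Lp.eq_zero_iff_ae_eq_zero).2 (hfy.trans (ae_of_all _ fun x => ?_)))
  have h1 := hs.eq_zero_of_im_ne_zero him hS x
  ext i
  fin_cases i
  · exact h1.1
  · exact h1.2

/-- Eigenvalues are simple. -/
lemma finrank_eigenspace (hq : LocallyIntegrable q) {E : ℝ}
    (hE : IsEigenvalue (diracOp (offDiag q)) E) :
    Module.finrank ℂ (eigenspace (diracOp (offDiag q)) E) = 1 := by
  obtain ⟨u, v, hs, hS, x, hx⟩ := isEigenvalue_iff_exists_isSol.1 hE
  obtain ⟨f, hf, hfy⟩ := hs.exists_mem_eigenspace hS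
  have key : ∀ h ∈ eigenspace (diracOp (offDiag q)) (E : ℂ), ∃ c : ℂ, c • f = h := by
    intro h hh
    obtain ⟨y, hy, hs', hS'⟩ := exists_isSol_of_mem_eigenspace hh
    have h1 := hs'.eq_smul_of_sqInt hq hs Real.volume_univ hS' hS (y := x) (c := y x 0 / u x)
      (by field_simp)
    refine ⟨y x 0 / u x, Lp.ext ?_⟩
    filter_upwards [hy, hfy, Lp.coeFn_smul (y x 0 / u x) f] with s k1 k2 k3
    rw [k3, k1, Pi.smul_apply, k2]
    ext i
    fin_cases i
    · simpa using (h1 s).1.symm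
    · simpa using (h1 s).2.symm
  obtain ⟨h, hh, hh0⟩ := (Submodule.ne_bot_iff _).1 hE
  have hf0 : f ≠ 0 := fun h0 => hh0 (by
    obtain ⟨c, hc⟩ := key h hh
    rw [← hc, h0, smul_zero])
  refine (finrank_eq_one_iff_of_nonzero' (⟨f, hf⟩ : eigenspace (diracOp (offDiag q)) (E : ℂ))
    (fun h0 => hf0 (congrArg Subtype.val h0))).2 fun h => ?_
  obtain ⟨c, hc⟩ := key h h.2
  exact ⟨c, Subtype.ext hc⟩

end Eigen

lemma exists_exp_bound_of_tails {f : ℝ → ℂ} (hf : Continuous f) {N C C' c c' : ℝ} (hc : 0 < c)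
    (hc' : 0 < c') (h : ∀ x, N ≤ x → ‖f x‖ ≤ C * Real.exp (-c * |x|))
    (h' : ∀ x, x ≤ -N → ‖f x‖ ≤ C' * Real.exp (-c' * |x|)) :
    ∃ K k : ℝ, 0 < k ∧ ∀ x, ‖f x‖ ≤ K * Real.exp (-k * |x|) := by
  obtain ⟨M, hM⟩ := isCompact_Icc.exists_bound_of_continuousOn (hf.continuousOn (s := Icc (-N) N))
  set k := min c c' with hk
  have e1 : ∀ x, Real.exp (-c * |x|) ≤ Real.exp (-k * |x|) := fun x => by
    gcongr; exact min_le_left _ _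
  have e2 : ∀ x, Real.exp (-c' * |x|) ≤ Real.exp (-k * |x|) := fun x => by
    gcongr; exact min_le_right _ _
  have hk0 : 0 < k := lt_min hc hc'
  -- The last term covers the middle segment, where exp(-k|x|) ≥ exp(-kN).
  refine ⟨|C| + |C'| + |M| * Real.exp (k * N), k, hk0, fun x => ?_⟩
  have p1 : 0 ≤ |M| * Real.exp (k * N) := by positivity
  rcases le_total N x with hx | hx
  · calc ‖f x‖ ≤ C * Real.exp (-c * |x|) := h x hx
      _ ≤ |C| * Real.exp (-k * |x|) :=
        mul_le_mul (le_abs_self C) (e1 x) (Real.exp_pos _).le (abs_nonneg _)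
      _ ≤ _ := by gcongr; linarith [abs_nonneg C']
  rcases le_total x (-N) with hx' | hx'
  · calc ‖f x‖ ≤ C' * Real.exp (-c' * |x|) := h' x hx'
      _ ≤ |C'| * Real.exp (-k * |x|) :=
        mul_le_mul (le_abs_self C') (e2 x) (Real.exp_pos _).le (abs_nonneg _)
      _ ≤ _ := by gcongr; linarith [abs_nonneg C]
  · calc ‖f x‖ ≤ M := hM x ⟨hx', hx⟩
      _ ≤ |M| * 1 := by rw [mul_one]; exact le_abs_self M
      _ ≤ |M| * (Real.exp (k * N) * Real.exp (-k * |x|)) := by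
        gcongr
        rw [← Real.exp_add]
        refine Real.one_le_exp ?_
        have : |x| ≤ N := abs_le.2 ⟨hx', hx⟩
        nlinarith
      _ = (|M| * Real.exp (k * N)) * Real.exp (-k * |x|) := by ring
      _ ≤ _ := by gcongr; linarith [abs_nonneg C, abs_nonneg C']

/-! ### Exponential localisation and the criterion for eigenvalues. -/

namespace Dislocation

variable {D : Dislocation} {t E : ℝ}

/-- Square integrable solutions of the domain wall equation are exponentially localised. -/
lemma exists_exp_bound_of_isSol {u v : ℝ → ℂ} (h : IsSol (D.q t) E u v) (hu : SqInt univ u v) :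
    ∃ K k : ℝ, 0 < k ∧ ∀ x, ‖u x‖ ≤ K * Real.exp (-k * |x|) := by
  have hN : (0 : ℝ) ≤ D.N := Nat.cast_nonneg _
  have hqr : LocallyIntegrable fun x => rot t * D.q 0 x :=
    LocallyIntegrable.continuous_mul' (D.locallyIntegrable_q 0) continuous_const
  -- The right tail extends to a solution of the rotated periodic equation on the whole line, to
  -- which Floquet theory applies; likewise for the left tail and the unrotated equation.
  obtain ⟨a, b, hab, ha, hb⟩ := IsSol.exists_initial hqr E D.N (u D.N) (v D.N)
  have hr : ∀ x, (D.N : ℝ) ≤ x → u x = a x ∧ v x = b x := fun x hx =>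
    h.eqOn_of_eq (D.locallyIntegrable_q t) hab (y := D.N) (fun s hs => by
      rw [uIoc_of_le hx] at hs
      exact D.q_right t hs.1.le) ha.symm hb.symm
  have hS : SqInt (Ici 0) a b := by
    have h1 : SqInt (Ici (D.N : ℝ)) a b := (hu.mono (subset_univ _)).congr measurableSet_Ici
      (fun x hx => (hr x hx).1) (fun x hx => (hr x hx).2)
    refine ((SqInt.of_continuous hab.1.continuous hab.2.continuous 0 D.N).union h1).mono ?_
    intro x hx
    rcases le_total x D.N with h3 | h3
    · exact Or.inl ⟨hx, h3⟩
    · exact Or.inr h3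
  obtain ⟨l, hl, hm⟩ := hab.exists_multiplier_plus hqr
    (fun x => by simp only [D.periodic_q_zero x]) hS
  obtain ⟨C, c, hc, h1⟩ := exists_exp_bound hab.1.continuous hl fun x => (hm x).1
  obtain ⟨a', b', hab', ha', hb'⟩ :=
    IsSol.exists_initial (D.locallyIntegrable_q 0) E (-D.N) (u (-D.N)) (v (-D.N))
  have hr' : ∀ x, x ≤ -(D.N : ℝ) → u x = a' x ∧ v x = b' x := fun x hx =>
    h.eqOn_of_eq (D.locallyIntegrable_q t) hab' (y := -D.N) (fun s hs => by
      rw [uIoc_of_ge hx] at hs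
      exact D.q_left t hs.2) ha'.symm hb'.symm
  have hS' : SqInt (Iic 0) a' b' := by
    have h1 : SqInt (Iic (-(D.N : ℝ))) a' b' := (hu.mono (subset_univ _)).congr measurableSet_Iic
      (fun x hx => (hr' x hx).1) (fun x hx => (hr' x hx).2)
    refine ((SqInt.of_continuous hab'.1.continuous hab'.2.continuous (-D.N) 0).union h1).mono ?_
    intro x hx
    rcases le_total (-(D.N : ℝ)) x with h3 | h3
    · exact Or.inl ⟨h3, hx⟩
    · exact Or.inr h3
  obtain ⟨l', hl', hm'⟩ := hab'.exists_multiplier_minus (D.locallyIntegrable_q 0)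
    D.periodic_q_zero hS'
  obtain ⟨C', c', hc', h1'⟩ := exists_exp_bound (f := fun x => a' (-x))
    (hab'.1.continuous.comp continuous_neg) hl' fun x => by
      have := (hm' (-x)).1
      rwa [← neg_add] at this
  refine exists_exp_bound_of_tails (N := D.N) (C := C) (C' := C') h.1.continuous hc hc' (fun x hx => ?_) fun x hx => ?_
  · rw [abs_of_nonneg (hN.trans hx), (hr x hx).1]
    exact h1 x (hN.trans hx)
  · have := h1' (-x) (by linarith)
    rwa [neg_neg, ← abs_of_nonpos (by linarith : x ≤ 0), ← (hr' x hx).1] at this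

lemma expLocalised_of_mem_eigenspace {f : L2Spinor}
    (hf : f ∈ eigenspace (diracOp (offDiag (D.q t))) (E : ℂ)) : ExpLocalised f := by
  obtain ⟨y, hfy, hs, hS⟩ := exists_isSol_of_mem_eigenspace hf
  obtain ⟨K, k, hk, hb⟩ := exists_exp_bound_of_isSol hs hS
  -- Both components have the same modulus, so the norm is √2 |u| ≤ 2|u|.
  refine ⟨2 * K, k, hk, ?_⟩
  filter_upwards [hfy] with x hx
  have h1 := hs.norm_eq Real.volume_univ hS x
  have h2 := hb x
  simp only at h1 h2
  rw [hx, EuclideanSpace.norm_eq, Fin.sum_univ_two, h1]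
  have h3 : √(‖y x 0‖ ^ 2 + ‖y x 0‖ ^ 2) ≤ 2 * ‖y x 0‖ :=
    Real.sqrt_le_iff.2 ⟨by positivity, by nlinarith [sq_nonneg ‖y x 0‖]⟩
  linarith

/-- The spectrum of the domain wall operators in terms of the total angle. -/
lemma isEigenvalue_iff (hE : E ∈ D.hyp) : IsEigenvalue (diracOp (offDiag (D.q t))) E ↔
    ∃ m : ℤ, D.totalAngle (t, E) / (2 * Real.pi) = m := by
  have hp : ((t, E) : ℝ × ℝ).2 ∈ D.hyp := hE
  have h1 := exp_totalAngle hp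
  have hUP := wallUP_ne_zero hp
  have hUM := wallUM_ne_zero hp
  have hVM : D.wallVM (t, E) D.N ≠ 0 := by
    rw [← norm_ne_zero_iff, norm_wallM hp, norm_ne_zero_iff]; exact hUM _
  -- The exponential of i times the total angle is the ratio of the two phases at N.
  have h2 : (∃ m : ℤ, D.totalAngle (t, E) / (2 * Real.pi) = m) ↔
      D.wallVP (t, E) D.N / D.wallUP (t, E) D.N = D.wallVM (t, E) D.N / D.wallUM (t, E) D.N := by
    rw [← div_eq_one_iff_eq (div_ne_zero hVM (hUM _)),
      div_eq_mul_inv (D.wallVP _ _ / _) (D.wallVM _ _ / _), ← h1, Complex.exp_eq_one_iff]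
    refine exists_congr fun m => ?_
    rw [div_eq_iff (by positivity)]
    constructor
    · intro h
      rw [h]; push_cast; ring
    · intro h
      have h3 : I * (D.totalAngle (t, E) : ℂ) = I * ((m * (2 * Real.pi) : ℝ) : ℂ) := by
        rw [h]; push_cast; ring
      exact_mod_cast mul_left_cancel₀ Complex.I_ne_zero h3
  rw [h2, isEigenvalue_iff_exists_isSol]
  constructor
  · rintro ⟨u, v, hs, hS, x, hx⟩
    have hN : u D.N ≠ 0 := fun h0 =>
      hx (hs.eq_zero_of_sqInt (D.locallyIntegrable_q t) Real.volume_univ hS h0 x).1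
    have e1 := ((D.isSol_wallP (t, E)).eq_smul_of_sqInt (D.locallyIntegrable_q t) hs
      Real.volume_Ici (sqInt_wallP hp) (hS.mono (subset_univ _)) (y := D.N)
      (c := D.wallUP (t, E) D.N / u D.N) (by field_simp) D.N).2
    have e2 := ((D.isSol_wallM (t, E)).eq_smul_of_sqInt (D.locallyIntegrable_q t) hs
      Real.volume_Iic (sqInt_wallM hp) (hS.mono (subset_univ _)) (y := D.N)
      (c := D.wallUM (t, E) D.N / u D.N) (by field_simp) D.N).2
    have k1 := hUP D.N
    have k2 := hUM D.N
    rw [e1, e2]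
    field_simp
  · intro h
    have k1 := hUP D.N
    have k2 := hUM D.N
    -- Equal phases at N make the data there proportional, so the two decaying solutions are
    -- proportional and the left one also decays to the right.
    have h3 := fun x => (D.isSol_wallM (t, E)).eqOn_of_eq (D.locallyIntegrable_q t)
      ((D.isSol_wallP (t, E)).smul (D.wallUM (t, E) D.N / D.wallUP (t, E) D.N)) (y := D.N)
      (x := x) (fun _ _ => rfl) (by field_simp) (by
        rw [div_eq_div_iff k1 k2] at h
        field_simp
        linear_combination -h)
    have h4 := (sqInt_wallP hp).smul (D.wallUM (t, E) D.N / D.wallUP (t, E) D.N)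
    refine ⟨_, _, D.isSol_wallM (t, E), ?_, D.N, k2⟩
    refine ((sqInt_wallM hp).union (h4.congr measurableSet_Ici (fun x _ => (h3 x).1.symm)
      (fun x _ => (h3 x).2.symm))).mono fun x _ => ?_
    exact le_total x 0

/-! ### Gaps -/

lemma gap_subset_hyp {E : ℝ} (hE : InResolventSet (diracOp (offDiag (D.q 0))) E) : E ∈ D.hyp := by
  obtain ⟨u, v, hs, hS, h0⟩ := exists_decaying_of_inResolventSet (D.locallyIntegrable_q 0) hE
  exact one_lt_re_sq_of_decaying (D.locallyIntegrable_q 0) D.periodic_q_zero (D.isSol' 0 E)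
    (D.a_zero _) (D.b_zero _) hs hS h0

/-- The Prüfer angle over a period in the bulk is an integer multiple of `2π`. -/
lemma angleP_period (hE : E ∈ D.hyp) :
    ∃ m : ℤ, D.angleP D.N (D.N + 1) (0, E) / (2 * Real.pi) = m := by
  have hp : ((0, E) : ℝ × ℝ).2 ∈ D.hyp := hE
  have h1 := phaseP_wall hp D.N (D.N + 1)
  have hs : (smallRoot (D.halfTrace E) : ℂ) ≠ 0 := fun h0 => by
    have := smallRoot_mul_largeRoot (T := D.halfTrace E) hE
    rw [Complex.ofReal_eq_zero.1 h0, zero_mul] at this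
    exact zero_ne_one this
  have hV : D.wallVP (0, E) D.N / D.wallUP (0, E) D.N ≠ 0 := by
    refine div_ne_zero ?_ (wallUP_ne_zero hp _)
    rw [← norm_ne_zero_iff, norm_wallP hp, norm_ne_zero_iff]
    exact wallUP_ne_zero hp _
  -- The Floquet multiplier is common to both components and cancels in the phase.
  have h2 : D.wallVP (0, E) (D.N + 1) / D.wallUP (0, E) (D.N + 1) =
      D.wallVP (0, E) D.N / D.wallUP (0, E) D.N := by
    rw [(D.wallP_eq _ le_rfl).1, (D.wallP_eq _ le_rfl).2,
      (D.wallP_eq _ (by linarith : (D.N : ℝ) ≤ D.N + 1)).1,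
      (D.wallP_eq _ (by linarith : (D.N : ℝ) ≤ D.N + 1)).2, (shiftP hE _).1, (shiftP hE _).2,
      mul_left_comm, mul_div_mul_left _ _ hs]
  rw [h2, eq_comm, mul_eq_left₀ hV, Complex.exp_eq_one_iff] at h1
  obtain ⟨m, hm⟩ := h1
  refine ⟨m, ?_⟩
  rw [div_eq_iff (by positivity)]
  have h3 : I * (D.angleP D.N (D.N + 1) (0, E) : ℂ) = I * ((m * (2 * Real.pi) : ℝ) : ℂ) := by
    rw [hm]; push_cast; ring
  exact_mod_cast mul_left_cancel₀ Complex.I_ne_zero h3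

/-- The Prüfer rate differs from -2E by at most 2|q|. This gives the boundedness of gaps, on which
the angle over a period is constant. -/
lemma abs_angleP_add_le (hE : E ∈ D.hyp) : |D.angleP D.N (D.N + 1) (0, E) + 2 * E| ≤
    ∫ s in (D.N : ℝ)..D.N + 1, 2 * ‖D.q 0 s‖ := by
  have hp : ((0, E) : ℝ × ℝ).2 ∈ D.hyp := hE
  have hle : (D.N : ℝ) ≤ D.N + 1 := by linarith
  have hq := (LocallyIntegrable.norm' (D.locallyIntegrable_q 0)).smul (2 : ℝ)
  have hc : Continuous fun s => D.wallVP (0, E) s / D.wallUP (0, E) s :=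
    (D.isSol_wallP _).2.continuous.div (D.isSol_wallP _).1.continuous (wallUP_ne_zero hp)
  have hr := LocallyIntegrable.intervalIntegrable'
    (locallyIntegrable_pruferRate (D.locallyIntegrable_q 0) hc E) D.N (D.N + 1)
  have h1 : D.angleP D.N (D.N + 1) (0, E) + 2 * E = ∫ s in (D.N : ℝ)..D.N + 1,
      (pruferRate (D.q 0) (fun s => D.wallVP (0, E) s / D.wallUP (0, E) s) E s + 2 * E) := by
    rw [intervalIntegral.integral_add hr intervalIntegrable_const, intervalIntegral.integral_const]
    simp [angleP]
  rw [h1, ← Real.norm_eq_abs]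
  refine intervalIntegral.norm_integral_le_of_norm_le hle (ae_of_all _ fun s _ => ?_)
    (LocallyIntegrable.intervalIntegrable' hq _ _)
  have e1 : pruferRate (D.q 0) (fun s => D.wallVP (0, E) s / D.wallUP (0, E) s) E s + 2 * E =
      2 * (conj (D.q 0 s) * (D.wallVP (0, E) s / D.wallUP (0, E) s)).re := by
    rw [pruferRate]; ring
  rw [e1, Real.norm_eq_abs, abs_mul, abs_two]
  gcongr
  refine (Complex.abs_re_le_norm _).trans ?_
  rw [norm_mul, RCLike.norm_conj, norm_div, norm_wallP hp,
    div_self (norm_ne_zero_iff.2 (wallUP_ne_zero hp s)), mul_one]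

lemma exists_gap_eq_Ioo {g : Set ℝ} (hg : IsGap (diracOp (offDiag (D.q 0))) g) :
    (∃ a b, a < b ∧ g = Ioo a b) ∧
      ∀ E ∈ g, E ∈ D.hyp ∧ InResolventSet (diracOp (offDiag (D.q 0))) E := by
  obtain ⟨E₀, hE₀, rfl⟩ := hg
  set R := {e : ℝ | InResolventSet (diracOp (offDiag (D.q 0))) e} with hR
  set g := connectedComponentIn R E₀ with hg
  have hgR : ∀ E ∈ g, E ∈ D.hyp ∧ InResolventSet (diracOp (offDiag (D.q 0))) E := fun E hE =>
    have h1 : E ∈ R := connectedComponentIn_subset R E₀ hE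
    ⟨gap_subset_hyp h1, h1⟩
  have hgc : IsPreconnected g := isPreconnected_connectedComponentIn
  have h0 : E₀ ∈ g := mem_connectedComponentIn hE₀
  refine ⟨?_, hgR⟩
  have hcont : ContinuousOn (fun E => D.angleP D.N (D.N + 1) (0, E) / (2 * Real.pi)) g :=
    fun E hE => (ContinuousAt.comp (f := fun E : ℝ => ((0, E) : ℝ × ℝ)) (x := E)
      (continuousAt_angleP (p := (0, E)) (hgR E hE).1 _ _)
      (by fun_prop : Continuous fun E : ℝ => ((0, E) : ℝ × ℝ)).continuousAt
      |>.div_const _).continuousWithinAt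
  -- The angle over a period is continuous with values in 2πℤ on a connected set.
  have hconst : ∀ E ∈ g, D.angleP D.N (D.N + 1) (0, E) = D.angleP D.N (D.N + 1) (0, E₀) :=
    fun E hE => by
      have := eq_of_continuousOn_of_int hgc hcont (fun E hE => angleP_period (hgR E hE).1) hE h0
      rwa [div_left_inj' (by positivity)] at this
  have hbd : ∀ E ∈ g, |D.angleP D.N (D.N + 1) (0, E₀) + 2 * E| ≤
      ∫ s in (D.N : ℝ)..D.N + 1, 2 * ‖D.q 0 s‖ := fun E hE => by
    rw [← hconst E hE]
    exact abs_angleP_add_le (hgR E hE).1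
  refine exists_eq_Ioo (isOpen_resolventSet _).connectedComponentIn hgc h0
    ⟨(-(∫ s in (D.N : ℝ)..D.N + 1, 2 * ‖D.q 0 s‖) - D.angleP D.N (D.N + 1) (0, E₀)) / 2,
      fun E hE => ?_⟩
    ⟨((∫ s in (D.N : ℝ)..D.N + 1, 2 * ‖D.q 0 s‖) - D.angleP D.N (D.N + 1) (0, E₀)) / 2,
      fun E hE => ?_⟩
  · linarith [(abs_le.1 (hbd E hE)).1]
  · linarith [(abs_le.1 (hbd E hE)).2]

/-- The total angle is a lifting of the eigenvalues in a gap. -/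
lemma isEnergyLifting {a b : ℝ} (hab : a < b) (hg : ∀ E ∈ Ioo a b, E ∈ D.hyp ∧
    InResolventSet (diracOp (offDiag (D.q 0))) E) :
    IsEnergyLifting D.V D.χ a b fun p => D.totalAngle p / (2 * Real.pi) where
  lt := hab
  contDiffAt p hp := (contDiffAt_totalAngle (hg _ hp).1).div_const _
  deriv_pos t E hE := by
    rw [deriv_div_const]
    exact div_pos (deriv_totalAngle_pos (hg E hE).1 t) (by positivity)
  one E hE := by
    have := Real.pi_pos
    rw [D.totalAngle_one]
    field_simp
  -- At time 0 the wall operator is the bulk operator, which has no eigenvalue in its resolvent set.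
  zero E hE m hm :=
    not_isEigenvalue_of_inResolventSet (hg E hE).2 ((isEigenvalue_iff (hg E hE).1).2 ⟨m, hm⟩)
  isEigenvalue_iff t E hE := by
    rw [wallOp, D.wallPotential_eq]
    exact isEigenvalue_iff (hg E hE).1

end Dislocation

lemma exists_dislocation {V χ : ℝ → ℝ} {L : ℝ} (hV_per : Function.Periodic V 1)
    (hV_int : LocallyIntegrable V) (hχ : MemLp χ ⊤) (hχ_left : ∀ x, x < -L → χ x = 1)
    (hχ_right : ∀ x, L < x → χ x = 0) : ∃ D : Dislocation, D.V = V ∧ D.χ = χ := by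
  -- With N strictly above L, the switch function is constant on the closed half-lines bounded by
  -- ±N.
  obtain ⟨N, hN⟩ := exists_nat_gt L
  have hVχ : LocallyIntegrable fun x => V x * χ x := by
    rw [locallyIntegrable_iff] at hV_int ⊢
    exact fun k hk => (hV_int k hk).mul_of_top_left (hχ.restrict k)
  have hV' : LocallyIntegrable fun x => V x * (1 - χ x) := by
    have h1 : V - (fun x => V x * χ x) = fun x => V x * (1 - χ x) := by
      funext x
      simp only [Pi.sub_apply]
      ring
    rw [← h1]
    exact hV_int.sub hVχ
  have hof : ∀ {f : ℝ → ℝ}, LocallyIntegrable f → LocallyIntegrable fun x => (f x : ℂ) :=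
    fun h => by
      rw [locallyIntegrable_iff] at h ⊢
      exact fun k hk => (h k hk).ofReal
  obtain ⟨a, b, h1, h2, h3, h4⟩ := exists_fundamental (hof hVχ) (hof hV')
  exact ⟨⟨V, χ, N, hV_per, hV_int, hVχ, fun x hx => hχ_left x (by linarith),
    fun x hx => hχ_right x (by linarith), a, b, fun p => (h1 p).1, fun p => (h1 p).2.1,
    fun p => (h1 p).2.2, fun x => (h2 x).1, fun x => (h2 x).2, h3, h4⟩, rfl, rfl⟩

end DislocatedDirac

end

open DislocatedDirac

theorem theorem1p2 (V χ : ℝ → ℝ) (L : ℝ)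
    (hV_per : Function.Periodic V 1) (hV_int : LocallyIntegrable V)
    (hχ : MemLp χ ⊤) (hL : 0 < L)
    (hχ_left : ∀ x, x < -L → χ x = 1) (hχ_right : ∀ x, L < x → χ x = 0)
    (g : Set ℝ) (hg : IsGap (diracOp (bulkPotential V 0)) g) :
    HasBulkIndex V g 1 ∧ HasEdgeIndex V χ g 1 ∧ HasSpectralFlow V χ g 1 ∧
      ∀ (t : ℝ) (z : ℂ), IsEigenvalue (wallOp V χ t) z →
        Module.finrank ℂ (eigenspace (wallOp V χ t) z) = 1 ∧
          ∀ f ∈ eigenspace (wallOp V χ t) z, ExpLocalised f := by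
  obtain ⟨D, rfl, rfl⟩ := exists_dislocation hV_per hV_int hχ hχ_left hχ_right
  have h0 : bulkPotential D.V 0 = offDiag (D.q 0) := by
    rw [D.bulkPotential_eq]
    simp only [rot_zero, one_mul]
  rw [h0] at hg
  obtain ⟨⟨a, b, hab, rfl⟩, hgap⟩ := Dislocation.exists_gap_eq_Ioo hg
  refine ⟨fun E hE => ?_, fun E hE => ?_, (Dislocation.isEnergyLifting hab hgap).hasSpectralFlow,
    fun t z hz => ?_⟩
  · simp only [D.bulkPotential_eq]
    exact Dislocation.bulk_index (hgap E hE).1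
  · simp only [D.wallPotential_eq]
    exact Dislocation.edge_index (hgap E hE).1
  · rw [wallOp, D.wallPotential_eq] at hz ⊢
    obtain ⟨E, rfl⟩ : ∃ E : ℝ, z = E :=
      ⟨z.re, Complex.ext rfl (by rw [eigenvalue_im_eq_zero hz, Complex.ofReal_im])⟩
    exact ⟨finrank_eigenspace (D.locallyIntegrable_q t) hz,
      fun f hf => Dislocation.expLocalised_of_mem_eigenspace hf⟩
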